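/- **Setting.** Let $\mathfrak g$ be a simple finite-dimensional complex Lie algebra, $\mathfrak h$ a Cartan subalgebra, $\Omega\subset\mathfrak h^*$ the root system, $\Pi$ a base of $\Omega$, $\Omega^+$ the positive roots. Choose root vectors $E_\alpha\in\mathfrak g_\alpha$ with $(E_\alpha,E_{-\alpha})=1$ for the Killing form. For $\Gamma\subset\Pi$ let $\mathfrak h^*_\Gamma$ be the span of $\Gamma$, $\Omega_\Gamma=\Omega\cap\mathfrak h^*_\Gamma$, $\mathfrak g_\Gamma$ the Levi subalgebra generated by $\mathfrak h$ and the $E_{\pm\alpha}$ ($\alpha\in\Gamma$), and $\mathfrak m$ its invariant complement, spanned by the $E_\gamma$, $\gamma\in\Omega\setminus\Omega_\Gamma$. The *quasiroots* are the nonzero images of the roots in $\mathfrak h^*/\mathfrak h^*_\Gamma$. Let $\lambda\in\mathfrak g^*$ have coadjoint stabilizer $\mathfrak g_\Gamma$; its orbit $M\cong G/G_\Gamma$ is a semisimple orbit, and every semisimple orbit arises so for a suitable $\Gamma$. As usual, the $G$-invariant polyvector fields on $M$ are identified with the $\mathfrak g_\Gamma$-invariant elements of $\Lambda^\bullet\mathfrak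 m\cong\Lambda^\bullet(\mathfrak g/\mathfrak g_\Gamma)$. An *invariant bracket* on $M$ is a $\mathfrak g_\Gamma$-invariant element $f\in\Lambda^2\mathfrak m$. The Schouten bracket of two invariant brackets is the image in $\Lambda^3(\mathfrak g/\mathfrak g_\Gamma)$ of their bracket in $\Lambda^3\mathfrak g$, where $$[\![X_1\wedge X_2,Y_1\wedge Y_2]\!]=\sum_{i,j}(-1)^{i+j}[X_i,Y_j]\wedge X_{3-i}\wedge Y_{3-j}.$$ Let $r=\sum_{\alpha\in\Omega^+}E_\alpha\wedge E_{-\alpha}$, let $\varphi=[\![r,r]\!]$, which is an invariant element of $\Lambda^3\mathfrak g$, and let $\varphi_M$ be its image in $\Lambda^3(\mathfrak g/\mathfrak g_\Gamma)$. The Kirillov–Kostant–Souriau bracket of the orbit is $$v_\lambda=\sum_{\alpha\in\Omega^+\setminus\Omega_\Gamma}\frac1{\lambda([E_\alpha,E_{-\alpha}])}\,E_\alpha\wedge E_{-\alpha}.$$ The orbit $M$ is called *good* if there is an invariant bracket $f$ on $M$ with $[\![f,f]\!]=K^2\varphi_M$ for some complex number $K\neq0$ and $[\![f,v_\lambda]\!]=0$.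 **Proposition 3.5.** (a) If $\mathfrak g$ is of type $A_n$, then every semisimple orbit is good. (b) If $\mathfrak g$ is not of type $A_n$ and $M$ is not a point ($\Gamma\ne\Pi$), then $M$ is good if and only if $\Pi\setminus\Gamma$ consists of one or two simple roots, each of which occurs with coefficient $1$ in the maximal root. (c) For every $\mathfrak g$, $M$ is good if and only if for some $k\ge0$ the set of quasiroots is linearly isomorphic to the root system of type $A_k$ (the empty set for $k=0$, which occurs exactly when $M$ is a point). -/

import Mathlib

open scoped ExteriorAlgebra

noncomputable section

namespace GoodOrbit

open Module LieAlgebra LieAlgebra.IsKilling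

/-! ### Bivectors over a Lie algebra and their Schouten bracket -/

section Schouten

variable {L : Type*} [LieRing L] [LieAlgebra ℂ L]

/-- The bivector `x ∧ y` in `⋀² L`. -/
def wedge (x y : L) : ⋀[ℂ]^2 L := exteriorPower.ιMulti ℂ 2 ![x, y]

/-- The product `x ∧ y` in the exterior algebra, as a bilinear map. -/
def wedgeAlg : L →ₗ[ℂ] L →ₗ[ℂ] ExteriorAlgebra ℂ L :=
  (LinearMap.mul ℂ (ExteriorAlgebra ℂ L)).compl₁₂ (ExteriorAlgebra.ι ℂ) (ExteriorAlgebra.ι ℂ)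

/-- Universal property of `⋀²`: an alternating bilinear map factors through `⋀² L`. -/
def altLift {N : Type*} [AddCommGroup N] [Module ℂ N] (B : L →ₗ[ℂ] L →ₗ[ℂ] N)
    (hB : ∀ x, B x x = 0) : ⋀[ℂ]^2 L →ₗ[ℂ] N :=
  exteriorPower.alternatingMapLinearEquiv
    { toFun := fun v => B (v 0) (v 1)
      map_update_add' := by
        intro _ m i x y
        fin_cases i <;> simp [Function.update]
      map_update_smul' := by
        intro _ m i c x
        fin_cases i <;> simp [Function.update]
      map_eq_zero_of_eq' := by
        intro v i j hij hne
        fin_cases i <;> fin_cases j <;> simp_all }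

theorem altLift_wedge {N : Type*} [AddCommGroup N] [Module ℂ N] (B : L →ₗ[ℂ] L →ₗ[ℂ] N)
    (hB : ∀ x, B x x = 0) (x y : L) : altLift B hB (wedge x y) = B x y := by
  simp [altLift, wedge]

/-- The adjoint action of `x` on bivectors, `x · (y ∧ z) = [x, y] ∧ z + y ∧ [x, z]`. -/
def adBivector (x : L) : ⋀[ℂ]^2 L →ₗ[ℂ] ExteriorAlgebra ℂ L :=
  altLift (wedgeAlg.compl₁₂ (LieAlgebra.ad ℂ L x : L →ₗ[ℂ] L) LinearMap.id
      + wedgeAlg.compl₁₂ LinearMap.id (LieAlgebra.ad ℂ L x : L →ₗ[ℂ] L)) (by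
    intro y
    simp [wedgeAlg, ExteriorAlgebra.ι_add_mul_swap])

theorem adBivector_wedge (x y z : L) :
    adBivector x (wedge y z) = ExteriorAlgebra.ι ℂ ⁅x, y⁆ * ExteriorAlgebra.ι ℂ z
      + ExteriorAlgebra.ι ℂ y * ExteriorAlgebra.ι ℂ ⁅x, z⁆ := by
  simp [adBivector, altLift_wedge, wedgeAlg]

theorem bivector_hom_ext {N : Type*} [AddCommGroup N] [Module ℂ N] {f g : ⋀[ℂ]^2 L →ₗ[ℂ] N}
    (h : ∀ x y, f (wedge x y) = g (wedge x y)) : f = g := by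
  apply exteriorPower.linearMap_ext
  ext v
  have hv : v = ![v 0, v 1] := by
    ext i
    fin_cases i <;> rfl
  rw [hv]
  exact h (v 0) (v 1)

/-- The bilinear map sending `(x, y)` to `w ↦ x ∧ (y · w) - y ∧ (x · w)`. -/
def wedgeAd : L →ₗ[ℂ] L →ₗ[ℂ] (⋀[ℂ]^2 L →ₗ[ℂ] ExteriorAlgebra ℂ L) :=
  LinearMap.mk₂ ℂ
    (fun x y => (LinearMap.mulLeft ℂ (ExteriorAlgebra.ι ℂ x)).comp (adBivector y)
      - (LinearMap.mulLeft ℂ (ExteriorAlgebra.ι ℂ y)).comp (adBivector x))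
    (by
      intro x x' y
      apply bivector_hom_ext
      intro u v
      simp only [LinearMap.comp_apply, LinearMap.add_apply, LinearMap.sub_apply, adBivector_wedge,
        add_lie, map_add, LinearMap.mulLeft_apply, mul_add, add_mul]
      abel)
    (by
      intro c x y
      apply bivector_hom_ext
      intro u v
      simp only [LinearMap.comp_apply, LinearMap.smul_apply, LinearMap.sub_apply, adBivector_wedge,
        smul_lie, map_smul, LinearMap.mulLeft_apply, mul_add, smul_mul_assoc, mul_smul_comm,
        smul_add, smul_sub])
    (by
      intro x y y'
      apply bivector_hom_ext
      intro u v
      simp only [LinearMap.comp_apply, LinearMap.add_apply, LinearMap.sub_apply, adBivector_wedge,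
        add_lie, map_add, LinearMap.mulLeft_apply, mul_add, add_mul]
      abel)
    (by
      intro c x y
      apply bivector_hom_ext
      intro u v
      simp only [LinearMap.comp_apply, LinearMap.smul_apply, LinearMap.sub_apply, adBivector_wedge,
        smul_lie, map_smul, LinearMap.mulLeft_apply, mul_add, smul_mul_assoc, mul_smul_comm,
        smul_add, smul_sub])

/-- The Schouten bracket of two bivectors over `L`; it is a trivector, viewed in the exterior
algebra. Its usual formula is `schouten_wedge` below. -/
def schouten : ⋀[ℂ]^2 L →ₗ[ℂ] ⋀[ℂ]^2 L →ₗ[ℂ] ExteriorAlgebra ℂ L :=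
  altLift wedgeAd (by
    intro x
    simp [wedgeAd])

/-- The formula `⟦X₁ ∧ X₂, Y₁ ∧ Y₂⟧ = ∑ (-1)^(i+j) [Xᵢ, Yⱼ] ∧ (the other X) ∧ (the other Y)`,
which determines the Schouten bracket of bivectors. -/
theorem schouten_wedge (x₁ x₂ y₁ y₂ : L) :
    schouten (wedge x₁ x₂) (wedge y₁ y₂) =
      ExteriorAlgebra.ι ℂ ⁅x₁, y₁⁆ * ExteriorAlgebra.ι ℂ x₂ * ExteriorAlgebra.ι ℂ y₂
      - ExteriorAlgebra.ι ℂ ⁅x₁, y₂⁆ * ExteriorAlgebra.ι ℂ x₂ * ExteriorAlgebra.ι ℂ y₁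
      - ExteriorAlgebra.ι ℂ ⁅x₂, y₁⁆ * ExteriorAlgebra.ι ℂ x₁ * ExteriorAlgebra.ι ℂ y₂
      + ExteriorAlgebra.ι ℂ ⁅x₂, y₂⁆ * ExteriorAlgebra.ι ℂ x₁ * ExteriorAlgebra.ι ℂ y₁ := by
  have swap : ∀ a c : L, ExteriorAlgebra.ι ℂ a * ExteriorAlgebra.ι ℂ c
      = -(ExteriorAlgebra.ι ℂ c * ExteriorAlgebra.ι ℂ a) := fun a c =>
    eq_neg_of_add_eq_zero_left (ExteriorAlgebra.ι_add_mul_swap a c)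
  have key : schouten (wedge x₁ x₂) (wedge y₁ y₂) =
      ExteriorAlgebra.ι ℂ x₁ * (ExteriorAlgebra.ι ℂ ⁅x₂, y₁⁆ * ExteriorAlgebra.ι ℂ y₂
        + ExteriorAlgebra.ι ℂ y₁ * ExteriorAlgebra.ι ℂ ⁅x₂, y₂⁆)
      - ExteriorAlgebra.ι ℂ x₂ * (ExteriorAlgebra.ι ℂ ⁅x₁, y₁⁆ * ExteriorAlgebra.ι ℂ y₂
        + ExteriorAlgebra.ι ℂ y₁ * ExteriorAlgebra.ι ℂ ⁅x₁, y₂⁆) := by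
    rw [schouten, altLift_wedge]
    simp [wedgeAd, adBivector_wedge]
  rw [key, swap y₁ ⁅x₂, y₂⁆, swap y₁ ⁅x₁, y₂⁆, mul_add, mul_add, mul_neg, mul_neg,
    ← mul_assoc, ← mul_assoc, ← mul_assoc, ← mul_assoc, swap x₁ ⁅x₂, y₁⁆, swap x₁ ⁅x₂, y₂⁆,
    swap x₂ ⁅x₁, y₁⁆, swap x₂ ⁅x₁, y₂⁆]
  simp only [neg_mul]
  abel

/-- The stabilizer of `lam ∈ L*` under the coadjoint action `(x · lam) y = -lam [x, y]`. -/
def coadjointStabilizer (lam : Dual ℂ L) : LieSubalgebra ℂ L where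
  carrier := {x | ∀ y, lam ⁅x, y⁆ = 0}
  add_mem' := by
    intro x x' hx hx' y
    simp [hx y, hx' y]
  zero_mem' := by
    intro y
    simp
  smul_mem' := by
    intro c x hx y
    simp [hx y]
  lie_mem' := by
    intro x x' hx hx' y
    rw [lie_lie, map_sub, hx, hx', sub_zero]

end Schouten

/-! ### Root vectors, Levi subalgebras and invariant bivectors -/

section Orbit

variable {L : Type*} [LieRing L] [LieAlgebra ℂ L] [FiniteDimensional ℂ L] [LieAlgebra.IsKilling ℂ L]
  {H : LieSubalgebra ℂ L} [H.IsCartanSubalgebra]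

variable (H) in
/-- A choice of root vectors `E_α`, normalized by `(E_α, E_{-α}) = 1` for the Killing form.
(The value of `vec` at the zero weight is irrelevant.) -/
structure RootVectors where
  vec : LieModule.Weight ℂ H L → L
  mem_rootSpace : ∀ α ∈ H.root, vec α ∈ LieAlgebra.rootSpace H α
  killing_eq_one : ∀ α ∈ H.root, killingForm ℂ L (vec α) (vec (-α)) = 1

/-- The subspace `h*_Γ` of `h*` generated by a set `Γ` of roots. -/
def rootSpan (Γ : Finset H.root) : Submodule ℂ (Dual ℂ H) :=
  Submodule.span ℂ ((rootSystem H).root '' (Γ : Set H.root))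

/-- The root subsystem `Ω_Γ = Ω ∩ h*_Γ`. -/
def leviRoots (Γ : Finset H.root) : Set H.root :=
  {α | (rootSystem H).root α ∈ rootSpan Γ}

/-- The Levi subalgebra `g_Γ`, generated by `h` and the `E_α`, `E_{-α}` with `α ∈ Γ`. -/
def levi (E : RootVectors H) (Γ : Finset H.root) : LieSubalgebra ℂ L :=
  LieSubalgebra.lieSpan ℂ L
    ((H : Set L) ∪ {x | ∃ α ∈ Γ, x = E.vec α.1 ∨ x = E.vec (-α.1)})

/-- The `ad g_Γ`-invariant complement `m` of `g_Γ`, with basis the `E_γ`, `γ ∈ Ω \ Ω_Γ`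
(`γ` positive or negative). -/
def tangent (E : RootVectors H) (Γ : Finset H.root) : Submodule ℂ L :=
  Submodule.span ℂ {x | ∃ γ : H.root, γ ∉ leviRoots Γ ∧ x = E.vec γ.1}

/-- `f` is a `g_Γ`-invariant element of `⋀² m`: such elements are the invariant brackets
(invariant bivector fields) on `M = G / G_Γ`. -/
def IsInvariantBracket (E : RootVectors H) (Γ : Finset H.root) (f : ⋀[ℂ]^2 L) : Prop :=
  f ∈ Submodule.span ℂ {w | ∃ x ∈ tangent E Γ, ∃ y ∈ tangent E Γ, w = wedge x y} ∧
    ∀ x ∈ levi E Γ, adBivector x f = 0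

/-- Reduction modulo `g_Γ ∧ ⋀ L`, that is, the map `⋀ L → ⋀ (L / g_Γ) = ⋀ T_o M` sending a
polyvector over `L` to the value at the base point `o` of the field that it induces on `M`. -/
def toM (E : RootVectors H) (Γ : Finset H.root) :
    ExteriorAlgebra ℂ L →ₐ[ℂ] ExteriorAlgebra ℂ (L ⧸ (levi E Γ).toSubmodule) :=
  ExteriorAlgebra.map (levi E Γ).toSubmodule.mkQ

open Classical in
/-- The Drinfeld-Jimbo `r`-matrix `r = ∑_{α > 0} E_α ∧ E_{-α}`. -/
def rMatrix (b : (rootSystem H).Base) (E : RootVectors H) : ⋀[ℂ]^2 L :=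
  ∑ α : H.root with b.IsPos α, wedge (E.vec α.1) (E.vec (-α.1))

/-- The invariant trivector `φ = ⟦r, r⟧`. -/
def phi (b : (rootSystem H).Base) (E : RootVectors H) : ExteriorAlgebra ℂ L :=
  schouten (rMatrix b E) (rMatrix b E)

open Classical in
/-- The Kirillov-Kostant-Souriau bracket `v_lam = ∑ (1 / lam(α)) E_α ∧ E_{-α}`, summed over the
positive roots outside `Ω_Γ`. Here `lam(α) = lam [E_α, E_{-α}]`, as `[E_α, E_{-α}] ∈ h` is the
element corresponding to `α` under the Killing form; the denominators do not vanish when the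
stabilizer of `lam` is `g_Γ`. -/
def kks (b : (rootSystem H).Base) (E : RootVectors H) (Γ : Finset H.root) (lam : Dual ℂ L) :
    ⋀[ℂ]^2 L :=
  ∑ α : H.root with b.IsPos α ∧ α ∉ leviRoots Γ,
    (lam ⁅E.vec α.1, E.vec (-α.1)⁆)⁻¹ • wedge (E.vec α.1) (E.vec (-α.1))

/-- The orbit `M` of `lam` (with stabilizer `g_Γ`) is good: it carries an invariant bracket `f`
with `⟦f, f⟧ = K² φ_M` for some `K ≠ 0` and `⟦f, v_lam⟧ = 0`. -/
def IsGood (b : (rootSystem H).Base) (E : RootVectors H) (Γ : Finset H.root)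
    (lam : Dual ℂ L) : Prop :=
  ∃ f : ⋀[ℂ]^2 L, IsInvariantBracket E Γ f ∧
    (∃ K : ℂ, K ≠ 0 ∧ toM E Γ (schouten f f) = K ^ 2 • toM E Γ (phi b E)) ∧
    toM E Γ (schouten f (kks b E Γ lam)) = 0

/-- The simple roots can be numbered so that the Cartan matrix is that of type `A_n`. -/
def IsTypeA (b : (rootSystem H).Base) : Prop :=
  ∃ (n : ℕ) (e : b.support ≃ Fin n), ∀ i j, b.cartanMatrix i j = CartanMatrix.A n (e i) (e j)

/-- `θ` is the maximal root: `θ - β` is a sum of simple roots for every root `β`. -/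
def IsMaximalRoot (b : (rootSystem H).Base) (θ : H.root) : Prop :=
  ∀ β : H.root, (rootSystem H).root θ - (rootSystem H).root β ∈
    AddSubmonoid.closure ((rootSystem H).root '' (b.support : Set H.root))

/-- The quasiroots: the nonzero images of the roots in `h* / h*_Γ`. -/
def quasiroots (Γ : Finset H.root) : Set (Dual ℂ H ⧸ rootSpan Γ) :=
  {q | q ≠ 0 ∧ ∃ α : H.root, q = (rootSpan Γ).mkQ ((rootSystem H).root α)}

end Orbit

/-- The roots `e_i - e_j`, `i ≠ j`, of the root system of type `A_k` in `ℂ^(k+1)`. -/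
def rootsA (k : ℕ) : Set (Fin (k + 1) → ℂ) :=
  {v | ∃ i j, i ≠ j ∧ v = Pi.single i 1 - Pi.single j 1}

/-- A subset `S` of a vector space is isomorphic to the root system of type `A_k`: some linear
isomorphism onto the span of the roots of `A_k` maps `S` onto these roots. -/
def IsIsoToRootsA {V : Type*} [AddCommGroup V] [Module ℂ V] (S : Set V) (k : ℕ) : Prop :=
  ∃ e : V ≃ₗ[ℂ] Submodule.span ℂ (rootsA k),
    (fun v => (e v : Fin (k + 1) → ℂ)) '' S = rootsA k

end GoodOrbit

end

/-! Through the Killing form a bivector becomes an endomorphism of `L`. For an invariant bracket `f`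
it commutes with `h`, so it multiplies each `E_α` by a scalar `s α`, and `s` is odd. Write `l α =
lam [E_α, E_{-α}]`; this functional vanishes at a root exactly when the root is in `Ω_Γ`. Tested on
root vectors with `α + β + γ = 0` outside `Ω_Γ`, the condition on `⟦f, f⟧` becomes `s α * s β + s β
* s γ + s γ * s α = -K ^ 2`, and the condition on `⟦f, v_lam⟧` says that the values of `l ^ 2 * s`
add up to zero. So `l ^ 2 * s` extends to a linear functional `m`. Eliminating `s` leaves a
quadratic relation between `l` and `m` (`IsQuadraticPair`), and any such `m` gives back an `f`: see
`exists_isQuadraticPair_of_isGood` and `isGood_of_isQuadraticPair`.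

Put `t = m / (K * l)` and view a root outside `Ω_Γ` as an arrow in `ℂ` from `(t - l) / 2` to `(t +
l) / 2`. The relation reads `t β - t α = ± l (α + β)`: when the sum of two roots is a root, their
arrows can be composed. Hence "tip minus tail" is additive and extends to a linear map sending roots
to differences of basis vectors (`ArrowLabelling.exists_of_sq_eq`). Irreducibility shows that every
arrow between points in use occurs and that roots with equal arrows agree modulo `h*_Γ`, so the
quasiroots form a system `A_k` (`ArrowLabelling.exists_equiv_span_arrows`). Conversely, if `l` is
the difference of a function `x` along arrows, the difference of `x ^ 2` serves as `m`. This is (c),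
and (a) holds because the roots of `A_n` are arrows already.

For (b), order the points by height. Positive roots become intervals, so their coefficients at
simple roots outside `Γ` are `0` or `1`, and the maximal root has `1` there. If three simple roots
are left out, the middle one is not a leaf of the Dynkin diagram, since otherwise the sum of all the
other simple roots would be a root that is no interval. A node with two neighbours and coefficient
one in the maximal root forces type `A`, by dominance of that root. Conversely, if one or two simple
roots are left out, with coefficient one, the coefficients of a root there define an arrow between
three points. -/

section

open Module

namespace RootPairing

variable {ι K M N : Type*} [Field K] [CharZero K] [AddCommGroup M] [Module K M] [AddCommGroup N]
  [Module K N] [Finite ι]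

/-! ### Additive functions on the roots, and consequences of irreducibility. -/

section

variable {P : RootPairing ι K M N} [P.IsCrystallographic]

/-- A function on the roots that is odd, and additive whenever a sum of two roots is a root,
extends to a linear functional. -/
theorem exists_dual_of_additive [P.IsRootSystem] (b : P.Base) (g : ι → K)
    (hneg : ∀ i, g (P.reflectionPerm i i) = -g i)
    (hadd : ∀ i j k, P.root k = P.root i + P.root j → g k = g i + g j) :
    ∃ φ : Dual K M, ∀ i, φ (P.root i) = g i := by
  refine ⟨b.toWeightBasis.constr K fun i => g i, fun i => ?_⟩
  refine b.induction_add (p := fun i => b.toWeightBasis.constr K (fun i => g i) (P.root i) = g i) i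
    ?_ ?_ ?_
  · intro i hi
    rw [hneg, ← hi]
    simp
  · intro i hi
    have := b.toWeightBasis.constr_basis K (fun i : b.support => g i) ⟨i, hi⟩
    rwa [b.toWeightBasis_apply] at this
  · intro i j k hk hi hj
    have := b.toWeightBasis.constr_basis K (fun i : b.support => g i) ⟨j, hj⟩
    rw [b.toWeightBasis_apply] at this
    rw [hk, map_add, hi, hadd i j k hk]
    exact congrArg _ this

theorem exists_root_eq_sub_of_pos {i j : ι} (h : 0 < P.pairingIn ℤ i j) (hij : i ≠ j) :
    ∃ k, P.root k = P.root i - P.root j :=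
  P.root_sub_root_mem_of_pairingIn_pos h hij

theorem exists_root_eq_add_of_neg {i j : ι} (h : P.pairingIn ℤ i j < 0)
    (hij : P.root i ≠ -P.root j) : ∃ k, P.root k = P.root i + P.root j :=
  P.root_add_root_mem_of_pairingIn_neg h hij

omit [Finite ι] in
theorem pairingIn_add {i j k l : ι} (h : P.root k = P.root i + P.root j) :
    P.pairingIn ℤ k l = P.pairingIn ℤ i l + P.pairingIn ℤ j l :=
  P.pairingIn_eq_add_of_root_eq_add h

omit [Finite ι] in
theorem pairingIn_sub {i j k l : ι} (h : P.root k = P.root i - P.root j) :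
    P.pairingIn ℤ k l = P.pairingIn ℤ i l - P.pairingIn ℤ j l := by
  have : P.root i = P.root k + P.root j := by rw [h]; abel
  rw [pairingIn_add this]; ring

/-- If two functionals never are both nonzero at the same root, then roots where one of them is
nonzero are orthogonal to roots where the other is. -/
theorem pairingIn_eq_zero_of_forall_or {f g : Dual K M}
    (h : ∀ i, f (P.root i) = 0 ∨ g (P.root i) = 0) {i j : ι} (hi : f (P.root i) ≠ 0)
    (hj : g (P.root j) ≠ 0) : P.pairingIn ℤ i j = 0 := by
  have gi := (h i).resolve_left hi
  have fj := (h j).resolve_right hj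
  -- A nonzero pairing would make the sum or the difference a root, and both functionals would be
  -- nonzero on it.
  rcases lt_trichotomy (P.pairingIn ℤ i j) 0 with hlt | h0 | hgt
  · obtain ⟨k, hk⟩ := exists_root_eq_add_of_neg hlt (by
      intro e
      rw [e, map_neg, fj, neg_zero] at hi
      exact hi rfl)
    have := h k
    simp [hk, gi, fj, hi, hj] at this
  · exact h0
  · obtain ⟨k, hk⟩ := exists_root_eq_sub_of_pos hgt (by
      rintro rfl
      exact hi fj)
    have := h k
    simp [hk, gi, fj, hi, hj] at this

/-- An irreducible root system is not the union of two proper linear sections. -/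
theorem exists_root_apply_ne_zero_and [P.IsIrreducible] {f g : Dual K M}
    (hf : ∃ i, f (P.root i) ≠ 0) (hg : ∃ i, g (P.root i) ≠ 0) :
    ∃ i, f (P.root i) ≠ 0 ∧ g (P.root i) ≠ 0 := by
  by_contra! hcon
  have h : ∀ i, f (P.root i) = 0 ∨ g (P.root i) = 0 := fun i => by
    by_cases hi : f (P.root i) = 0
    · exact Or.inl hi
    · exact Or.inr (hcon i hi)
  have hperp : ∀ i j, f (P.root i) ≠ 0 → g (P.root j) ≠ 0 → P.pairing i j = 0 :=
    fun i j hi hj => by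
      rw [← P.algebraMap_pairingIn ℤ, pairingIn_eq_zero_of_forall_or h hi hj, map_zero]
  -- This span contradicts irreducibility: it is nonzero and stable under all reflections, yet it is
  -- killed by the coroot of any root where `g` does not vanish.
  set q : Submodule K M := Submodule.span K (P.root '' {i | f (P.root i) ≠ 0}) with hq
  have hmem : ∀ i, f (P.root i) ≠ 0 → P.root i ∈ q := fun i hi =>
    Submodule.subset_span ⟨i, hi, rfl⟩
  have hinv : ∀ i, q ∈ Module.End.invtSubmodule (P.reflection i) := by
    intro j
    rw [Module.End.mem_invtSubmodule, hq, Submodule.span_le]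
    rintro _ ⟨i, hi, rfl⟩
    simp only [Submodule.comap_coe, Set.mem_preimage, SetLike.mem_coe, LinearEquiv.coe_coe]
    rw [P.reflection_apply_root]
    by_cases hfj : f (P.root j) = 0
    · by_cases hgj : g (P.root j) = 0
      · rw [← P.reflection_apply_root, ← P.root_reflectionPerm]
        apply hmem
        rw [P.root_reflectionPerm, P.reflection_apply_root, map_sub, map_smul, hfj]
        simpa using hi
      · rw [hperp i j hi hgj, zero_smul, sub_zero]
        exact hmem i hi
    · exact q.sub_mem (hmem i hi) (q.smul_mem _ (hmem j hfj))
  obtain ⟨i, hi⟩ := hf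
  obtain ⟨j, hj⟩ := hg
  have htop : q = ⊤ := IsIrreducible.eq_top_of_invtSubmodule_reflection q hinv
    (q.ne_bot_iff.mpr ⟨_, hmem i hi, P.ne_zero i⟩)
  have hle : q ≤ LinearMap.ker (P.coroot' j) := by
    rw [hq, Submodule.span_le]
    rintro _ ⟨i, hi, rfl⟩
    simpa using hperp i j hi hj
  have : P.root j ∈ LinearMap.ker (P.coroot' j) := hle (htop ▸ Submodule.mem_top)
  simp at this

end

/-! ### Root systems labelled by arrows -/

section Arrow

/-- A labelling of the roots by arrows `src i ⟶ tgt i` between points of `V`, such that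
`i ↦ [tgt i] - [src i]` extends to a linear map. -/
structure ArrowLabelling (P : RootPairing ι K M N) (V : Type*) [DecidableEq V] where
  src : ι → V
  tgt : ι → V
  toLin : M →ₗ[K] (V → K)
  toLin_root : ∀ i, toLin (P.root i) = Pi.single (tgt i) 1 - Pi.single (src i) 1

namespace ArrowLabelling

variable {P : RootPairing ι K M N} {V : Type*} [DecidableEq V] (A : ArrowLabelling P V)

/-- The integral version of `toLin` on roots. -/
def deg (i : ι) (v : V) : ℤ := (if v = A.tgt i then 1 else 0) - (if v = A.src i then 1 else 0)

omit [CharZero K] [Finite ι] in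
theorem cast_deg (i : ι) (v : V) : (A.deg i v : K) = A.toLin (P.root i) v := by
  rw [toLin_root, deg]
  simp [Pi.single_apply]

omit [Finite ι] in
theorem deg_add {i j k : ι} (h : P.root k = P.root i + P.root j) (v : V) :
    A.deg k v = A.deg i v + A.deg j v := by
  apply Int.cast_injective (α := K)
  simp [cast_deg, h]

omit [Finite ι] in
theorem deg_sub {i j k : ι} (h : P.root k = P.root i - P.root j) (v : V) :
    A.deg k v = A.deg i v - A.deg j v := by
  apply Int.cast_injective (α := K)
  simp [cast_deg, h]

omit [Finite ι] in
theorem deg_neg {i j : ι} (h : P.root j = -P.root i) (v : V) :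
    A.deg j v = -A.deg i v := by
  apply Int.cast_injective (α := K)
  simp [cast_deg, h]

omit [Finite ι] in
theorem deg_of_sub_mem_ker {i j : ι} (h : P.root i - P.root j ∈ LinearMap.ker A.toLin) (v : V) :
    A.deg i v = A.deg j v := by
  apply Int.cast_injective (α := K)
  rw [LinearMap.mem_ker, map_sub, sub_eq_zero] at h
  simp [cast_deg, h]

omit [CharZero K] [Finite ι] in
-- The tip is the only point of degree `1` and the tail the only one of degree `-1`. A trivial arrow
-- has degree zero everywhere and its position is lost, hence the hypothesis `hi`.
theorem tgt_src_eq {i j : ι} (hi : A.tgt i ≠ A.src i) (h : ∀ v, A.deg j v = A.deg i v) :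
    A.tgt j = A.tgt i ∧ A.src j = A.src i := by
  have h1 := h (A.tgt i)
  have h2 := h (A.src i)
  have h3 := h (A.tgt j)
  have h4 := h (A.src j)
  simp only [deg] at h1 h2 h3 h4
  grind

omit [Finite ι] in
/-- If a sum of roots is a root then the arrows can be composed. -/
theorem comp_of_add {i j k : ι} (h : P.root k = P.root i + P.root j) (hi : A.tgt i ≠ A.src i)
    (hj : A.tgt j ≠ A.src j) (hk : A.tgt k ≠ A.src k) :
    (A.src i = A.tgt j ∧ A.tgt k = A.tgt i ∧ A.src k = A.src j) ∨
      (A.src j = A.tgt i ∧ A.tgt k = A.tgt j ∧ A.src k = A.src i) := by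
  have h0 := A.deg_add h
  have h1 := h0 (A.tgt i)
  have h2 := h0 (A.src i)
  have h3 := h0 (A.tgt j)
  have h4 := h0 (A.src j)
  have h5 := h0 (A.tgt k)
  have h6 := h0 (A.src k)
  simp only [deg] at h1 h2 h3 h4 h5 h6
  grind

variable [P.IsCrystallographic]

variable {A} in
/-- Roots with the same arrow that are not orthogonal differ by a root with a trivial arrow. -/
theorem sub_mem_of_pairingIn_ne_zero {Q : Submodule K M}
    (hQ : ∀ i, P.root i ∈ Q ↔ A.tgt i = A.src i) {i j : ι} (ht : A.tgt i = A.tgt j)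
    (hs : A.src i = A.src j) (h : P.pairingIn ℤ i j ≠ 0) : P.root i - P.root j ∈ Q := by
  by_cases hi : A.tgt i = A.src i
  · exact Q.sub_mem ((hQ i).2 hi) ((hQ j).2 (by rw [← ht, ← hs, hi]))
  rcases lt_or_gt_of_ne h with hlt | hgt
  -- Otherwise the sum would be a root whose label is twice an arrow.
  · exfalso
    obtain ⟨k, hk⟩ := exists_root_eq_add_of_neg hlt (by
      intro e
      have := A.deg_neg e (A.tgt i)
      simp only [deg] at this
      grind)
    have := A.deg_add hk (A.tgt i)
    simp only [deg] at this
    grind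
  · by_cases hij : i = j
    · simp [hij]
    obtain ⟨k, hk⟩ := exists_root_eq_sub_of_pos hgt hij
    rw [← hk, hQ]
    have := A.deg_sub hk (A.tgt k)
    simp only [deg] at this
    grind

variable {A} in
-- If `i` and `j` are orthogonal, then `i - k` is a root pairing negatively with `j`, so `i - k + j`
-- is a root too. Its label is twice the common arrow minus that of `k`, which is an arrow only if
-- `k` carries the common arrow as well; then `i` and `j` are both compared with `k`.
theorem sub_mem_of_mul_pos {Q : Submodule K M} (hQ : ∀ i, P.root i ∈ Q ↔ A.tgt i = A.src i)
    {i j k : ι} (ht : A.tgt i = A.tgt j) (hs : A.src i = A.src j)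
    (hi : 0 < P.pairingIn ℤ i k) (hj : 0 < P.pairingIn ℤ j k) : P.root i - P.root j ∈ Q := by
  by_cases hij : P.pairingIn ℤ i j ≠ 0
  · exact sub_mem_of_pairingIn_ne_zero hQ ht hs hij
  push Not at hij
  by_cases hi' : A.tgt i = A.src i
  · exact Q.sub_mem ((hQ i).2 hi') ((hQ j).2 (by rw [← ht, ← hs, hi']))
  have hji : P.pairingIn ℤ j i = 0 := by rwa [P.pairingIn_eq_zero_iff]
  obtain ⟨a, ha⟩ := exists_root_eq_sub_of_pos hi (by rintro rfl; omega)
  have hkj : 0 < P.pairingIn ℤ k j := by rwa [P.zero_lt_pairingIn_iff']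
  have haj : P.pairingIn ℤ a j < 0 := by rw [pairingIn_sub ha]; omega
  obtain ⟨c, hc⟩ := exists_root_eq_add_of_neg haj (by
    intro e
    have e' : P.root k = P.root i + P.root j := by
      have e'' : P.root k = P.root i - P.root a := by rw [ha]; abel
      rw [e'', e, sub_neg_eq_add]
    have := A.deg_add e' (A.tgt i)
    simp only [deg] at this
    grind)
  have h0 : ∀ v, A.deg c v = A.deg i v - A.deg k v + A.deg j v := fun v => by
    rw [A.deg_add hc, A.deg_sub ha]
  have h1 := h0 (A.tgt i)
  have h2 := h0 (A.src i)
  simp only [deg] at h1 h2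
  have hk : A.tgt k = A.tgt i ∧ A.src k = A.src i := by grind
  have ik := sub_mem_of_pairingIn_ne_zero hQ hk.1.symm hk.2.symm hi.ne'
  have jk := sub_mem_of_pairingIn_ne_zero hQ (ht.symm.trans hk.1.symm) (hs.symm.trans hk.2.symm)
    hj.ne'
  simpa using Q.sub_mem ik jk

variable {A} in
/-- In an irreducible root system, roots with the same arrow agree modulo the roots with a trivial
arrow. -/
theorem sub_mem [P.IsIrreducible] {Q : Submodule K M}
    (hQ : ∀ i, P.root i ∈ Q ↔ A.tgt i = A.src i) (hker : Q ≤ LinearMap.ker A.toLin) {i j : ι}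
    (ht : A.tgt i = A.tgt j) (hs : A.src i = A.src j) : P.root i - P.root j ∈ Q := by
  let := P.indexNeg
  by_cases hi' : A.tgt i = A.src i
  · exact Q.sub_mem ((hQ i).2 hi') ((hQ j).2 (by rw [← ht, ← hs, hi']))
  have key : ∀ k, 0 < P.pairingIn ℤ i k → P.pairingIn ℤ j k ≠ 0 → P.root i - P.root j ∈ Q := by
    intro k hik hjk
    by_cases hij : P.pairingIn ℤ i j ≠ 0
    · exact sub_mem_of_pairingIn_ne_zero hQ ht hs hij
    push Not at hij
    have hji : P.pairingIn ℤ j i = 0 := by rwa [P.pairingIn_eq_zero_iff]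
    rcases lt_or_gt_of_ne hjk with hlt | hgt
    · obtain ⟨a, ha⟩ := exists_root_eq_sub_of_pos hik (by rintro rfl; omega)
      obtain ⟨c, hc⟩ := exists_root_eq_add_of_neg hlt (by
        intro e
        have : P.pairingIn ℤ k i ≠ 0 := by
          rw [Ne, P.pairingIn_eq_zero_iff]; exact hik.ne'
        have e' : P.root j = P.root (-k) := by simp [e]
        rw [P.root.injective e'] at hji
        simp at hji
        exact this hji)
      -- Both `i - k` and `j + k` are roots: the common arrow minus, and plus, the label of `k` are
      -- both differences of two points. This leaves only the zero label for `k`.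
      have hk : A.tgt k = A.src k := by
        have h1 := A.deg_sub ha (A.tgt i)
        have h2 := A.deg_sub ha (A.src i)
        have h3 := A.deg_add hc (A.tgt i)
        have h4 := A.deg_add hc (A.src i)
        have h5 := A.deg_add hc (A.tgt k)
        have h6 := A.deg_add hc (A.src k)
        simp only [deg] at h1 h2 h3 h4 h5 h6
        grind
      have hkQ := (hQ k).2 hk
      -- Reflecting in `k` changes `i` only by an element of `Q` and reverses its pairing with `k`.
      -- The reflected root and `j` then both pair positively with `-k`.
      have hi1 : P.root (P.reflectionPerm k i) - P.root i ∈ Q := by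
        rw [P.root_reflectionPerm, P.reflection_apply_root]
        simpa using Q.smul_mem _ hkQ
      have h' := A.tgt_src_eq hi' (A.deg_of_sub_mem_ker (hker hi1))
      have := sub_mem_of_mul_pos (k := -k) hQ (h'.1.trans ht) (h'.2.trans hs)
        (by
          change 0 < P.pairingIn ℤ (P.reflectionPerm k i) (P.reflectionPerm k k)
          rw [← P.pairingIn_reflectionPerm]
          simpa using hik) (by simpa using hlt)
      simpa using Q.sub_mem this hi1
    · exact sub_mem_of_mul_pos hQ ht hs hik hgt
  -- Irreducibility supplies a root orthogonal to neither `i` nor `j`.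
  obtain ⟨k, hk1, hk2⟩ := exists_root_apply_ne_zero_and (P := P)
    (f := P.coroot' i) (g := P.coroot' j) ⟨i, by simp⟩ ⟨j, by simp⟩
  have h1 : P.pairingIn ℤ i k ≠ 0 := by
    intro h0
    rw [P.pairingIn_eq_zero_iff] at h0
    apply hk1
    rw [P.root_coroot'_eq_pairing, ← P.algebraMap_pairingIn ℤ, h0, map_zero]
  have h2 : P.pairingIn ℤ j k ≠ 0 := by
    intro h0
    rw [P.pairingIn_eq_zero_iff] at h0
    apply hk2
    rw [P.root_coroot'_eq_pairing, ← P.algebraMap_pairingIn ℤ, h0, map_zero]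
  rcases lt_or_gt_of_ne h1 with hlt | hgt
  · exact key (-k) (by simpa using hlt) (by simpa using h2)
  · exact key k hgt h2


omit [CharZero K] [Finite ι] [P.IsCrystallographic] in
theorem exists_swap (i : ι) : ∃ j, P.root j = -P.root i := by
  let := P.indexNeg
  exact ⟨-i, by simp⟩

variable {A} in
/-- In an irreducible root system every arrow between two points in use is the label of a root. -/
theorem exists_tgt_src [P.IsIrreducible] {u v : V} (huv : u ≠ v)
    (hu : ∃ i, A.deg i u ≠ 0) (hv : ∃ i, A.deg i v ≠ 0) : ∃ i, A.tgt i = u ∧ A.src i = v := by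
  have key : ∀ (w : V) (i : ι), A.deg i w ≠ 0 ↔
      ((LinearMap.proj w : (V → K) →ₗ[K] K) ∘ₗ A.toLin) (P.root i) ≠ 0 := fun w i => by
    rw [LinearMap.comp_apply, LinearMap.proj_apply, ← A.cast_deg, Int.cast_ne_zero]
  simp_rw [key] at hu hv
  -- A root whose label involves both points joins them in one direction; its negative joins them in
  -- the other.
  obtain ⟨i, hi1, hi2⟩ := exists_root_apply_ne_zero_and hu hv
  rw [← key] at hi1 hi2
  obtain ⟨j, hj⟩ := exists_swap (P := P) i
  have h1 := A.deg_neg hj u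
  have h2 := A.deg_neg hj v
  simp only [deg] at hi1 hi2 h1 h2
  by_cases h : A.tgt i = u
  · exact ⟨i, h, by grind⟩
  · exact ⟨j, by grind, by grind⟩

variable {A} in
/-- The classes of the roots with given arrows satisfy the cocycle condition. -/
theorem sub_add_mem [P.IsIrreducible] {Q : Submodule K M}
    (hQ : ∀ i, P.root i ∈ Q ↔ A.tgt i = A.src i) (hker : Q ≤ LinearMap.ker A.toLin)
    {i j k : ι} (hi : A.tgt i ≠ A.src i) (hj : A.tgt j ≠ A.src j)
    (hk : A.tgt k ≠ A.src k) (hij : A.src i = A.tgt j) (hik : A.tgt k = A.tgt i)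
    (hjk : A.src k = A.src j) : P.root k - (P.root i + P.root j) ∈ Q := by
  set z := A.src j with hz
  have key : ∀ (w : V) (i : ι), A.deg i w ≠ 0 ↔
      ((LinearMap.proj w : (V → K) →ₗ[K] K) ∘ₗ A.toLin) (P.root i) ≠ 0 := fun w i => by
    rw [LinearMap.comp_apply, LinearMap.proj_apply, ← A.cast_deg, Int.cast_ne_zero]
  -- A root not orthogonal to `i` whose label involves `z` gives, up to sign, an honest relation `m
  -- = l + i` between roots on the three points. By `sub_mem` it carries over to the given roots
  -- modulo `Q`.
  obtain ⟨l, hl1, hl2⟩ := exists_root_apply_ne_zero_and (P := P) (f := P.coroot' i)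
    (g := (LinearMap.proj z : (V → K) →ₗ[K] K) ∘ₗ A.toLin) ⟨i, by simp⟩
    ⟨j, by rw [← key]; simp only [deg]; grind⟩
  rw [← key] at hl2
  rw [P.root_coroot'_eq_pairing, ← P.algebraMap_pairingIn ℤ] at hl1
  replace hl1 : P.pairingIn ℤ l i ≠ 0 := by
    intro h0
    simp [h0] at hl1
  -- we may assume that `l + i` is a root
  obtain ⟨l, m, hl2, hm⟩ : ∃ l m, A.deg l z ≠ 0 ∧ P.root m = P.root l + P.root i := by
    rcases lt_or_gt_of_ne hl1 with hlt | hgt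
    · obtain ⟨m, hm⟩ := exists_root_eq_add_of_neg hlt (by
        intro e
        have := A.deg_neg e z
        simp only [deg] at this hl2
        grind)
      exact ⟨l, m, hl2, hm⟩
    · obtain ⟨m, hm⟩ := exists_root_eq_sub_of_pos hgt (by
        rintro rfl
        simp only [deg] at hl2
        grind)
      obtain ⟨l', hl'⟩ := exists_swap (P := P) l
      obtain ⟨m', hm'⟩ := exists_swap (P := P) m
      refine ⟨l', m', ?_, ?_⟩
      · rw [A.deg_neg hl']
        exact neg_ne_zero.2 hl2
      · rw [hm', hl', hm]
        abel
  have h1 := A.deg_add hm (A.tgt i)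
  have h2 := A.deg_add hm (A.src i)
  have h3 := A.deg_add hm z
  have h4 := A.deg_add hm (A.tgt l)
  have h5 := A.deg_add hm (A.src l)
  have h6 : (A.tgt l = A.src i ∧ A.src l = z ∧ A.tgt m = A.tgt i ∧ A.src m = z) ∨
      (A.tgt l = z ∧ A.src l = A.tgt i ∧ A.tgt m = z ∧ A.src m = A.src i) := by
    simp only [deg] at h1 h2 h3 h4 h5 hl2
    clear key
    grind (splits := 20)
  rcases h6 with ⟨a1, a2, a3, a4⟩ | ⟨a1, a2, a3, a4⟩
  · have b1 := sub_mem hQ hker (i := k) (j := m) (by rw [a3, hik]) (by rw [a4, hjk])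
    have b2 := sub_mem hQ hker (i := l) (j := j) (by rw [a1, hij]) (by rw [a2])
    have : P.root k - (P.root i + P.root j) = (P.root k - P.root m) + (P.root l - P.root j) := by
      rw [hm]; abel
    rw [this]
    exact Q.add_mem b1 b2
  · obtain ⟨k', hk'⟩ := exists_swap (P := P) k
    obtain ⟨j', hj'⟩ := exists_swap (P := P) j
    have c1 := A.deg_neg hk' (A.tgt k)
    have c2 := A.deg_neg hk' (A.src k)
    have c3 := A.deg_neg hj' (A.tgt j)
    have c4 := A.deg_neg hj' (A.src j)
    have c5 : A.tgt k' = A.src k ∧ A.src k' = A.tgt k ∧ A.tgt j' = A.src j ∧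
        A.src j' = A.tgt j := by
      simp only [deg] at c1 c2 c3 c4
      grind
    have b1 := sub_mem hQ hker (i := l) (j := k') (by rw [a1, c5.1, hjk])
      (by rw [a2, c5.2.1, hik])
    have b2 := sub_mem hQ hker (i := m) (j := j') (by rw [a3, c5.2.2.1])
      (by rw [a4, c5.2.2.2, hij])
    have : P.root k - (P.root i + P.root j) = (P.root l - P.root k') - (P.root m - P.root j') := by
      rw [hm, hk', hj']; abel
    rw [this]
    exact Q.sub_mem b1 b2

variable (K V) in
/-- The differences of two distinct coordinate vectors. -/
def arrows : Set (V → K) := {v | ∃ i j, i ≠ j ∧ v = Pi.single i 1 - Pi.single j 1}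

variable {A} in
/-- The quotient of an irreducible root system by the roots with trivial labels is a root system of
type `A`. -/
theorem exists_equiv_span_arrows [P.IsRootSystem] [P.IsIrreducible] [Fintype V] [Nonempty V] {Q : Submodule K M}
    (hQ : ∀ i, P.root i ∈ Q ↔ A.tgt i = A.src i) (hker : Q ≤ LinearMap.ker A.toLin)
    (hA : ∀ v, ∃ i, A.deg i v ≠ 0) :
    ∃ e : (M ⧸ Q) ≃ₗ[K] Submodule.span K (arrows K V),
      (fun v => (e v : V → K)) '' {q | q ≠ 0 ∧ ∃ i, q = Q.mkQ (P.root i)} = arrows K V ∧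
      ∀ φ : Dual K M, Q ≤ LinearMap.ker φ →
        ∃ x : V → K, ∀ i, φ (P.root i) = x (A.tgt i) - x (A.src i) := by
  have hspan : Submodule.span K (Set.range P.root) = ⊤ :=
    IsRootSystem.span_root_eq_top
  set F : (M ⧸ Q) →ₗ[K] (V → K) := Q.liftQ A.toLin hker with hF
  have hFr : ∀ i, F (Q.mkQ (P.root i)) = A.toLin (P.root i) := fun i => rfl
  have himg : F '' {q | q ≠ 0 ∧ ∃ i, q = Q.mkQ (P.root i)} = arrows K V := by
    ext v
    constructor
    · rintro ⟨_, ⟨h0, i, rfl⟩, rfl⟩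
      refine ⟨A.tgt i, A.src i, fun e => h0 ?_, A.toLin_root i⟩
      rwa [Submodule.mkQ_apply, Submodule.Quotient.mk_eq_zero, hQ]
    · rintro ⟨a, c, hac, rfl⟩
      obtain ⟨i, rfl, rfl⟩ := exists_tgt_src hac (hA a) (hA c)
      refine ⟨Q.mkQ (P.root i), ⟨?_, i, rfl⟩, A.toLin_root i⟩
      rwa [Submodule.mkQ_apply, Ne, Submodule.Quotient.mk_eq_zero, hQ]
  obtain ⟨x₀⟩ := ‹Nonempty V›
  have hex : ∀ u v : V, ∃ q : M ⧸ Q, (u = v → q = 0) ∧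
      ∀ i, A.tgt i = u → A.src i = v → Q.mkQ (P.root i) = q := by
    intro u v
    by_cases huv : u = v
    · refine ⟨0, fun _ => rfl, fun i h1 h2 => ?_⟩
      rw [Submodule.mkQ_apply, Submodule.Quotient.mk_eq_zero, hQ, h1, h2, huv]
    · obtain ⟨i, h1, h2⟩ := exists_tgt_src huv (hA u) (hA v)
      refine ⟨Q.mkQ (P.root i), fun e => absurd e huv, fun j h3 h4 => ?_⟩
      rw [← sub_eq_zero, ← map_sub, Submodule.mkQ_apply, Submodule.Quotient.mk_eq_zero]
      exact sub_mem hQ hker (h3.trans h1.symm) (h4.trans h2.symm)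
  choose q hq0 hq using hex
  -- Here `q u v` is the common class of all roots with arrow `v ⟶ u`; this cocycle identity makes
  -- `G` below a left inverse of `F`.
  have hcoc : ∀ u v, q u x₀ - q v x₀ = q u v := by
    intro u v
    by_cases huv : u = v
    · rw [huv, hq0 v v rfl, sub_self]
    by_cases hv : v = x₀
    · rw [hv, hq0 x₀ x₀ rfl, sub_zero]
    obtain ⟨i, h1, h2⟩ := exists_tgt_src huv (hA u) (hA v)
    obtain ⟨j, h3, h4⟩ := exists_tgt_src hv (hA v) (hA x₀)
    rw [← hq u v i h1 h2, ← hq v x₀ j h3 h4]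
    by_cases hu : u = x₀
    · rw [hq0 u x₀ hu, zero_sub, eq_comm, ← add_eq_zero_iff_eq_neg, ← map_add]
      obtain ⟨j', hj'⟩ := exists_swap (P := P) j
      have c3 := A.deg_neg hj' (A.tgt j)
      have c4 := A.deg_neg hj' (A.src j)
      have c5 : A.tgt j' = A.src j ∧ A.src j' = A.tgt j := by
        simp only [deg] at c3 c4
        grind
      have := sub_mem hQ hker (i := i) (j := j') (by rw [c5.1, h1, h4, hu])
        (by rw [c5.2, h2, h3])
      rw [Submodule.mkQ_apply, Submodule.Quotient.mk_eq_zero]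
      rwa [hj', sub_neg_eq_add] at this
    · obtain ⟨k, h5, h6⟩ := exists_tgt_src hu (hA u) (hA x₀)
      rw [← hq u x₀ k h5 h6, sub_eq_iff_eq_add, ← map_add, ← sub_eq_zero, ← map_sub,
        Submodule.mkQ_apply, Submodule.Quotient.mk_eq_zero]
      exact sub_add_mem hQ hker (by rwa [h1, h2]) (by rwa [h3, h4]) (by rwa [h5, h6])
        (by rw [h2, h3]) (by rw [h5, h1]) (by rw [h6, h4])
  set G : (V → K) →ₗ[K] (M ⧸ Q) := (Pi.basisFun K V).constr K fun v => q v x₀ with hG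
  have hGs : ∀ v, G (Pi.single v 1) = q v x₀ := fun v => by
    rw [hG, ← Pi.basisFun_apply, Basis.constr_basis]
  have hGF : G ∘ₗ F = LinearMap.id := by
    apply Submodule.linearMap_qext
    apply LinearMap.ext_on_range (v := P.root) hspan
    intro i
    simp only [LinearMap.comp_apply, hFr, A.toLin_root, map_sub, hGs, hcoc, LinearMap.id_apply]
    exact (hq _ _ i rfl rfl).symm
  have hinj : Function.Injective F := fun x y hxy => by
    have := congrArg G hxy
    rwa [← LinearMap.comp_apply, ← LinearMap.comp_apply, hGF] at this
  have hrange : LinearMap.range F = Submodule.span K (arrows K V) := by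
    apply le_antisymm
    · rw [hF, Submodule.range_liftQ, LinearMap.range_eq_map, ← hspan, Submodule.map_span,
        Submodule.span_le]
      rintro _ ⟨_, ⟨i, rfl⟩, rfl⟩
      by_cases h : A.tgt i = A.src i
      · rw [A.toLin_root, h, sub_self]
        exact Submodule.zero_mem _
      · exact Submodule.subset_span ⟨_, _, h, A.toLin_root i⟩
    · rw [Submodule.span_le, ← himg]
      rintro _ ⟨x, -, rfl⟩
      exact ⟨x, rfl⟩
  refine ⟨(LinearEquiv.ofInjective F hinj).trans (LinearEquiv.ofEq _ _ hrange), himg,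
    fun φ hφ => ?_⟩
  -- The potential of a point is the value of the functional on the class of the arrow from `x₀` to
  -- it.
  refine ⟨fun v => Q.liftQ φ hφ (G (Pi.single v 1)), fun i => ?_⟩
  have := congrArg (Q.liftQ φ hφ) (LinearMap.congr_fun hGF (Q.mkQ (P.root i)))
  rw [LinearMap.comp_apply, hFr, A.toLin_root, map_sub, map_sub] at this
  exact this.symm

omit [CharZero K] [P.IsCrystallographic] in
/-- The points of a labelling can be restricted to the finite set of those in use. -/
theorem exists_fin (h : ∃ i, A.tgt i ≠ A.src i) :
    ∃ (k : ℕ) (B : ArrowLabelling P (Fin (k + 1))), (∀ i, B.tgt i = B.src i ↔ A.tgt i = A.src i) ∧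
      (∀ v, ∃ i, B.deg i v ≠ 0) ∧ LinearMap.ker A.toLin ≤ LinearMap.ker B.toLin := by
  set W : Set V := {v | ∃ i, A.deg i v ≠ 0} with hW
  have hsub : W ⊆ Set.range A.tgt ∪ Set.range A.src := by
    rintro v ⟨i, hi⟩
    by_contra hv
    simp only [Set.mem_union, Set.mem_range, not_or, not_exists] at hv
    have h1 := hv.1 i
    have h2 := hv.2 i
    simp only [deg] at hi
    grind
  have hfin : W.Finite := ((Set.finite_range _).union (Set.finite_range _)).subset hsub
  have htgt : ∀ i, A.tgt i ≠ A.src i → A.tgt i ∈ W := fun i hi => ⟨i, by simp [deg, hi]⟩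
  have hsrc : ∀ i, A.tgt i ≠ A.src i → A.src i ∈ W := fun i hi => ⟨i, by simp [deg, hi.symm]⟩
  obtain ⟨i₀, hi₀⟩ := h
  have : Fintype W := hfin.fintype
  obtain ⟨k, hk⟩ : ∃ k, Fintype.card W = k + 1 :=
    ⟨Fintype.card W - 1, by
      have : 0 < Fintype.card W := Fintype.card_pos_iff.2 ⟨⟨_, htgt i₀ hi₀⟩⟩
      omega⟩
  let e : W ≃ Fin (k + 1) := Fintype.equivFinOfCardEq hk
  -- The endpoints of a trivial arrow need not be in use. Such arrows are all moved to `0`, which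
  -- keeps their label zero.
  let T : ι → Fin (k + 1) := fun i => if hi : A.tgt i ≠ A.src i then e ⟨_, htgt i hi⟩ else 0
  let S : ι → Fin (k + 1) := fun i => if hi : A.tgt i ≠ A.src i then e ⟨_, hsrc i hi⟩ else 0
  have hTS : ∀ i, T i = S i ↔ A.tgt i = A.src i := by
    intro i
    by_cases hi : A.tgt i ≠ A.src i
    · simp [T, S, hi]
    · push Not at hi
      simp [T, S, hi]
  have hval : ∀ i v, ((if v = T i then 1 else 0) - (if v = S i then 1 else 0) : ℤ) =
      A.deg i (e.symm v) := by
    intro i v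
    have key : ∀ w : W, v = e w ↔ (e.symm v : V) = w := fun w => by
      rw [← Subtype.ext_iff, Equiv.symm_apply_eq]
    by_cases hi : A.tgt i ≠ A.src i
    · simp only [T, S, dif_pos hi, deg, key]
    · simp only [T, S, dif_neg hi, deg]
      push Not at hi
      simp [hi]
  let B : ArrowLabelling P (Fin (k + 1)) :=
    { src := S
      tgt := T
      toLin := (LinearMap.funLeft K K fun v => (e.symm v : V)) ∘ₗ A.toLin
      toLin_root := fun i => by
        ext v
        rw [LinearMap.comp_apply, LinearMap.funLeft_apply, ← A.cast_deg, ← hval i v]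
        simp [Pi.single_apply] }
  refine ⟨k, B, hTS, fun v => ?_, fun x hx => ?_⟩
  · obtain ⟨i, hi⟩ := (e.symm v).2
    exact ⟨i, by rwa [← hval i v] at hi⟩
  · rw [LinearMap.mem_ker] at hx ⊢
    simp [B, hx]

/-- With `s = p / (c * a)` and `s' = p' / (c * a')`, the hypothesis `hq` becomes `s' - s = ± (a +
a')`. One sign says that the second arrow starts at the tip of the first, the other sign the
reverse. The sum has the composite arrow, so the indicators of the common point cancel. If `a`, `a'`
or `a + a'` is zero, the corresponding arrow is trivial, by the convention for division by zero. -/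
theorem indicator_add_of_sq_eq [DecidableEq K] {c a a' p p' : K} (hc : c ≠ 0) (v : K)
    (hi : a = 0 → p = 0) (hj : a' = 0 → p' = 0) (hk : a + a' = 0 → p + p' = 0)
    (hq : (p' * a - p * a') ^ 2 = c ^ 2 * a ^ 2 * a' ^ 2 * (a + a') ^ 2) :
    ((if v = ((p + p') / (c * (a + a')) + (a + a')) / 2 then 1 else 0) -
      (if v = ((p + p') / (c * (a + a')) - (a + a')) / 2 then 1 else 0) : K) =
    ((if v = (p / (c * a) + a) / 2 then 1 else 0) - (if v = (p / (c * a) - a) / 2 then 1 else 0)) +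
    ((if v = (p' / (c * a') + a') / 2 then 1 else 0) -
      (if v = (p' / (c * a') - a') / 2 then 1 else 0)) := by
  by_cases ha : a = 0
  · simp [ha, hi ha]
  by_cases ha' : a' = 0
  · simp [ha', hj ha']
  by_cases haa : a + a' = 0
  · obtain rfl : a' = -a := by linear_combination haa
    obtain rfl : p' = -p := by linear_combination hk haa
    rw [show -p / (c * -a) = p / (c * a) by field_simp]
    simp [sub_eq_add_neg]
  · have hs : (p' / (c * a') - p / (c * a)) ^ 2 = (a + a') ^ 2 := by
      field_simp
      linear_combination hq
    obtain ⟨s, rfl⟩ : ∃ s, p = c * a * s := ⟨p / (c * a), by field_simp⟩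
    obtain ⟨s', rfl⟩ : ∃ s', p' = c * a' * s' := ⟨p' / (c * a'), by field_simp⟩
    rw [mul_div_cancel_left₀ s' (mul_ne_zero hc ha'),
      mul_div_cancel_left₀ s (mul_ne_zero hc ha)] at hs ⊢
    rcases sq_eq_sq_iff_eq_or_eq_neg.1 hs with h1 | h1
    · have e1 : (c * a * s + c * a' * s') / (c * (a + a')) = s + a' := by
        rw [div_eq_iff (mul_ne_zero hc haa)]
        linear_combination c * a' * h1
      rw [e1, show (s' - a') / 2 = (s + a) / 2 by linear_combination h1 / 2,
        show (s + a' + (a + a')) / 2 = (s' + a') / 2 by linear_combination -h1 / 2,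
        show (s + a' - (a + a')) / 2 = (s - a) / 2 by ring]
      ring
    · have e1 : (c * a * s + c * a' * s') / (c * (a + a')) = s - a' := by
        rw [div_eq_iff (mul_ne_zero hc haa)]
        linear_combination c * a' * h1
      rw [e1, show (s' + a') / 2 = (s - a) / 2 by linear_combination h1 / 2,
        show (s - a' - (a + a')) / 2 = (s' - a') / 2 by linear_combination -h1 / 2,
        show (s - a' + (a + a')) / 2 = (s + a) / 2 by ring]
      ring

/-- The quadratic relations on two functionals define a labelling of the roots by arrows. -/
theorem exists_of_sq_eq [DecidableEq K] [P.IsRootSystem] (b : P.Base) (l m : Dual K M) {c : K}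
    (hc : c ≠ 0) (hlm : ∀ i, l (P.root i) = 0 → m (P.root i) = 0)
    (h : ∀ i j k, P.root k = P.root i + P.root j →
      (m (P.root j) * l (P.root i) - m (P.root i) * l (P.root j)) ^ 2 =
        c ^ 2 * l (P.root i) ^ 2 * l (P.root j) ^ 2 * l (P.root k) ^ 2) :
    ∃ A : ArrowLabelling P K, ∀ i, A.tgt i = A.src i ↔ l (P.root i) = 0 := by
  -- Where `l` is nonzero on `i`, `j` and `k`, the relation says `t j - t i = ± l k`, so that a tip
  -- `T` meets a tail `S`.
  let t : ι → K := fun i => m (P.root i) / (c * l (P.root i))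
  let T : ι → K := fun i => (t i + l (P.root i)) / 2
  let S : ι → K := fun i => (t i - l (P.root i)) / 2
  have hadd : ∀ (v : K) (i j k : ι), P.root k = P.root i + P.root j →
      ((if v = T k then 1 else 0) - (if v = S k then 1 else 0) : K) =
      ((if v = T i then 1 else 0) - (if v = S i then 1 else 0)) +
      ((if v = T j then 1 else 0) - (if v = S j then 1 else 0)) := by
    intro v i j k hk
    have hl : l (P.root k) = l (P.root i) + l (P.root j) := by rw [hk, map_add]
    have hm : m (P.root k) = m (P.root i) + m (P.root j) := by rw [hk, map_add]
    have hq := h i j k hk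
    have hi := hlm i
    have hj := hlm j
    have hk' := hlm k
    rw [hm, hl] at hk'
    rw [hl] at hq
    have hT : T k = ((m (P.root i) + m (P.root j)) / (c * (l (P.root i) + l (P.root j))) +
        (l (P.root i) + l (P.root j))) / 2 := by simp only [T, t, hl, hm]
    have hS : S k = ((m (P.root i) + m (P.root j)) / (c * (l (P.root i) + l (P.root j))) -
        (l (P.root i) + l (P.root j))) / 2 := by simp only [S, t, hl, hm]
    rw [hT, hS]
    exact indicator_add_of_sq_eq hc v hi hj hk' hq
  have hneg : ∀ (v : K) (i : ι),
      ((if v = T (P.reflectionPerm i i) then 1 else 0) -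
        (if v = S (P.reflectionPerm i i) then 1 else 0) : K) =
      -((if v = T i then 1 else 0) - (if v = S i then 1 else 0)) := by
    intro v i
    have e : P.root (P.reflectionPerm i i) = -P.root i := by simp
    simp only [T, S, t, e, map_neg, mul_neg, neg_div_neg_eq, sub_neg_eq_add, neg_sub,
      ← sub_eq_add_neg]
  have hφ := fun v => exists_dual_of_additive b _ (hneg v) (hadd v)
  choose φ hφ using hφ
  refine ⟨⟨S, T, LinearMap.pi φ, fun i => ?_⟩, fun i => ?_⟩
  · ext v
    simp [hφ, Pi.single_apply]
  · simp only [T, S, t]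
    constructor
    · intro h
      linear_combination h
    · intro h
      simp [h]

end ArrowLabelling

end Arrow

end RootPairing

end

/-! ### Quadratic pairs from arrows, and simple roots of coefficient one. -/

section

open Module

set_option linter.unusedSectionVars false

namespace RootPairing

variable {ι K M N : Type*} [Field K] [CharZero K] [AddCommGroup M] [Module K M] [AddCommGroup N]
  [Module K N] [Finite ι] {P : RootPairing ι K M N}

/-- The quadratic relations on two functionals that describe the good orbits. -/
def IsQuadraticPair (P : RootPairing ι K M N) (l m : Dual K M) (c : K) : Prop :=
  (∀ i, l (P.root i) = 0 → m (P.root i) = 0) ∧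
    ∀ i j k, P.root k = P.root i + P.root j →
      (m (P.root j) * l (P.root i) - m (P.root i) * l (P.root j)) ^ 2 =
        c ^ 2 * l (P.root i) ^ 2 * l (P.root j) ^ 2 * l (P.root k) ^ 2

section

omit [Finite ι]

/-- A labelling of the roots by arrows gives solutions of the quadratic relations. -/
theorem ArrowLabelling.exists_isQuadraticPair {V : Type*} [DecidableEq V] [Fintype V]
    (A : ArrowLabelling P V) {l : Dual K M} {x : V → K}
    (hl : ∀ i, l (P.root i) = x (A.tgt i) - x (A.src i)) : ∃ m, IsQuadraticPair P l m 1 := by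
  -- With squared potentials `m / l` is the sum of `x` at the two ends. For composable arrows these
  -- sums differ by `± l k`, which is the quadratic relation with `c = 1`.
  let m : Dual K M := ∑ v, x v ^ 2 • ((LinearMap.proj v : (V → K) →ₗ[K] K) ∘ₗ A.toLin)
  have hm : ∀ i, m (P.root i) = x (A.tgt i) ^ 2 - x (A.src i) ^ 2 := by
    intro i
    simp [m, LinearMap.sum_apply, A.toLin_root, Pi.single_apply, mul_sub, Finset.sum_sub_distrib]
  have h0 : ∀ i, l (P.root i) = 0 → m (P.root i) = 0 := by
    intro i hi
    rw [hm]
    rw [hl] at hi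
    linear_combination (x (A.tgt i) + x (A.src i)) * hi
  refine ⟨m, h0, fun i j k hk => ?_⟩
  have hlk : l (P.root k) = l (P.root i) + l (P.root j) := by rw [hk, map_add]
  have hmk : m (P.root k) = m (P.root i) + m (P.root j) := by rw [hk, map_add]
  by_cases hi : l (P.root i) = 0
  · simp [hi, h0 i hi]
  by_cases hj : l (P.root j) = 0
  · simp [hj, h0 j hj]
  by_cases hk0 : l (P.root k) = 0
  · have hk1 := h0 k hk0
    rw [hmk] at hk1
    rw [hk0]
    rw [hlk] at hk0
    have : m (P.root j) * l (P.root i) - m (P.root i) * l (P.root j) = 0 := by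
      linear_combination l (P.root i) * hk1 - m (P.root i) * hk0
    rw [this]
    ring
  have hne : ∀ i, l (P.root i) ≠ 0 → A.tgt i ≠ A.src i := by
    intro i hi e
    rw [hl, e, sub_self] at hi
    exact hi rfl
  rw [hlk, hm, hm, hl, hl]
  rcases A.comp_of_add hk (hne i hi) (hne j hj) (hne k hk0) with ⟨h1, -, -⟩ | ⟨h1, -, -⟩
  · rw [h1]; ring
  · rw [h1]; ring

end

section Base

variable [P.IsCrystallographic] [P.IsRootSystem] (b : P.Base)

omit [Finite ι] [P.IsCrystallographic] in
theorem Base.repr_root [DecidableEq ι] (i d : b.support) :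
    b.toWeightBasis.repr (P.root i) d = if i = d then 1 else 0 := by
  rw [b.toWeightBasis_repr_root, Finsupp.single_apply]

omit [Finite ι] [P.IsCrystallographic] in
theorem Base.exists_nat_of_mem_closure {x : M}
    (hx : x ∈ AddSubmonoid.closure (P.root '' (b.support : Set ι))) (d : b.support) :
    ∃ n : ℕ, b.toWeightBasis.repr x d = n := by
  classical
  induction hx using AddSubmonoid.closure_induction with
  | mem x hx =>
    obtain ⟨i, hi, rfl⟩ := hx
    refine ⟨if ⟨i, hi⟩ = d then 1 else 0, ?_⟩
    rw [b.repr_root ⟨i, hi⟩ d]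
    split_ifs <;> simp
  | zero => exact ⟨0, by simp⟩
  | add x y _ _ hx hy =>
    obtain ⟨n, hn⟩ := hx
    obtain ⟨m, hm⟩ := hy
    exact ⟨n + m, by simp [hn, hm]⟩

omit [P.IsRootSystem] in
theorem Base.IsPos.mem_closure {b : P.Base} {i : ι} (hi : b.IsPos i) :
    P.root i ∈ AddSubmonoid.closure (P.root '' (b.support : Set ι)) := by
  refine hi.induction_on_add (p := fun i => P.root i ∈ AddSubmonoid.closure _) ?_ ?_
  · intro i hi
    exact AddSubmonoid.subset_closure ⟨i, hi, rfl⟩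
  · intro i j k hk hi hj
    rw [hk]
    exact add_mem hi (AddSubmonoid.subset_closure ⟨j, hj, rfl⟩)

omit [Finite ι] [P.IsCrystallographic] [P.IsRootSystem] in
theorem Base.isPos_or_exists_neg (i : ι) : b.IsPos i ∨ ∃ j, b.IsPos j ∧ P.root j = -P.root i := by
  let := P.indexNeg
  rcases Base.IsPos.or_neg b i with h | h
  · exact Or.inl h
  · exact Or.inr ⟨-i, h, by simp⟩

/-- `θ` is the maximal root. -/
def Base.IsMaximal (θ : ι) : Prop :=
  ∀ i, P.root θ - P.root i ∈ AddSubmonoid.closure (P.root '' (b.support : Set ι))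

/-- If the maximal root has coefficient one at a simple root, then all roots have coefficient
`-1`, `0` or `1` there; those of positive roots are `0` or `1`. -/
theorem Base.IsMaximal.repr_of_isPos {b : P.Base} {θ : ι} (hθ : b.IsMaximal θ) {d : b.support}
    (hd : b.toWeightBasis.repr (P.root θ) d = 1) {i : ι} (hi : b.IsPos i) :
    b.toWeightBasis.repr (P.root i) d = 0 ∨ b.toWeightBasis.repr (P.root i) d = 1 := by
  obtain ⟨n, hn⟩ := b.exists_nat_of_mem_closure (hθ i) d
  obtain ⟨m, hm⟩ := b.exists_nat_of_mem_closure hi.mem_closure d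
  rw [map_sub, Finsupp.sub_apply, hd, hm] at hn
  have : 1 = n + m := by
    have : (1 : K) = n + m := by linear_combination hn
    exact_mod_cast this
  rw [hm]
  rcases Nat.eq_zero_or_pos m with h | h
  · left; simp [h]
  · right
    have : m = 1 := by omega
    simp [this]

theorem Base.apply_eq_sum {l : Dual K M} {Γ : Finset ι} (hl : ∀ i ∈ Γ, l (P.root i) = 0) (x : M)
    (s : Finset b.support) (hs : ∀ d : b.support, d.1 ∉ Γ → d ∈ s) :
    l x = ∑ d ∈ s, b.toWeightBasis.repr x d * l (P.root d) := by
  classical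
  conv_lhs => rw [← b.toWeightBasis.sum_repr x, map_sum]
  symm
  apply Finset.sum_subset_zero_on_sdiff (Finset.subset_univ _)
  · intro d hd
    have : d.1 ∈ Γ := by
      by_contra h
      simp [hs d h] at hd
    rw [map_smul, b.toWeightBasis_apply, hl d this, smul_zero]
  · intro d _
    rw [map_smul, b.toWeightBasis_apply, smul_eq_mul]

/-- The quadratic relations can be solved if one or two simple roots are left out, with
coefficient one in the maximal root. -/
theorem Base.exists_isQuadraticPair_of_pair {Γ : Finset ι} {l : Dual K M}
    (hl : ∀ i ∈ Γ, l (P.root i) = 0) {θ : ι} (hθ : b.IsMaximal θ) (d d' : b.support)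
    (hΓ : ∀ i : b.support, i.1 ∉ Γ → i = d ∨ i = d')
    (h1 : b.toWeightBasis.repr (P.root θ) d = 1) (h2 : b.toWeightBasis.repr (P.root θ) d' = 1) :
    ∃ m, IsQuadraticPair P l m 1 := by
  classical
  set n : Dual K M := b.toWeightBasis.coord d with hn
  -- Allowing `d = d'`, with a zero second coordinate, covers the case of a single simple root.
  set n' : Dual K M := if d = d' then 0 else b.toWeightBasis.coord d' with hn'
  set a := l (P.root d)
  set a' := l (P.root d')
  have hln : ∀ x, l x = n x * a + n' x * a' := by
    intro x
    by_cases hdd : d = d'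
    · rw [b.apply_eq_sum hl x {d} (fun i hi => by simpa [← hdd] using hΓ i hi),
        Finset.sum_singleton]
      simp [hn, hn', hdd, a]
    · rw [b.apply_eq_sum hl x {d, d'} (fun i hi => by simpa using hΓ i hi), Finset.sum_pair hdd]
      simp [hn, hn', hdd, a, a']
  have hpos : ∀ i, b.IsPos i → (n (P.root i) = 0 ∨ n (P.root i) = 1) ∧
      (n' (P.root i) = 0 ∨ n' (P.root i) = 1) := by
    intro i hi
    refine ⟨hθ.repr_of_isPos h1 hi, ?_⟩
    by_cases hdd : d = d'
    · left
      simp [hn', hdd]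
    · rw [hn', if_neg hdd]
      exact hθ.repr_of_isPos h2 hi
  let F : M →ₗ[K] (Fin 3 → K) := n.smulRight (Pi.single 0 1 - Pi.single 1 1) +
    n'.smulRight (Pi.single 1 1 - Pi.single 2 1)
  have hFpos : ∀ i, b.IsPos i → ∃ t s : Fin 3, F (P.root i) = Pi.single t 1 - Pi.single s 1 := by
    intro i hi
    obtain ⟨h3 | h3, h4 | h4⟩ := hpos i hi
    · exact ⟨0, 0, by simp [F, h3, h4]⟩
    · exact ⟨1, 2, by simp [F, h3, h4]⟩
    · exact ⟨0, 1, by simp [F, h3, h4]⟩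
    · exact ⟨0, 2, by simp [F, h3, h4]⟩
  have hF : ∀ i, ∃ t s : Fin 3, F (P.root i) = Pi.single t 1 - Pi.single s 1 := by
    intro i
    rcases b.isPos_or_exists_neg i with hi | ⟨j, hj, hji⟩
    · exact hFpos i hi
    · obtain ⟨t, s, hts⟩ := hFpos j hj
      refine ⟨s, t, ?_⟩
      rw [hji, map_neg, neg_eq_iff_eq_neg, neg_sub] at hts
      exact hts
  choose t s hts using hF
  -- The potentials are chosen so that the steps `1 ⟶ 0` and `2 ⟶ 1` have differences `a` and `a'`.
  let x : Fin 3 → K := ![a + a', a', 0]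
  refine ArrowLabelling.exists_isQuadraticPair ⟨s, t, F, hts⟩ (x := x) fun i => ?_
  have key : ∀ v : Fin 3, ∑ w, x w * (Pi.single v 1 : Fin 3 → K) w = x v := by
    intro v
    simp [Pi.single_apply]
  have h3 : ∑ w, x w * F (P.root i) w = x (t i) - x (s i) := by
    simp only [hts, Pi.sub_apply, mul_sub, Finset.sum_sub_distrib, key]
  rw [← h3, hln]
  simp [F, Fin.sum_univ_three, x]
  ring

end Base

end RootPairing

end

/-! ### Heights, and positive roots as intervals. -/

section

open Module

set_option linter.unusedSectionVars false

namespace RootPairing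

variable {ι K M N : Type*} [Field K] [CharZero K] [AddCommGroup M] [Module K M] [AddCommGroup N]
  [Module K N] [Finite ι] {P : RootPairing ι K M N} [P.IsCrystallographic] [P.IsRootSystem]

/-- The span of a set of roots. -/
def spanRoots (P : RootPairing ι K M N) (Γ : Finset ι) : Submodule K M :=
  Submodule.span K (P.root '' (Γ : Set ι))

theorem root_mem_spanRoots {Γ : Finset ι} {i : ι} (hi : i ∈ Γ) : P.root i ∈ P.spanRoots Γ :=
  Submodule.subset_span ⟨i, hi, rfl⟩

theorem Base.repr_eq_zero_of_mem_spanRoots {b : P.Base} {Γ : Finset ι} (hΓ : Γ ⊆ b.support) {x : M}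
    (hx : x ∈ P.spanRoots Γ) {d : b.support} (hd : d.1 ∉ Γ) : b.toWeightBasis.repr x d = 0 := by
  classical
  have : P.spanRoots Γ ≤ LinearMap.ker (b.toWeightBasis.coord d) := by
    rw [spanRoots, Submodule.span_le]
    rintro _ ⟨i, hi, rfl⟩
    have hne : (⟨i, hΓ hi⟩ : b.support) ≠ d := by
      rintro rfl
      exact hd hi
    simpa [hne] using b.repr_root ⟨i, hΓ hi⟩ d
  simpa using this hx

/-- The height of a root relative to the simple roots outside `Γ`. -/
theorem Base.exists_height (b : P.Base) (Γ : Finset ι) (hΓ : Γ ⊆ b.support) :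
    ∃ h : Dual K M, (∀ i ∈ Γ, h (P.root i) = 0) ∧ (∀ i ∈ b.support, i ∉ Γ → h (P.root i) = 1) ∧
      (∀ i, b.IsPos i → ∃ n : ℕ, h (P.root i) = n ∧ (n = 0 → P.root i ∈ P.spanRoots Γ)) := by
  classical
  let h : Dual K M := b.toWeightBasis.constr K fun i => if i.1 ∈ Γ then 0 else 1
  have hb : ∀ i (hi : i ∈ b.support), h (P.root i) = if i ∈ Γ then 0 else 1 := by
    intro i hi
    have := b.toWeightBasis.constr_basis K (fun i => if i.1 ∈ Γ then (0 : K) else 1) ⟨i, hi⟩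
    rwa [b.toWeightBasis_apply] at this
  have hs : ∀ i ∈ b.support, ∃ n : ℕ, h (P.root i) = n ∧ (n = 0 → P.root i ∈ P.spanRoots Γ) := by
    intro i hi
    by_cases hiΓ : i ∈ Γ
    · exact ⟨0, by simp [hb i hi, hiΓ], fun _ => root_mem_spanRoots hiΓ⟩
    · exact ⟨1, by simp [hb i hi, hiΓ], by simp⟩
  refine ⟨h, fun i hi => by simp [hb i (hΓ hi), hi], fun i hi hi' => by simp [hb i hi, hi'], ?_⟩
  intro i hi
  refine hi.induction_on_add
    (p := fun i => ∃ n : ℕ, h (P.root i) = n ∧ (n = 0 → P.root i ∈ P.spanRoots Γ)) hs ?_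
  rintro i j k hk ⟨n, hn, hn'⟩ hj
  obtain ⟨m, hm, hm'⟩ := hs j hj
  refine ⟨n + m, by simp [hk, hn, hm], fun h0 => ?_⟩
  rw [hk]
  exact Submodule.add_mem _ (hn' (by omega)) (hm' (by omega))

namespace ArrowLabelling

variable {V : Type*} [DecidableEq V] {A : ArrowLabelling P V}

/-- The points of a labelling can be ordered so that the simple roots with a nontrivial label are
the steps between consecutive points. -/
theorem exists_height [P.IsIrreducible] [Nonempty V] (b : P.Base) {Γ : Finset ι}
    (hΓ : Γ ⊆ b.support)
    (hQ : ∀ i, P.root i ∈ P.spanRoots Γ ↔ A.tgt i = A.src i)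
    (hA : ∀ v, ∃ i, A.deg i v ≠ 0)
    (hφ : ∀ φ : Dual K M, P.spanRoots Γ ≤ LinearMap.ker φ →
        ∃ x : V → K, ∀ i, φ (P.root i) = x (A.tgt i) - x (A.src i)) :
    ∃ w : V → ℤ, Function.Injective w ∧
      (∀ d ∈ b.support, d ∉ Γ → w (A.tgt d) = w (A.src d) + 1) ∧
      (∀ i, b.IsPos i → A.tgt i ≠ A.src i → w (A.src i) < w (A.tgt i)) := by
  obtain ⟨h, h0, h1, hpos⟩ := b.exists_height Γ hΓ
  -- The height vanishes on `Γ`, hence is the difference of a potential `x` along arrows. Any two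
  -- points are joined by a root, so `x` is integral up to a constant; it is injective because roots
  -- with a nontrivial arrow have nonzero height.
  obtain ⟨x, hx⟩ := hφ h (by
    rw [spanRoots, Submodule.span_le]
    rintro _ ⟨i, hi, rfl⟩
    exact h0 i hi)
  obtain ⟨v₀⟩ := ‹Nonempty V›
  have hint : ∀ i, ∃ n : ℤ, h (P.root i) = n := by
    intro i
    rcases b.isPos_or_exists_neg i with hi | ⟨j, hj, hji⟩
    · obtain ⟨n, hn, -⟩ := hpos i hi
      exact ⟨n, by simp [hn]⟩
    · obtain ⟨n, hn, -⟩ := hpos j hj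
      refine ⟨-n, ?_⟩
      rw [hji, map_neg] at hn
      push_cast
      linear_combination -hn
  have hw : ∀ v, ∃ n : ℤ, x v - x v₀ = n := by
    intro v
    by_cases hv : v = v₀
    · exact ⟨0, by simp [hv]⟩
    · obtain ⟨i, h2, h3⟩ := exists_tgt_src hv (hA v) (hA v₀)
      obtain ⟨n, hn⟩ := hint i
      exact ⟨n, by rw [← hn, hx, h2, h3]⟩
  choose w hw using hw
  have hwh : ∀ i, ((w (A.tgt i) - w (A.src i) : ℤ) : K) = h (P.root i) := by
    intro i
    push_cast
    rw [← hw, ← hw, hx]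
    ring
  have hlt : ∀ i, b.IsPos i → A.tgt i ≠ A.src i → w (A.src i) < w (A.tgt i) := by
    intro i hi hne
    obtain ⟨n, hn, hn'⟩ := hpos i hi
    have : w (A.tgt i) - w (A.src i) = n := by
      have := hwh i
      rw [hn] at this
      exact_mod_cast this
    have hn0 : n ≠ 0 := fun e => hne ((hQ i).1 (hn' e))
    omega
  refine ⟨w, fun u v huv => ?_, fun d hd hdΓ => ?_, hlt⟩
  · by_contra hne
    obtain ⟨i, h2, h3⟩ := exists_tgt_src hne (hA u) (hA v)
    have hts : A.tgt i ≠ A.src i := by rwa [h2, h3]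
    rcases b.isPos_or_exists_neg i with hi | ⟨j, hj, hji⟩
    · have := hlt i hi hts
      rw [h2, h3] at this
      omega
    · have c3 := A.deg_neg hji (A.tgt i)
      have c4 := A.deg_neg hji (A.src i)
      have c5 : A.tgt j = A.src i ∧ A.src j = A.tgt i := by
        simp only [deg] at c3 c4
        grind
      have := hlt j hj (by rw [c5.1, c5.2]; exact hts.symm)
      rw [c5.1, c5.2, h2, h3] at this
      omega
  · have := hwh d
    rw [h1 d hd hdΓ] at this
    have : w (A.tgt d) - w (A.src d) = 1 := by exact_mod_cast this
    omega

/-- The coefficients of a positive root at the simple roots with a nontrivial label are given by an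
interval. -/
theorem repr_eq_one_or_eq_zero (b : P.Base) {Γ : Finset ι} (hΓ : Γ ⊆ b.support)
    (hQ : ∀ i, P.root i ∈ P.spanRoots Γ ↔ A.tgt i = A.src i)
    (hsub : ∀ i j, A.tgt i = A.tgt j → A.src i = A.src j → P.root i - P.root j ∈ P.spanRoots Γ)
    {w : V → ℤ} (hw : Function.Injective w)
    (hw1 : ∀ d ∈ b.support, d ∉ Γ → w (A.tgt d) = w (A.src d) + 1)
    (hwpos : ∀ i, b.IsPos i → A.tgt i ≠ A.src i → w (A.src i) < w (A.tgt i)) {i : ι}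
    (hi : b.IsPos i) : ∀ d : b.support, d.1 ∉ Γ →
      (b.toWeightBasis.repr (P.root i) d = 1 ∧ w (A.src i) ≤ w (A.src d) ∧
        w (A.tgt d) ≤ w (A.tgt i)) ∨
      (b.toWeightBasis.repr (P.root i) d = 0 ∧
        (w (A.tgt d) ≤ w (A.src i) ∨ w (A.tgt i) ≤ w (A.src d))) := by
  classical
  -- Two unit steps from the same point have the same arrow, so they agree modulo the span of `Γ`;
  -- simple roots outside `Γ` are independent there.
  have hdd : ∀ d d' : b.support, d.1 ∉ Γ → d'.1 ∉ Γ → w (A.src d) = w (A.src d') → d = d' := by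
    intro d d' hd hd' h
    have h1 := hw h
    have h2 : A.tgt d = A.tgt d' := hw (by rw [hw1 d d.2 hd, hw1 d' d'.2 hd', h])
    by_contra hne
    have := b.repr_eq_zero_of_mem_spanRoots hΓ (hsub d d' h2 h1) hd
    rw [map_sub, Finsupp.sub_apply, b.repr_root, b.repr_root, if_pos rfl,
      if_neg (Ne.symm hne)] at this
    norm_num at this
  suffices b.IsPos i ∧ ∀ d : b.support, d.1 ∉ Γ →
      (b.toWeightBasis.repr (P.root i) d = 1 ∧ w (A.src i) ≤ w (A.src d) ∧
        w (A.tgt d) ≤ w (A.tgt i)) ∨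
      (b.toWeightBasis.repr (P.root i) d = 0 ∧
        (w (A.tgt d) ≤ w (A.src i) ∨ w (A.tgt i) ≤ w (A.src d))) from this.2
  refine hi.induction_on_add (p := fun i => b.IsPos i ∧ ∀ d : b.support, d.1 ∉ Γ →
      (b.toWeightBasis.repr (P.root i) d = 1 ∧ w (A.src i) ≤ w (A.src d) ∧
        w (A.tgt d) ≤ w (A.tgt i)) ∨
      (b.toWeightBasis.repr (P.root i) d = 0 ∧
        (w (A.tgt d) ≤ w (A.src i) ∨ w (A.tgt i) ≤ w (A.src d)))) ?_ ?_
  · intro i hi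
    refine ⟨b.isPos_of_mem_support hi, fun d hd => ?_⟩
    have hdw := hw1 d d.2 hd
    rw [b.repr_root ⟨i, hi⟩ d]
    by_cases hid : (⟨i, hi⟩ : b.support) = d
    · left
      subst hid
      simp
    · right
      refine ⟨by simp [hid], ?_⟩
      by_cases hiΓ : i ∈ Γ
      · have := (hQ i).1 (root_mem_spanRoots hiΓ)
        rw [this]
        omega
      · have h1 := hw1 i hi hiΓ
        have h2 : w (A.src i) ≠ w (A.src d) := fun e => hid (hdd ⟨i, hi⟩ d hiΓ hd e)
        omega
  · rintro i j k hk ⟨hi, ih⟩ hj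
    have hkp := hi.add (b.isPos_of_mem_support hj) hk
    refine ⟨hkp, fun d hd => ?_⟩
    have hdw := hw1 d d.2 hd
    have ihd := ih d hd
    have hrep : b.toWeightBasis.repr (P.root k) d = b.toWeightBasis.repr (P.root i) d +
        if (⟨j, hj⟩ : b.support) = d then 1 else 0 := by
      rw [hk, map_add, Finsupp.add_apply, b.repr_root ⟨j, hj⟩ d]
    -- Adding a simple root of `Γ` changes neither the label nor the coefficients in question.
    -- Adding one outside `Γ` extends the interval by one step at either end.
    by_cases hjΓ : j ∈ Γ
    · have hjd : (⟨j, hj⟩ : b.support) ≠ d := by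
        rintro rfl
        exact hd hjΓ
      rw [if_neg hjd, add_zero] at hrep
      rw [hrep]
      have hjt := (hQ j).1 (root_mem_spanRoots hjΓ)
      have hdeg : ∀ v, A.deg k v = A.deg i v := by
        intro v
        rw [A.deg_add hk, add_eq_left]
        simp [deg, hjt]
      by_cases hit : A.tgt i = A.src i
      · have hkt : A.tgt k = A.src k := by
          have := hdeg (A.tgt k)
          simp only [deg, hit] at this
          grind
        rw [hit] at ihd
        rw [hkt]
        rcases ihd with h | h
        · omega
        · right
          exact ⟨h.1, by omega⟩
      · obtain ⟨h1, h2⟩ := A.tgt_src_eq hit hdeg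
        rwa [h1, h2]
    · have hjw := hw1 j hj hjΓ
      have hjt : A.tgt j ≠ A.src j := by
        intro e
        rw [e] at hjw
        omega
      have hjd : (⟨j, hj⟩ : b.support) ≠ d → w (A.src j) ≠ w (A.src d) := fun h e =>
        h (hdd ⟨j, hj⟩ d hjΓ hd e)
      have hjd' : (⟨j, hj⟩ : b.support) = d → w (A.src j) = w (A.src d) ∧
          w (A.tgt j) = w (A.tgt d) := by
        rintro rfl
        exact ⟨rfl, rfl⟩
      by_cases hit : A.tgt i = A.src i
      · have hdeg : ∀ v, A.deg k v = A.deg j v := by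
          intro v
          rw [A.deg_add hk, add_eq_right]
          simp [deg, hit]
        obtain ⟨h1, h2⟩ := A.tgt_src_eq hjt hdeg
        rw [h1, h2, hrep]
        rw [hit] at ihd
        have h3 : b.toWeightBasis.repr (P.root i) d = 0 := by
          rcases ihd with h | h
          · omega
          · exact h.1
        rw [h3]
        by_cases e : (⟨j, hj⟩ : b.support) = d
        · left
          obtain ⟨h4, h5⟩ := hjd' e
          simp [e, h4, h5]
        · right
          have := hjd e
          refine ⟨by simp [e], by omega⟩
      · have hiw := hwpos i hi hit
        have hkt : A.tgt k ≠ A.src k := by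
          intro e
          have h0 : ∀ v, A.deg i v + A.deg j v = 0 := fun v => by
            rw [← A.deg_add hk]
            simp [deg, e]
          have h1 := h0 (A.tgt i)
          have h2 := h0 (A.src i)
          have h3 : A.src j = A.tgt i ∧ A.tgt j = A.src i := by
            simp only [deg] at h1 h2
            grind
          rw [h3.1, h3.2] at hjw
          omega
        rcases A.comp_of_add hk hit hjt hkt with ⟨h1, h2, h3⟩ | ⟨h1, h2, h3⟩
        · rw [h2, h3, hrep]
          rw [h1] at ihd hiw
          by_cases e : (⟨j, hj⟩ : b.support) = d
          · obtain ⟨h4, h5⟩ := hjd' e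
            rw [if_pos e]
            rcases ihd with h | h
            · omega
            · left
              refine ⟨by simp [h.1], by omega, by omega⟩
          · have := hjd e
            rw [if_neg e, add_zero]
            rcases ihd with h | h
            · left
              exact ⟨h.1, by omega, by omega⟩
            · right
              exact ⟨h.1, by omega⟩
        · rw [h2, h3, hrep]
          rw [← h1] at ihd hiw
          by_cases e : (⟨j, hj⟩ : b.support) = d
          · obtain ⟨h4, h5⟩ := hjd' e
            rw [if_pos e]
            rcases ihd with h | h
            · omega
            · left
              refine ⟨by simp [h.1], by omega, by omega⟩
          · have := hjd e
            rw [if_neg e, add_zero]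
            rcases ihd with h | h
            · left
              exact ⟨h.1, by omega, by omega⟩
            · right
              exact ⟨h.1, by omega⟩

end ArrowLabelling

end RootPairing

end

/-! ### Existence of the maximal root. -/

section

open Module

set_option linter.unusedSectionVars false

namespace RootPairing

variable {ι K M N : Type*} [Field K] [CharZero K] [AddCommGroup M] [Module K M] [AddCommGroup N]
  [Module K N] [Finite ι] {P : RootPairing ι K M N} [P.IsCrystallographic] [P.IsRootSystem]

namespace Base

variable {b : P.Base}

theorem pairingIn_eq_sum {i : ι} {n : b.support → ℤ}
    (hn : ∀ d, b.toWeightBasis.repr (P.root i) d = n d) (j : ι) :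
    P.pairingIn ℤ i j = ∑ d, n d * P.pairingIn ℤ d j := by
  apply FaithfulSMul.algebraMap_injective ℤ K
  rw [P.algebraMap_pairingIn, map_sum, ← P.root_coroot'_eq_pairing]
  conv_lhs => rw [← b.toWeightBasis.sum_repr (P.root i), map_sum]
  refine Finset.sum_congr rfl fun d _ => ?_
  rw [map_smul, b.toWeightBasis_apply, hn, map_mul, P.algebraMap_pairingIn,
    P.root_coroot'_eq_pairing]
  simp

theorem IsPos.ne_neg {i j : ι} (hi : b.IsPos i) (hj : b.IsPos j) : P.root i ≠ -P.root j := by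
  let := P.indexNeg
  intro e
  have e' : P.root i = P.root (-j) := by simp [e]
  rw [P.root.injective e', IsPos.neg_iff_not] at hi
  exact hi hj

/-- Every positive root lies below a root to which no positive root can be added. -/
theorem IsPos.exists_above {i : ι} (hi : b.IsPos i) :
    ∃ j, b.IsPos j ∧ P.root j - P.root i ∈ AddSubmonoid.closure (P.root '' (b.support : Set ι)) ∧
      ∀ g k, b.IsPos g → P.root k ≠ P.root j + P.root g := by
  set S : Set ι := {j | b.IsPos j ∧
    P.root j - P.root i ∈ AddSubmonoid.closure (P.root '' (b.support : Set ι))} with hS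
  obtain ⟨j, hj, hmax⟩ := Set.exists_max_image S b.height (Set.toFinite S) ⟨i, hi, by simp⟩
  refine ⟨j, hj.1, hj.2, fun g k hg hk => ?_⟩
  have hkS : k ∈ S := by
    refine ⟨hj.1.add hg hk, ?_⟩
    rw [hk, add_sub_right_comm]
    exact add_mem hj.2 hg.mem_closure
  have h1 := hmax k hkS
  have h2 := (b.isPos_iff).1 hg
  rw [b.height_add hk] at h1
  omega

theorem pairingIn_nonneg_of_forall_ne {j : ι} (hj : b.IsPos j)
    (hmax : ∀ g k, b.IsPos g → P.root k ≠ P.root j + P.root g) {g : ι} (hg : b.IsPos g) :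
    0 ≤ P.pairingIn ℤ j g := by
  by_contra! h
  obtain ⟨k, hk⟩ := exists_root_eq_add_of_neg h (hj.ne_neg hg)
  exact hmax g k hg hk

variable [P.IsReduced] [P.IsIrreducible]

/-- A simple root missing from `j` but adjacent to one that occurs would pair negatively with `j`,
and could be added to it. Connectedness of the Dynkin diagram does the rest. -/
theorem repr_ne_zero_of_forall_ne {j : ι} (hj : b.IsPos j)
    (hmax : ∀ g k, b.IsPos g → P.root k ≠ P.root j + P.root g) (d : b.support) :
    b.toWeightBasis.repr (P.root j) d ≠ 0 := by
  have hnat := b.exists_nat_of_mem_closure hj.mem_closure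
  choose n hn using hnat
  obtain ⟨d₀, hd₀⟩ : ∃ d₀, b.toWeightBasis.repr (P.root j) d₀ ≠ 0 := by
    by_contra! h
    apply P.ne_zero j
    apply b.toWeightBasis.repr.injective
    ext d
    simp [h d]
  refine b.induction_on_cartanMatrix (fun d => b.toWeightBasis.repr (P.root j) d ≠ 0) hd₀ ?_
  intro i i' hi hii' h0
  have h1 := pairingIn_nonneg_of_forall_ne hj hmax (b.isPos_of_mem_support i'.2)
  rw [pairingIn_eq_sum (n := fun d => (n d : ℤ)) (by simpa using hn)] at h1
  have hne : i ≠ i' := by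
    rintro rfl
    exact hi h0
  have h2 : ∀ d ∈ Finset.univ, (n d : ℤ) * P.pairingIn ℤ d i' ≤ 0 := by
    intro d _
    by_cases hd : d = i'
    · have : n d = 0 := by
        rw [hn, ← hd] at h0
        exact_mod_cast h0
      simp [this]
    · exact mul_nonpos_of_nonneg_of_nonpos (by positivity)
        (b.cartanMatrix_le_zero_of_ne d i' hd)
  have h3 : (n i : ℤ) * P.pairingIn ℤ i i' < 0 := by
    apply mul_neg_of_pos_of_neg
    · have : n i ≠ 0 := by
        rintro e
        rw [hn, e] at hi
        simp at hi
      exact_mod_cast Nat.pos_of_ne_zero this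
    · apply lt_of_le_of_ne (b.cartanMatrix_le_zero_of_ne i i' hne)
      intro e
      exact hii' (b.cartanMatrix_apply_eq_zero_iff_symm.1 e)
  have := Finset.sum_lt_sum h2 ⟨i, Finset.mem_univ _, h3⟩
  simp only [Finset.sum_const_zero] at this
  omega

/-- Both roots are dominant and `i` involves every simple root, so they pair positively and their
difference, if nonzero, is a root. Whatever its sign, it or its negative is a positive root that can
be added to `j` or to `i`. -/
theorem eq_of_forall_ne {i j : ι} (hi : b.IsPos i)
    (himax : ∀ g k, b.IsPos g → P.root k ≠ P.root i + P.root g) (hj : b.IsPos j)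
    (hjmax : ∀ g k, b.IsPos g → P.root k ≠ P.root j + P.root g) : i = j := by
  by_contra hne
  have hnat := b.exists_nat_of_mem_closure hi.mem_closure
  choose n hn using hnat
  have hpos : 0 < P.pairingIn ℤ i j := by
    rw [pairingIn_eq_sum (n := fun d => (n d : ℤ)) (by simpa using hn)]
    have hnn : ∀ d : b.support, 0 ≤ P.pairingIn ℤ d j := by
      intro d
      have := pairingIn_nonneg_of_forall_ne hj hjmax (b.isPos_of_mem_support d.2)
      by_contra! h
      rw [P.pairingIn_lt_zero_iff] at h
      omega
    obtain ⟨d, hd, hdj⟩ := hj.exists_mem_support_pos_pairingIn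
    refine Finset.sum_pos' (fun d _ => mul_nonneg (by positivity) (hnn d))
      ⟨⟨d, hd⟩, Finset.mem_univ _, mul_pos ?_ hdj⟩
    have := repr_ne_zero_of_forall_ne hi himax ⟨d, hd⟩
    rw [hn] at this
    exact_mod_cast Nat.pos_of_ne_zero (by exact_mod_cast this)
  obtain ⟨k, hk⟩ := exists_root_eq_sub_of_pos hpos hne
  rcases b.isPos_or_exists_neg k with hk' | ⟨k', hk', hkk'⟩
  · exact hjmax k i hk' (by rw [hk]; abel)
  · exact himax k' j hk' (by rw [hkk', hk]; abel)

variable (b) in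
/-- The maximal root exists. -/
theorem exists_isMaximal : ∃ θ, b.IsMaximal θ := by
  have : Nonempty ι := by
    by_contra h
    rw [not_nonempty_iff] at h
    have h1 : Submodule.span K (Set.range P.root) = ⊤ := IsRootSystem.span_root_eq_top
    have := IsIrreducible.nontrivial P
    rw [Set.range_eq_empty, Submodule.span_empty] at h1
    exact bot_ne_top h1
  obtain ⟨i₀, hi₀⟩ := b.support_nonempty
  obtain ⟨θ, hθ, -, hmax⟩ := (b.isPos_of_mem_support hi₀).exists_above
  refine ⟨θ, fun i => ?_⟩
  rcases b.isPos_or_exists_neg i with hi | ⟨j, hj, hji⟩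
  · obtain ⟨k, hk, hki, hkmax⟩ := hi.exists_above
    rwa [eq_of_forall_ne hθ hmax hk hkmax]
  · rw [sub_eq_add_neg, ← hji]
    exact add_mem hθ.mem_closure hj.mem_closure

end Base

end RootPairing

end

/-! ### The Dynkin graph and the recognition of type `A`. -/

section

open Module

set_option linter.unusedSectionVars false

/-- A connected finite graph with all degrees at most two and with a vertex of degree at most one
is a path. -/
theorem SimpleGraph.Connected.exists_equiv_fin {V : Type*} [Finite V] {G : SimpleGraph V}
    (hG : G.Connected) {v₀ : V} (h₀ : ∀ u v, G.Adj v₀ u → G.Adj v₀ v → u = v)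
    (h : ∀ x u v w, G.Adj x u → G.Adj x v → G.Adj x w → u = v ∨ u = w ∨ v = w) :
    ∃ (n : ℕ) (e : V ≃ Fin n), ∀ i j, G.Adj i j ↔
      ((e i).val + 1 = (e j).val ∨ (e j).val + 1 = (e i).val) := by
  have hpred : ∀ n x, G.dist v₀ x = n + 1 → ∃ y, G.dist v₀ y = n ∧ G.Adj y x := by
    intro n x hx
    obtain ⟨p, hp⟩ := hG.exists_walk_length_eq_dist x v₀
    rw [SimpleGraph.dist_comm, hx] at hp
    cases p with
    | nil => simp at hp
    | cons hxy q =>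
      rename_i y
      refine ⟨y, ?_, hxy.symm⟩
      have h1 := SimpleGraph.dist_le q
      rw [SimpleGraph.dist_comm] at h1
      simp only [SimpleGraph.Walk.length_cons] at hp
      have h2 := hxy.symm.diff_dist_adj (u := v₀)
      omega
  -- Vertices are numbered by their distance from `v₀`. The only vertex at distance `n + 1` already
  -- has a neighbour at distance `n`, so the degree bound leaves room for one at distance `n + 2`.
  have hinj : ∀ n x y, G.dist v₀ x = n → G.dist v₀ y = n → x = y := by
    intro n
    induction n using Nat.strong_induction_on with
    | _ n ih =>
    intro x y hx hy
    match n, hx, hy, ih with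
    | 0, hx, hy, ih =>
      rw [hG.dist_eq_zero_iff] at hx hy
      rw [← hx, ← hy]
    | 1, hx, hy, ih =>
      rw [SimpleGraph.dist_eq_one_iff_adj] at hx hy
      exact h₀ x y hx hy
    | n + 2, hx, hy, ih =>
      obtain ⟨x', hx', hxx⟩ := hpred _ _ hx
      obtain ⟨y', hy', hyy⟩ := hpred _ _ hy
      obtain rfl := ih (n + 1) (by omega) _ _ hx' hy'
      obtain ⟨z, hz, hzx⟩ := hpred _ _ hx'
      rcases h x' x y z hxx hyy hzx.symm with e | rfl | rfl
      · exact e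
      · omega
      · omega
  have hlt : ∀ x, G.dist v₀ x < Nat.card V := by
    intro x
    have hall : ∀ k ≤ G.dist v₀ x, ∃ y, G.dist v₀ y = k := by
      intro k hk
      induction hk using Nat.decreasingInduction with
      | of_succ k _ ih =>
        obtain ⟨y, hy⟩ := ih
        obtain ⟨z, hz, -⟩ := hpred _ _ hy
        exact ⟨z, hz⟩
      | self => exact ⟨x, rfl⟩
    have : Nonempty V := ⟨x⟩
    choose! g hg using hall
    have h1 : Function.Injective fun k : Fin (G.dist v₀ x + 1) => g k := by
      intro k k' hkk
      have h2 := hg k (by omega)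
      have h3 := hg k' (by omega)
      simp only at hkk
      rw [hkk, h3] at h2
      exact Fin.ext h2.symm
    have := Nat.card_le_card_of_injective _ h1
    rw [Nat.card_fin] at this
    omega
  let f : V → Fin (Nat.card V) := fun x => ⟨G.dist v₀ x, hlt x⟩
  have hf : Function.Bijective f := by
    refine (Nat.bijective_iff_injective_and_card f).2 ⟨fun x y hxy => ?_, by simp⟩
    exact hinj _ _ _ rfl (Fin.val_eq_of_eq hxy).symm
  refine ⟨Nat.card V, Equiv.ofBijective f hf, fun i j => ?_⟩
  simp only [Equiv.ofBijective_apply, f]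
  constructor
  · intro hij
    have h1 := hij.diff_dist_adj (u := v₀)
    have h2 : G.dist v₀ i ≠ G.dist v₀ j := fun e => hij.ne (hinj _ i j rfl e.symm)
    omega
  · rintro (e | e)
    · obtain ⟨y, hy, hyj⟩ := hpred _ _ e.symm
      rwa [hinj _ _ _ rfl hy]
    · obtain ⟨y, hy, hyj⟩ := hpred _ _ e.symm
      rw [hinj _ _ _ rfl hy]
      exact hyj.symm

namespace RootPairing

variable {ι K M N : Type*} [Field K] [CharZero K] [AddCommGroup M] [Module K M] [AddCommGroup N]
  [Module K N] [Finite ι] {P : RootPairing ι K M N} [P.IsCrystallographic] [P.IsRootSystem]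

namespace Base

variable (b : P.Base)

/-- The graph of the Dynkin diagram. -/
def dynkinGraph : SimpleGraph b.support where
  Adj i j := i ≠ j ∧ b.cartanMatrix i j ≠ 0
  symm := ⟨fun _ _ h => ⟨h.1.symm, fun e => h.2 (b.cartanMatrix_apply_eq_zero_iff_symm.1 e)⟩⟩
  loopless := ⟨fun _ h => h.1 rfl⟩

theorem cartanMatrix_le_neg_one {i j : b.support} (h : b.dynkinGraph.Adj i j) :
    b.cartanMatrix i j ≤ -1 := by
  have := b.cartanMatrix_le_zero_of_ne i j h.1
  have := h.2
  omega

theorem connected_dynkinGraph [P.IsReduced] [P.IsIrreducible] : b.dynkinGraph.Connected := by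
  have : Nonempty b.support := by
    have : Nonempty ι := by
      obtain ⟨θ, -⟩ := b.exists_isMaximal
      exact ⟨θ⟩
    obtain ⟨i, hi⟩ := b.support_nonempty
    exact ⟨⟨i, hi⟩⟩
  refine ⟨fun i j => ?_⟩
  refine b.induction_on_cartanMatrix (fun j => b.dynkinGraph.Reachable i j) (.refl i) ?_
  intro j k hj hkj
  by_cases hjk : j = k
  · rwa [← hjk]
  · exact hj.trans (SimpleGraph.Adj.reachable (G := b.dynkinGraph)
      ⟨hjk, fun e => hkj (b.cartanMatrix_apply_eq_zero_iff_symm.1 e)⟩)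

open Classical in
/-- The sum of the simple roots over a connected part of the Dynkin diagram is a root. -/
theorem exists_repr_eq_indicator [P.IsReduced] {S : Set b.support}
    (hS : (b.dynkinGraph.induce S).Connected) :
    ∃ i, b.IsPos i ∧ ∀ d, b.toWeightBasis.repr (P.root i) d = if d ∈ S then 1 else 0 := by
  obtain ⟨s₀⟩ := hS.nonempty
  -- Take a largest subset whose sum is a root. If it were not all of `S`, an edge would leave it,
  -- and the new simple root, pairing negatively with the sum, could be added.
  let F : Set (Set b.support) := {T | T ⊆ S ∧ T.Nonempty ∧
    ∃ i, b.IsPos i ∧ ∀ d, b.toWeightBasis.repr (P.root i) d = if d ∈ T then 1 else 0}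
  obtain ⟨T, ⟨hTS, hT, i, hi, hiT⟩, hmax⟩ := Set.exists_max_image F Set.ncard (Set.toFinite F)
    ⟨{s₀.1}, by simp, by simp, s₀.1, b.isPos_of_mem_support s₀.1.2, fun d => by
      rw [b.repr_root]
      simp [eq_comm]⟩
  by_cases hTS' : T = S
  · exact ⟨i, hi, hTS' ▸ hiT⟩
  exfalso
  obtain ⟨s, hs, hsT⟩ := Set.exists_of_ssubset (hTS.ssubset_of_ne hTS')
  obtain ⟨t, ht⟩ := hT
  obtain ⟨p⟩ := hS.preconnected ⟨t, hTS ht⟩ ⟨s, hs⟩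
  obtain ⟨e, -, he1, he2⟩ := p.exists_boundary_dart {x | x.1 ∈ T} ht hsT
  have hadj : b.dynkinGraph.Adj e.fst.1 e.snd.1 := e.adj
  set u := e.fst.1
  set v := e.snd.1
  replace he1 : u ∈ T := he1
  replace he2 : v ∉ T := he2
  have hneg : P.pairingIn ℤ i v < 0 := by
    rw [pairingIn_eq_sum (n := fun d => if d ∈ T then 1 else 0) (by simpa using hiT)]
    refine Finset.sum_neg' (fun d _ => ?_) ⟨u, Finset.mem_univ _, ?_⟩
    · split_ifs with hd
      · rw [one_mul]
        exact b.cartanMatrix_le_zero_of_ne d v (by rintro rfl; exact he2 hd)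
      · simp
    · rw [if_pos he1, one_mul]
      have := b.cartanMatrix_le_neg_one hadj
      change b.cartanMatrix u v < 0
      omega
  obtain ⟨k, hk⟩ := exists_root_eq_add_of_neg hneg (hi.ne_neg (b.isPos_of_mem_support v.2))
  have hkF : insert v T ∈ F := by
    refine ⟨Set.insert_subset e.snd.2 hTS, ⟨v, by simp⟩, k,
      hi.add (b.isPos_of_mem_support v.2) hk, fun d => ?_⟩
    rw [hk, map_add, Finsupp.add_apply, hiT, b.repr_root]
    by_cases hdv : d = v
    · subst hdv
      simpa using he2
    · simp [hdv, Ne.symm hdv]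
  have := hmax _ hkF
  rw [Set.ncard_insert_of_notMem he2] at this
  omega

variable {b}

theorem IsMaximal.coeff_nonneg {θ : ι} (hθ : b.IsMaximal θ) (d : b.support) (i : ι) :
    ∃ n : ℕ, b.toWeightBasis.repr (P.root θ) d - b.toWeightBasis.repr (P.root i) d = n := by
  obtain ⟨n, hn⟩ := b.exists_nat_of_mem_closure (hθ i) d
  exact ⟨n, by rw [← hn, map_sub, Finsupp.sub_apply]⟩

theorem IsMaximal.exists_coeff {θ : ι} (hθ : b.IsMaximal θ) :
    ∃ n : b.support → ℕ, (∀ d, b.toWeightBasis.repr (P.root θ) d = n d) ∧ ∀ d, 0 < n d := by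
  classical
  have h : ∀ d : b.support, ∃ n : ℕ, b.toWeightBasis.repr (P.root θ) d = n ∧ 0 < n := by
    intro d
    obtain ⟨n, hn⟩ := hθ.coeff_nonneg d d
    rw [b.repr_root, if_pos rfl] at hn
    exact ⟨n + 1, by push_cast; linear_combination hn, by omega⟩
  choose n hn using h
  exact ⟨n, fun d => (hn d).1, fun d => (hn d).2⟩

theorem IsMaximal.isPos [Nonempty b.support] {θ : ι} (hθ : b.IsMaximal θ) : b.IsPos θ := by
  classical
  obtain ⟨n, hn, hn0⟩ := hθ.exists_coeff
  rcases b.isPos_or_exists_neg θ with h | ⟨j, hj, hji⟩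
  · exact h
  · exfalso
    obtain ⟨d⟩ := ‹Nonempty b.support›
    obtain ⟨m, hm⟩ := b.exists_nat_of_mem_closure hj.mem_closure d
    rw [hji, map_neg, Finsupp.neg_apply, hn] at hm
    have h1 : ((n d + m : ℕ) : K) = 0 := by push_cast; linear_combination -hm
    rw [Nat.cast_eq_zero] at h1
    have := hn0 d
    omega

theorem IsMaximal.root_ne_add {θ : ι} (hθ : b.IsMaximal θ) (g k : ι) (hg : b.IsPos g) :
    P.root k ≠ P.root θ + P.root g := by
  intro e
  apply P.ne_zero g
  apply b.toWeightBasis.repr.injective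
  ext d
  obtain ⟨n, hn⟩ := hθ.coeff_nonneg d k
  obtain ⟨m, hm⟩ := b.exists_nat_of_mem_closure hg.mem_closure d
  rw [e, map_add, Finsupp.add_apply, hm] at hn
  have h1 : ((n + m : ℕ) : K) = 0 := by push_cast; linear_combination -hn
  rw [Nat.cast_eq_zero] at h1
  rw [hm, map_zero, Finsupp.zero_apply, Nat.cast_eq_zero]
  omega

/-- If the maximal root has coefficient one at a simple root with at least two neighbours, then
the Dynkin diagram is of type `A`. -/
theorem IsMaximal.exists_equiv_cartanMatrix_A [P.IsReduced] [P.IsIrreducible] {θ : ι}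
    (hθ : b.IsMaximal θ)
    {d u v : b.support} (hd : b.toWeightBasis.repr (P.root θ) d = 1)
    (hdu : b.dynkinGraph.Adj d u) (hdv : b.dynkinGraph.Adj d v) (huv : u ≠ v) :
    ∃ (n : ℕ) (e : b.support ≃ Fin n), ∀ i j, b.cartanMatrix i j = CartanMatrix.A n (e i) (e j) := by
  classical
  have : Nonempty b.support := ⟨d⟩
  obtain ⟨n, hn, hn0⟩ := hθ.exists_coeff
  have hpair : ∀ j : b.support, P.pairingIn ℤ θ j = ∑ i, (n i : ℤ) * b.cartanMatrix i j :=
    fun j => pairingIn_eq_sum (n := fun i => (n i : ℤ)) (by simpa using hn) j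
  have hterm : ∀ i j : b.support, i ≠ j → (n i : ℤ) * b.cartanMatrix i j ≤ 0 := fun i j hij =>
    mul_nonpos_of_nonneg_of_nonpos (by positivity) (b.cartanMatrix_le_zero_of_ne i j hij)
  have hsum : ∀ (j : b.support) (s : Finset b.support), j ∉ s →
      P.pairingIn ℤ θ j ≤ 2 * n j + ∑ i ∈ s, (n i : ℤ) * b.cartanMatrix i j := by
    intro j s hjs
    rw [hpair]
    have h1 : ∑ i ∈ insert j s, (n i : ℤ) * b.cartanMatrix i j =
        2 * n j + ∑ i ∈ s, (n i : ℤ) * b.cartanMatrix i j := by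
      rw [Finset.sum_insert hjs, b.cartanMatrix_apply_same]
      ring
    rw [← h1, ← Finset.sum_add_sum_compl (insert j s), add_le_iff_nonpos_right]
    refine Finset.sum_nonpos fun i hi => hterm i j ?_
    rintro rfl
    simp at hi
  have hdom : ∀ j : b.support, 0 ≤ P.pairingIn ℤ θ j := fun j =>
    pairingIn_nonneg_of_forall_ne hθ.isPos (fun g k hg => hθ.root_ne_add g k hg)
      (b.isPos_of_mem_support j.2)
  have hadj : ∀ {i j : b.support}, b.dynkinGraph.Adj i j →
      (n i : ℤ) * b.cartanMatrix i j ≤ - n i := by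
    intro i j hij
    have := b.cartanMatrix_le_neg_one hij
    nlinarith [hn0 i]
  -- Dominance of `θ` at `j` gives `n x + n y ≤ 2 * n j = 2`.
  have hstep : ∀ {j x y : b.support}, n j = 1 → b.dynkinGraph.Adj x j → b.dynkinGraph.Adj y j →
      x ≠ y → n x = 1 ∧ n y = 1 := by
    intro j x y hj hx hy hxy
    have h1 := hsum j {x, y} (by simp [hx.1.symm, hy.1.symm])
    rw [Finset.sum_pair hxy] at h1
    have := hdom j
    have := hadj hx
    have := hadj hy
    have := hn0 x
    have := hn0 y
    omega
  have hdeg : ∀ x u v w, b.dynkinGraph.Adj x u → b.dynkinGraph.Adj x v → b.dynkinGraph.Adj x w →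
      n x = 1 → u = v ∨ u = w ∨ v = w := by
    intro x u v w hu hv hw hx
    by_contra! hne
    obtain ⟨h1, h2, h3⟩ := hne
    have h := hsum x {u, v, w} (by simp [hu.1, hv.1, hw.1])
    rw [Finset.sum_insert (by simp [h1, h2]), Finset.sum_pair h3] at h
    have := hdom x
    have := hadj hu.symm
    have := hadj hv.symm
    have := hadj hw.symm
    have := hn0 u
    have := hn0 v
    have := hn0 w
    omega
  have hd1 : n d = 1 := by
    rw [hn] at hd
    exact_mod_cast hd
  -- Coefficient one spreads along the diagram: beyond `d`, each vertex is reached from a neighbour,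
  -- and any further neighbour forms with it a pair for `hstep`.
  have hall : ∀ i, n i = 1 ∧ ∀ j, b.dynkinGraph.Adj i j → n j = 1 := by
    intro i
    refine b.induction_on_cartanMatrix
      (fun i => n i = 1 ∧ ∀ j, b.dynkinGraph.Adj i j → n j = 1) (i := d) ⟨hd1, ?_⟩ ?_
    · intro j hj
      by_cases hju : j = u
      · exact hju ▸ (hstep hd1 hdu.symm hdv.symm huv).1
      · exact (hstep hd1 hj.symm hdu.symm hju).1
    · rintro i j ⟨hi, hi'⟩ hji
      by_cases hij : i = j
      · exact hij ▸ ⟨hi, hi'⟩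
      · have hadj' : b.dynkinGraph.Adj j i := ⟨Ne.symm hij, hji⟩
        refine ⟨hi' j hadj'.symm, fun k hk => ?_⟩
        by_cases hki : k = i
        · rwa [hki]
        · exact (hstep (hi' j hadj'.symm) hk.symm hadj'.symm hki).1
  have hone : ∀ i, n i = 1 := fun i => (hall i).1
  have hcart : ∀ i j, b.dynkinGraph.Adj i j → b.cartanMatrix i j = -1 := by
    intro i j hij
    have h1 := b.cartanMatrix_le_neg_one hij
    by_contra hne
    -- Reflecting the simple root `i` in `j` gives a root with coefficient `-b.cartanMatrix i j` at
    -- `j`, which cannot exceed the coefficient one of `θ`.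
    let k := P.reflectionPerm j i
    have hk : P.root k = P.root i - P.pairing i j • P.root j := by
      rw [P.root_reflectionPerm, P.reflection_apply_root]
    obtain ⟨m, hm⟩ := hθ.coeff_nonneg j k
    rw [hk, hn, hone, map_sub, map_smul, Finsupp.sub_apply, Finsupp.smul_apply, b.repr_root,
      b.repr_root, if_neg hij.1, if_pos rfl, ← P.algebraMap_pairingIn ℤ] at hm
    change _ - (0 - (algebraMap ℤ K (b.cartanMatrix i j)) • (1 : K)) = _ at hm
    have h2 : ((1 + b.cartanMatrix i j : ℤ) : K) = ((m : ℤ) : K) := by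
      push_cast
      simpa using hm
    rw [Int.cast_inj] at h2
    omega
  obtain ⟨v₀, hv₀⟩ : ∃ v₀, ∀ u v, b.dynkinGraph.Adj v₀ u → b.dynkinGraph.Adj v₀ v → u = v := by
    by_contra! hne
    -- A simple root pairing positively with `θ` is an end of the path: two neighbours would make
    -- the pairing at most `2 - 1 - 1 = 0`.
    obtain ⟨j, hj, hjpos⟩ := hθ.isPos.exists_mem_support_pos_pairingIn
    obtain ⟨x, y, hx, hy, hxy⟩ := hne ⟨j, hj⟩
    have h1 := hsum ⟨j, hj⟩ {x, y} (by simp [hx.1, hy.1])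
    rw [Finset.sum_pair hxy] at h1
    have := hadj hx.symm
    have := hadj hy.symm
    have := hone x
    have := hone y
    have := hone ⟨j, hj⟩
    change P.pairingIn ℤ θ j ≤ _ at h1
    rw [P.zero_lt_pairingIn_iff'] at hjpos
    omega
  obtain ⟨m, e, he⟩ := b.connected_dynkinGraph.exists_equiv_fin hv₀
    (fun x u v w hu hv hw => hdeg x u v w hu hv hw (hone x))
  refine ⟨m, e, fun i j => ?_⟩
  by_cases hij : i = j
  · subst hij
    simp [CartanMatrix.A]
  · have hij' : e i ≠ e j := fun h => hij (e.injective h)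
    simp only [CartanMatrix.A, Matrix.of_apply, if_neg hij', ← he]
    split_ifs with h
    · exact hcart i j h
    · by_contra h0
      exact h ⟨hij, h0⟩

end Base

/-- If a root system that is not of type `A` admits an arrow labelling compatible with `Γ`, then at
most two simple roots lie outside `Γ`. -/
theorem ArrowLabelling.exists_equiv_cartanMatrix_A {V : Type*} [DecidableEq V]
    {A : ArrowLabelling P V} [P.IsReduced] [P.IsIrreducible] (b : P.Base) {Γ : Finset ι}
    (hΓ : Γ ⊆ b.support)
    (hQ : ∀ i, P.root i ∈ P.spanRoots Γ ↔ A.tgt i = A.src i)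
    (hsub : ∀ i j, A.tgt i = A.tgt j → A.src i = A.src j → P.root i - P.root j ∈ P.spanRoots Γ)
    {w : V → ℤ} (hw : Function.Injective w)
    (hw1 : ∀ d ∈ b.support, d ∉ Γ → w (A.tgt d) = w (A.src d) + 1)
    (hwpos : ∀ i, b.IsPos i → A.tgt i ≠ A.src i → w (A.src i) < w (A.tgt i))
    (h : 3 ≤ ((b.support : Set ι) \ Γ).ncard) :
    ∃ (n : ℕ) (e : b.support ≃ Fin n), ∀ i j,
      b.cartanMatrix i j = CartanMatrix.A n (e i) (e j) := by
  classical
  have hrepr : ∀ i, b.IsPos i → _ := fun i hi =>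
    repr_eq_one_or_eq_zero b hΓ hQ hsub hw hw1 hwpos hi
  have hinj : ∀ d d' : b.support, d.1 ∉ Γ → d'.1 ∉ Γ → w (A.src d) = w (A.src d') → d = d' := by
    intro d d' hd hd' e
    have h1 := hw1 d d.2 hd
    have h2 := hw1 d' d'.2 hd'
    rcases hrepr d' (b.isPos_of_mem_support d'.2) d hd with h | h
    · have h3 := h.1
      rw [b.repr_root] at h3
      by_contra hne
      simp [Ne.symm hne] at h3
    · omega
  obtain ⟨d₁, d₂, d₃, hd₁, hd₂, hd₃, h12, h23⟩ : ∃ d₁ d₂ d₃ : b.support, d₁.1 ∉ Γ ∧ d₂.1 ∉ Γ ∧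
      d₃.1 ∉ Γ ∧ w (A.src d₁) < w (A.src d₂) ∧ w (A.src d₂) < w (A.src d₃) := by
    obtain ⟨x, ⟨hx, hxΓ⟩, y, ⟨hy, hyΓ⟩, z, ⟨hz, hzΓ⟩, hxy, hxz, hyz⟩ :=
      (Set.two_lt_ncard (Set.toFinite _)).1 h
    have h1 : w (A.src x) ≠ w (A.src y) := fun e =>
      hxy (congrArg Subtype.val (hinj ⟨x, hx⟩ ⟨y, hy⟩ hxΓ hyΓ e))
    have h2 : w (A.src x) ≠ w (A.src z) := fun e =>
      hxz (congrArg Subtype.val (hinj ⟨x, hx⟩ ⟨z, hz⟩ hxΓ hzΓ e))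
    have h3 : w (A.src y) ≠ w (A.src z) := fun e =>
      hyz (congrArg Subtype.val (hinj ⟨y, hy⟩ ⟨z, hz⟩ hyΓ hzΓ e))
    rcases lt_or_gt_of_ne h1 with h1 | h1 <;> rcases lt_or_gt_of_ne h2 with h2 | h2 <;>
      rcases lt_or_gt_of_ne h3 with h3 | h3
    · exact ⟨⟨x, hx⟩, ⟨y, hy⟩, ⟨z, hz⟩, hxΓ, hyΓ, hzΓ, h1, h3⟩
    · exact ⟨⟨x, hx⟩, ⟨z, hz⟩, ⟨y, hy⟩, hxΓ, hzΓ, hyΓ, h2, h3⟩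
    · omega
    · exact ⟨⟨z, hz⟩, ⟨x, hx⟩, ⟨y, hy⟩, hzΓ, hxΓ, hyΓ, h2, h1⟩
    · exact ⟨⟨y, hy⟩, ⟨x, hx⟩, ⟨z, hz⟩, hyΓ, hxΓ, hzΓ, h1, h2⟩
    · omega
    · exact ⟨⟨y, hy⟩, ⟨z, hz⟩, ⟨x, hx⟩, hyΓ, hzΓ, hxΓ, h3, h2⟩
    · exact ⟨⟨z, hz⟩, ⟨y, hy⟩, ⟨x, hx⟩, hzΓ, hyΓ, hxΓ, h3, h1⟩
  obtain ⟨θ, hθ⟩ := b.exists_isMaximal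
  have : Nonempty b.support := ⟨d₁⟩
  obtain ⟨n, hn, hn0⟩ := hθ.exists_coeff
  have hθ2 : b.toWeightBasis.repr (P.root θ) d₂ = 1 := by
    rcases hrepr θ hθ.isPos d₂ hd₂ with h | h
    · exact h.1
    · have := h.1
      rw [hn, Nat.cast_eq_zero] at this
      have := hn0 d₂
      omega
  have hne1 : d₁ ≠ d₂ := by
    rintro rfl
    omega
  have hne3 : d₃ ≠ d₂ := by
    rintro rfl
    omega
  obtain ⟨u, hu⟩ : ∃ u, b.dynkinGraph.Adj d₂ u := by
    have : Nontrivial b.support := ⟨_, _, hne1⟩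
    exact b.connected_dynkinGraph.preconnected.exists_adj_of_nontrivial d₂
  by_cases hleaf : ∃ v, b.dynkinGraph.Adj d₂ v ∧ u ≠ v
  · obtain ⟨v, hv, huv⟩ := hleaf
    exact hθ.exists_equiv_cartanMatrix_A hθ2 hu hv huv
  · exfalso
    -- If `d₂` were a leaf, the other simple roots would form a connected diagram and sum to a root,
    -- with coefficients `1, 0, 1` at `d₁, d₂, d₃`. These do not come from an interval.
    push Not at hleaf
    have hS : (b.dynkinGraph.induce {d₂}ᶜ).Connected := by
      apply b.connected_dynkinGraph.induce_compl_singleton_of_degree_eq_one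
      rw [SimpleGraph.degree_eq_one_iff_existsUnique_adj]
      exact ⟨u, hu, fun v hv => (hleaf v hv).symm⟩
    obtain ⟨i, hi, hii⟩ := b.exists_repr_eq_indicator hS
    have h1 := hrepr i hi d₁ hd₁
    have h2 := hrepr i hi d₂ hd₂
    have h3 := hrepr i hi d₃ hd₃
    simp only [hii, Set.mem_compl_iff, Set.mem_singleton_iff, hne1, hne3, not_true_eq_false,
      not_false_eq_true, if_true, if_false, one_ne_zero, zero_ne_one, true_and, false_and,
      or_false, false_or] at h1 h2 h3
    have := hw1 d₁ d₁.2 hd₁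
    have := hw1 d₂ d₂.2 hd₂
    have := hw1 d₃ d₃.2 hd₃
    omega

end RootPairing

end

/-! ### Quadratic pairs and quotients of type `A`. -/

section

open Module

set_option linter.unusedSectionVars false

namespace RootPairing

variable {ι K M N : Type*} [Field K] [CharZero K] [AddCommGroup M] [Module K M] [AddCommGroup N]
  [Module K N] [Finite ι] {P : RootPairing ι K M N} [P.IsCrystallographic] [P.IsRootSystem]

open ArrowLabelling

omit [CharZero K] in
theorem sub_smul_single_eq_comp_swap {V : Type*} [DecidableEq V] {c d : V} (hcd : c ≠ d)
    (v : V → K) :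
    v - (v c - v d) • (Pi.single c 1 - Pi.single d 1) = v ∘ Equiv.swap c d := by
  ext x
  simp only [Pi.sub_apply, Pi.smul_apply, smul_eq_mul, Function.comp_apply]
  rcases eq_or_ne x c with rfl | hxc
  · simp [hcd]
  rcases eq_or_ne x d with rfl | hxd
  · simp [hcd.symm]
  · simp [hxc, hxd, Equiv.swap_apply_of_ne_of_ne hxc hxd]

omit [CharZero K] in
theorem single_comp_swap {V : Type*} [DecidableEq V] (c d s : V) :
    (Pi.single s 1 : V → K) ∘ Equiv.swap c d = Pi.single (Equiv.swap c d s) 1 := by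
  ext x
  simp only [Function.comp_apply, Pi.single_apply, Equiv.swap_apply_eq_iff]

/-- In type `A` every functional belongs to a quadratic pair. -/
theorem Base.exists_isQuadraticPair_of_cartanMatrix_A [P.IsReduced] (b : P.Base) {n : ℕ}
    (e : b.support ≃ Fin n) (he : ∀ i j, b.cartanMatrix i j = CartanMatrix.A n (e i) (e j))
    (l : Dual K M) : ∃ m, IsQuadraticPair P l m 1 := by
  classical
  let F : M →ₗ[K] (Fin (n + 1) → K) := b.toWeightBasis.constr K fun d =>
    Pi.single (e d).castSucc 1 - Pi.single (e d).succ 1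
  have hF : ∀ d : b.support, F (P.root d) =
      Pi.single (e d).castSucc 1 - Pi.single (e d).succ 1 := by
    intro d
    rw [← b.toWeightBasis_apply]
    exact b.toWeightBasis.constr_basis K _ d
  -- Through `F`, simple coroots are differences of consecutive coordinates, so simple reflections
  -- become transpositions and preserve the set of arrows.
  have hco : ∀ (j : b.support) (x : M),
      P.coroot' j x = F x (e j).castSucc - F x (e j).succ := by
    intro j x
    have : P.coroot' j = ((LinearMap.proj (e j).castSucc : (Fin (n + 1) → K) →ₗ[K] K) -
        (LinearMap.proj (e j).succ : (Fin (n + 1) → K) →ₗ[K] K)) ∘ₗ F := by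
      apply b.toWeightBasis.ext
      intro d
      rw [b.toWeightBasis_apply, P.root_coroot'_eq_pairing, LinearMap.comp_apply, hF]
      have h1 := he d j
      have h2 : P.pairing d j = ((b.cartanMatrix d j : ℤ) : K) :=
        (P.algebraMap_pairingIn ℤ d j).symm
      rw [h2, h1]
      simp only [CartanMatrix.A, Matrix.of_apply, LinearMap.sub_apply, LinearMap.proj_apply,
        Pi.sub_apply, Pi.single_apply, Fin.ext_iff, Fin.val_castSucc, Fin.val_succ]
      split_ifs <;> first | omega | norm_num
    rw [this]
    rfl
  have harrow : ∀ i, ∃ p : Fin (n + 1) × Fin (n + 1),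
      F (P.root i) = Pi.single p.1 1 - Pi.single p.2 1 := by
    intro i
    refine b.induction_reflect i (p := fun i => ∃ p : Fin (n + 1) × Fin (n + 1),
      F (P.root i) = Pi.single p.1 1 - Pi.single p.2 1) ?_ ?_ ?_
    · rintro i ⟨⟨s, t⟩, h⟩
      refine ⟨⟨t, s⟩, ?_⟩
      rw [P.root_reflectionPerm, P.reflection_apply_self, map_neg, h, neg_sub]
    · exact fun i hi => ⟨⟨_, _⟩, hF ⟨i, hi⟩⟩
    · rintro i j ⟨⟨s, t⟩, h⟩ hj
      set c := (e ⟨j, hj⟩).castSucc with hc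
      set d := (e ⟨j, hj⟩).succ with hd
      have hcd : c ≠ d := by simp [hc, hd, Fin.ext_iff]
      refine ⟨⟨Equiv.swap c d s, Equiv.swap c d t⟩, ?_⟩
      have h1 := hco ⟨j, hj⟩ (P.root i)
      rw [P.root_reflectionPerm, P.reflection_apply, map_sub, map_smul]
      change _ - P.coroot' j (P.root i) • _ = _
      rw [h1, hF ⟨j, hj⟩, sub_smul_single_eq_comp_swap hcd, h, ← single_comp_swap,
        ← single_comp_swap]
      rfl
  choose p hp using harrow
  -- Minus the partial sums of the values of `l` on the simple roots, so that consecutive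
  -- differences recover `l`.
  let y : ℕ → K := fun k => Nat.rec 0
    (fun k a => a - if h : k < n then l (P.root (e.symm ⟨k, h⟩)) else 0) k
  refine ArrowLabelling.exists_isQuadraticPair ⟨fun i => (p i).2, fun i => (p i).1, F, hp⟩
    (x := fun v => y v) fun i => ?_
  have hl : l = ∑ v : Fin (n + 1), y v • ((LinearMap.proj v : (Fin (n + 1) → K) →ₗ[K] K) ∘ₗ F) := by
    apply b.toWeightBasis.ext
    intro d
    rw [b.toWeightBasis_apply]
    simp only [LinearMap.sum_apply, LinearMap.smul_apply, LinearMap.comp_apply, hF,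
      LinearMap.proj_apply, Pi.sub_apply, Pi.single_apply, smul_eq_mul, mul_sub, mul_ite, mul_one,
      mul_zero, Finset.sum_sub_distrib, Finset.sum_ite_eq', Finset.mem_univ, if_true,
      Fin.val_castSucc, Fin.val_succ]
    simp [y]
  conv_lhs => rw [hl]
  simp [LinearMap.sum_apply, hp, Pi.single_apply, mul_sub, Finset.sum_sub_distrib]

/-- If the roots modulo a subspace form a root system of type `A`, then every functional vanishing
on this subspace belongs to a quadratic pair. -/
theorem exists_isQuadraticPair_of_equiv {Q : Submodule K M} {k : ℕ}
    (e : (M ⧸ Q) ≃ₗ[K] Submodule.span K (arrows K (Fin (k + 1))))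
    (he : (fun v => (e v : Fin (k + 1) → K)) '' {q | q ≠ 0 ∧ ∃ i, q = Q.mkQ (P.root i)} =
      arrows K (Fin (k + 1))) {l : Dual K M} (hl : Q ≤ LinearMap.ker l) :
    ∃ m, IsQuadraticPair P l m 1 := by
  let F : M →ₗ[K] (Fin (k + 1) → K) := (Submodule.subtype _) ∘ₗ e.toLinearMap ∘ₗ Q.mkQ
  have harrow : ∀ i, ∃ p : Fin (k + 1) × Fin (k + 1),
      F (P.root i) = Pi.single p.1 1 - Pi.single p.2 1 := by
    intro i
    by_cases hi : Q.mkQ (P.root i) = 0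
    · exact ⟨⟨0, 0⟩, by simp only [F, LinearMap.comp_apply, hi, map_zero, sub_self]⟩
    · obtain ⟨s, t, -, h⟩ := he.le ⟨_, ⟨hi, i, rfl⟩, rfl⟩
      exact ⟨⟨s, t⟩, h⟩
  choose p hp using harrow
  -- The functional is known only on the span of the arrows; any extension to the coordinate space
  -- yields potentials.
  obtain ⟨g, hg⟩ := LinearMap.exists_extend ((Q.liftQ l hl) ∘ₗ e.symm.toLinearMap)
  refine ArrowLabelling.exists_isQuadraticPair ⟨fun i => (p i).2, fun i => (p i).1, F, hp⟩
    (x := fun v => g (Pi.single v 1)) fun i => ?_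
  simp only
  rw [← map_sub, ← hp]
  have := LinearMap.congr_fun hg (e (Q.mkQ (P.root i)))
  simp only [LinearMap.comp_apply, LinearEquiv.coe_coe, LinearEquiv.symm_apply_apply] at this
  exact this.symm

variable {b : P.Base} {Γ : Finset ι} {l m : Dual K M} {c : K}

/-- The arrows are first drawn between points of `K`; since there are finitely many roots, only
finitely many points are needed. The hypothesis `hΓ` guarantees at least one. -/
theorem IsQuadraticPair.exists_arrowLabelling [DecidableEq K] (h : IsQuadraticPair P l m c)
    (b : P.Base) (hc : c ≠ 0) (hl : ∀ i, l (P.root i) = 0 ↔ P.root i ∈ P.spanRoots Γ)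
    (hΓ : ∃ i, P.root i ∉ P.spanRoots Γ) :
    ∃ (k : ℕ) (A : ArrowLabelling P (Fin (k + 1))),
      (∀ i, P.root i ∈ P.spanRoots Γ ↔ A.tgt i = A.src i) ∧
      P.spanRoots Γ ≤ LinearMap.ker A.toLin ∧ ∀ v, ∃ i, A.deg i v ≠ 0 := by
  obtain ⟨A, hA⟩ := ArrowLabelling.exists_of_sq_eq b l m hc h.1 h.2
  obtain ⟨k, B, hB, hdeg, hker⟩ := A.exists_fin (by
    obtain ⟨i, hi⟩ := hΓ
    exact ⟨i, by rwa [Ne, hA, hl]⟩)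
  refine ⟨k, B, fun i => by rw [hB, hA, hl], ?_, hdeg⟩
  rw [spanRoots, Submodule.span_le]
  rintro _ ⟨i, hi, rfl⟩
  have : B.tgt i = B.src i := by rw [hB, hA, hl]; exact root_mem_spanRoots hi
  simp [B.toLin_root, this]

/-- A functional in a quadratic pair makes the quotient root system one of type `A`. -/
theorem IsQuadraticPair.exists_equiv [P.IsIrreducible] (h : IsQuadraticPair P l m c) (b : P.Base)
    (hc : c ≠ 0) (hl : ∀ i, l (P.root i) = 0 ↔ P.root i ∈ P.spanRoots Γ) :
    ∃ (k : ℕ) (e : (M ⧸ P.spanRoots Γ) ≃ₗ[K] Submodule.span K (arrows K (Fin (k + 1)))),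
      (fun v => (e v : Fin (k + 1) → K)) ''
        {q | q ≠ 0 ∧ ∃ i, q = (P.spanRoots Γ).mkQ (P.root i)} = arrows K (Fin (k + 1)) := by
  classical
  by_cases hΓ : ∃ i, P.root i ∉ P.spanRoots Γ
  · obtain ⟨k, A, hQ, hker, hdeg⟩ := h.exists_arrowLabelling b hc hl hΓ
    obtain ⟨e, he, -⟩ := A.exists_equiv_span_arrows hQ hker hdeg
    exact ⟨k, e, he⟩
  · push Not at hΓ
    have htop : P.spanRoots Γ = ⊤ := by
      rw [eq_top_iff, ← IsRootSystem.span_root_eq_top (P := P), Submodule.span_le]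
      rintro _ ⟨i, rfl⟩
      exact hΓ i
    have h1 : Subsingleton (M ⧸ P.spanRoots Γ) := by
      rw [htop]
      infer_instance
    have h2 : arrows K (Fin (0 + 1)) = ∅ := by
      ext v
      simp only [arrows, Set.mem_ofPred_eq, Set.mem_empty_iff_false, iff_false]
      rintro ⟨i, j, hij, -⟩
      omega
    have h3 : Subsingleton (Submodule.span K (arrows K (Fin (0 + 1)))) := by
      rw [h2, Submodule.span_empty]
      infer_instance
    refine ⟨0, LinearEquiv.ofLinearMap 0 0 (Subsingleton.elim _ _) (Subsingleton.elim _ _), ?_⟩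
    refine Eq.trans (Set.image_eq_empty.2 ?_) h2.symm
    ext q
    simp [Subsingleton.elim q 0]

/-- If the root system is not of type `A`, a functional in a quadratic pair vanishes on all but at
most two simple roots, and these have coefficient one in the maximal root. -/
theorem IsQuadraticPair.ncard_eq_one_or_two [P.IsReduced] [P.IsIrreducible]
    (h : IsQuadraticPair P l m c)
    (hc : c ≠ 0) (hΓ : Γ ⊆ b.support) (hl : ∀ i, l (P.root i) = 0 ↔ P.root i ∈ P.spanRoots Γ)
    (hne : Γ ≠ b.support)
    (hA : ¬ ∃ (n : ℕ) (e : b.support ≃ Fin n), ∀ i j,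
      b.cartanMatrix i j = CartanMatrix.A n (e i) (e j)) :
    (((b.support : Set ι) \ Γ).ncard = 1 ∨ ((b.support : Set ι) \ Γ).ncard = 2) ∧
      ∃ θ, b.IsMaximal θ ∧ ∀ d : b.support, d.1 ∉ Γ → b.toWeightBasis.repr (P.root θ) d = 1 := by
  classical
  obtain ⟨i₀, hi₀, hi₀Γ⟩ : ∃ i ∈ b.support, i ∉ Γ := by
    by_contra! h
    exact hne (hΓ.antisymm h)
  have hi₀' : P.root i₀ ∉ P.spanRoots Γ := by
    intro hmem
    have := b.repr_eq_zero_of_mem_spanRoots hΓ hmem (d := ⟨i₀, hi₀⟩) hi₀Γ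
    rw [b.repr_root ⟨i₀, hi₀⟩, if_pos rfl] at this
    exact one_ne_zero this
  obtain ⟨k, A, hQ, hker, hdeg⟩ := h.exists_arrowLabelling b hc hl ⟨i₀, hi₀'⟩
  obtain ⟨-, -, hφ⟩ := A.exists_equiv_span_arrows hQ hker hdeg
  obtain ⟨w, hw, hw1, hwpos⟩ := A.exists_height b hΓ hQ hdeg hφ
  have hsub : ∀ i j, A.tgt i = A.tgt j → A.src i = A.src j →
      P.root i - P.root j ∈ P.spanRoots Γ := fun i j => A.sub_mem hQ hker
  constructor
  · by_contra! hcard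
    have h0 : ((b.support : Set ι) \ Γ).ncard ≠ 0 := by
      rw [Ne, Set.ncard_eq_zero (Set.toFinite _)]
      exact Set.Nonempty.ne_empty ⟨i₀, hi₀, hi₀Γ⟩
    exact hA (A.exists_equiv_cartanMatrix_A b hΓ hQ hsub hw hw1 hwpos (by omega))
  · obtain ⟨θ, hθ⟩ := b.exists_isMaximal
    have : Nonempty b.support := ⟨⟨i₀, hi₀⟩⟩
    obtain ⟨n, hn, hn0⟩ := hθ.exists_coeff
    refine ⟨θ, hθ, fun d hd => ?_⟩
    rcases A.repr_eq_one_or_eq_zero b hΓ hQ hsub hw hw1 hwpos hθ.isPos d hd with h | h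
    · exact h.1
    · have := h.1
      rw [hn, Nat.cast_eq_zero] at this
      have := hn0 d
      omega

/-- If at most two simple roots lie outside `Γ` and these have coefficient one in the maximal root,
then every functional vanishing on `Γ` belongs to a quadratic pair. -/
theorem Base.exists_isQuadraticPair_of_ncard (b : P.Base) (hl : ∀ i ∈ Γ, l (P.root i) = 0)
    (hcard : ((b.support : Set ι) \ Γ).ncard = 1 ∨ ((b.support : Set ι) \ Γ).ncard = 2)
    {θ : ι} (hθ : b.IsMaximal θ)
    (hone : ∀ d : b.support, d.1 ∉ Γ → b.toWeightBasis.repr (P.root θ) d = 1) :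
    ∃ m, IsQuadraticPair P l m 1 := by
  obtain ⟨d, d', hd, hd', hdd⟩ : ∃ d d', d ∈ (b.support : Set ι) \ Γ ∧
      d' ∈ (b.support : Set ι) \ Γ ∧ ∀ i ∈ (b.support : Set ι) \ Γ, i = d ∨ i = d' := by
    rcases hcard with h | h
    · obtain ⟨d, hd⟩ := Set.ncard_eq_one.1 h
      exact ⟨d, d, by simp [hd], by simp [hd], by simp [hd]⟩
    · obtain ⟨d, d', -, hd⟩ := Set.ncard_eq_two.1 h
      exact ⟨d, d', by simp [hd], by simp [hd], by simp [hd]⟩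
  exact b.exists_isQuadraticPair_of_pair hl hθ ⟨d, hd.1⟩ ⟨d', hd'.1⟩
    (fun i hi => by simpa [Subtype.ext_iff] using hdd i ⟨i.2, hi⟩) (hone _ hd.2) (hone _ hd'.2)

end RootPairing

end

/-! ### Contractions and the evaluation of bivectors and trivectors. -/

section

open Module
open scoped ExteriorAlgebra

namespace ExteriorAlgebra

open CliffordAlgebra (contractLeft contractLeft_ι_mul contractLeft_algebraMap contractLeft_ι)

section

variable {R M N : Type*} [CommRing R] [AddCommGroup M] [Module R M] [AddCommGroup N] [Module R N]

theorem contractLeft_ι_mul' (d : Dual R M) (x : M) (w : ExteriorAlgebra R M) :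
    contractLeft d (ι R x * w) = d x • w - ι R x * contractLeft d w :=
  contractLeft_ι_mul d x w

theorem contractLeft_ι' (d : Dual R M) (x : M) :
    contractLeft d (ι R x) = algebraMap R (ExteriorAlgebra R M) (d x) :=
  contractLeft_ι (Q := (0 : QuadraticForm R M)) d x

theorem contractLeft_map (f : M →ₗ[R] N) (d : Dual R N) (w : ExteriorAlgebra R M) :
    contractLeft d (map f w) = map f (contractLeft (d ∘ₗ f) w) := by
  induction w using CliffordAlgebra.left_induction with
  | algebraMap r =>
    change contractLeft d (map f (algebraMap R (ExteriorAlgebra R M) r)) = _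
    rw [AlgHom.commutes, contractLeft_algebraMap, contractLeft_algebraMap, map_zero]
  | add x y hx hy => simp only [map_add, hx, hy]
  | ι_mul x m hx =>
    change contractLeft d (map f (ι R m * x)) = map f (contractLeft (d ∘ₗ f) (ι R m * x))
    rw [map_mul, map_apply_ι, contractLeft_ι_mul', contractLeft_ι_mul', hx, map_sub, map_smul,
      map_mul, map_apply_ι, LinearMap.comp_apply]

theorem contractLeft_mem {n : ℕ} (d : Dual R M) {w : ExteriorAlgebra R M}
    (hw : w ∈ ⋀[R]^(n + 1) M) : contractLeft d w ∈ ⋀[R]^n M := by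
  induction n generalizing w with
  | zero =>
    rw [zero_add, exteriorPower, pow_one] at hw
    obtain ⟨x, rfl⟩ := hw
    rw [contractLeft_ι', exteriorPower, pow_zero]
    exact Submodule.algebraMap_mem _
  | succ n ih =>
    rw [exteriorPower, pow_succ'] at hw
    induction hw using Submodule.mul_induction_on' with
    | mem_mul_mem x hx y hy =>
      obtain ⟨x, rfl⟩ := hx
      rw [contractLeft_ι_mul']
      refine Submodule.sub_mem _ (Submodule.smul_mem _ _ hy) ?_
      rw [exteriorPower, pow_succ']
      exact Submodule.mul_mem_mul ⟨x, rfl⟩ (ih hy)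
    | add x _ y _ hx hy =>
      rw [map_add]
      exact Submodule.add_mem _ hx hy

/-- The Euler identity for contractions. -/
theorem sum_ι_mul_contractLeft {κ : Type*} [Fintype κ] (e : Basis κ R M) {n : ℕ}
    {w : ExteriorAlgebra R M} (hw : w ∈ ⋀[R]^n M) :
    ∑ i, ι R (e i) * contractLeft (e.coord i) w = n • w := by
  induction n generalizing w with
  | zero =>
    rw [exteriorPower, pow_zero] at hw
    obtain ⟨r, rfl⟩ := Submodule.mem_one.1 hw
    simp [contractLeft_algebraMap]
  | succ n ih =>
    rw [exteriorPower, pow_succ'] at hw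
    induction hw using Submodule.mul_induction_on' with
    | mem_mul_mem x hx y hy =>
      obtain ⟨x, rfl⟩ := hx
      have h1 : ∀ i, ι R (e i) * contractLeft (e.coord i) (ι R x * y) =
          ι R (e.coord i x • e i) * y + ι R x * (ι R (e i) * contractLeft (e.coord i) y) := by
        intro i
        have h2 : ι R (e i) * ι R x = -(ι R x * ι R (e i)) :=
          eq_neg_of_add_eq_zero_left (ι_add_mul_swap _ _)
        rw [contractLeft_ι_mul', mul_sub, ← mul_assoc, h2, map_smul, mul_smul_comm,
          smul_mul_assoc, neg_mul, mul_assoc, sub_neg_eq_add]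
      simp_rw [h1]
      rw [Finset.sum_add_distrib, ← Finset.sum_mul, ← map_sum, ← Finset.mul_sum, ih hy]
      simp only [Basis.coord_apply, e.sum_repr]
      rw [mul_smul_comm, succ_nsmul']
    | add x _ y _ hx hy =>
      simp only [map_add, mul_add, Finset.sum_add_distrib, hx, hy, smul_add]

end

/-- An element of a positive exterior power all of whose contractions vanish is zero. -/
theorem eq_zero_of_contractLeft {K V : Type*} [Field K] [CharZero K] [AddCommGroup V] [Module K V]
    [FiniteDimensional K V] {n : ℕ} {w : ExteriorAlgebra K V} (hw : w ∈ ⋀[K]^(n + 1) V)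
    (h : ∀ d : Dual K V, contractLeft d w = 0) : w = 0 := by
  have h1 := sum_ι_mul_contractLeft (Module.finBasis K V) hw
  simp only [h, mul_zero, Finset.sum_const_zero] at h1
  rw [← Nat.cast_smul_eq_nsmul K] at h1
  exact (smul_eq_zero.1 h1.symm).resolve_left (Nat.cast_ne_zero.2 n.succ_ne_zero)

end ExteriorAlgebra

namespace GoodOrbit

open CliffordAlgebra (contractLeft contractLeft_algebraMap)
open ExteriorAlgebra

section

variable {K V : Type*} [Field K] [AddCommGroup V] [Module K V]

/-- The value of a bivector on two covectors. -/
def evalBivector (d₁ d₂ : Dual K V) : ExteriorAlgebra K V →ₗ[K] K :=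
  algebraMapInv.toLinearMap ∘ₗ contractLeft d₂ ∘ₗ contractLeft d₁

/-- The value of a trivector on three covectors. -/
def evalTrivector (d₁ d₂ d₃ : Dual K V) : ExteriorAlgebra K V →ₗ[K] K :=
  evalBivector d₂ d₃ ∘ₗ contractLeft d₁

theorem evalBivector_ι_mul_ι (d₁ d₂ : Dual K V) (x y : V) :
    evalBivector d₁ d₂ (ι K x * ι K y) = d₁ x * d₂ y - d₁ y * d₂ x := by
  simp only [evalBivector, LinearMap.comp_apply, contractLeft_ι_mul', contractLeft_ι', map_sub,
    map_smul, AlgHom.toLinearMap_apply, ← Algebra.commutes (R := K), ← Algebra.smul_def,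
    algebraMap_leftInverse _ _, smul_eq_mul]

theorem evalTrivector_ι_mul_ι_mul_ι (d₁ d₂ d₃ : Dual K V) (x y z : V) :
    evalTrivector d₁ d₂ d₃ (ι K x * ι K y * ι K z) =
      d₁ x * (d₂ y * d₃ z - d₂ z * d₃ y) - d₁ y * (d₂ x * d₃ z - d₂ z * d₃ x) +
        d₁ z * (d₂ x * d₃ y - d₂ y * d₃ x) := by
  rw [evalTrivector, LinearMap.comp_apply, mul_assoc, contractLeft_ι_mul', contractLeft_ι_mul',
    contractLeft_ι', ← Algebra.commutes, ← Algebra.smul_def, mul_sub, mul_smul_comm, mul_smul_comm]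
  simp only [map_sub, map_smul, evalBivector_ι_mul_ι, smul_eq_mul]
  ring

variable [CharZero K] [FiniteDimensional K V]

theorem eq_zero_of_evalBivector {w : ExteriorAlgebra K V} (hw : w ∈ ⋀[K]^2 V)
    (h : ∀ d₁ d₂, evalBivector d₁ d₂ w = 0) : w = 0 := by
  refine eq_zero_of_contractLeft hw fun d₁ => ?_
  have h1 := contractLeft_mem d₁ hw
  refine eq_zero_of_contractLeft h1 fun d₂ => ?_
  have h2 := contractLeft_mem d₂ h1
  rw [exteriorPower, pow_zero] at h2
  obtain ⟨r, hr⟩ := Submodule.mem_one.1 h2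
  have h3 := h d₁ d₂
  rw [evalBivector, LinearMap.comp_apply, LinearMap.comp_apply, ← hr, AlgHom.toLinearMap_apply,
    algebraMap_leftInverse] at h3
  rw [← hr, h3, map_zero]

theorem eq_zero_of_evalTrivector {w : ExteriorAlgebra K V} (hw : w ∈ ⋀[K]^3 V)
    (h : ∀ d₁ d₂ d₃, evalTrivector d₁ d₂ d₃ w = 0) : w = 0 :=
  eq_zero_of_contractLeft hw fun d₁ =>
    eq_zero_of_evalBivector (contractLeft_mem d₁ hw) fun d₂ d₃ => h d₁ d₂ d₃

end

theorem evalTrivector_map {K V W : Type*} [Field K] [AddCommGroup V] [Module K V] [AddCommGroup W]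
    [Module K W] (f : V →ₗ[K] W) (d₁ d₂ d₃ : Dual K W) (w : ExteriorAlgebra K V) :
    evalTrivector d₁ d₂ d₃ (map f w) = evalTrivector (d₁ ∘ₗ f) (d₂ ∘ₗ f) (d₃ ∘ₗ f) w := by
  simp only [evalTrivector, evalBivector, LinearMap.comp_apply, contractLeft_map,
    AlgHom.toLinearMap_apply]
  exact AlgHom.congr_fun (ExteriorAlgebra.hom_ext (f := algebraMapInv.comp (map f))
    (g := algebraMapInv) (by ext; simp [algebraMapInv])) _

end GoodOrbit

end

/-! ### Bivectors as endomorphisms through the Killing form. -/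

section

open Module LieAlgebra LieAlgebra.IsKilling
open scoped ExteriorAlgebra

namespace GoodOrbit

section

variable {L : Type*} [LieRing L] [LieAlgebra ℂ L]

/-- The endomorphism of `L` corresponding to a bivector by the Killing form. -/
noncomputable def toEndo : ⋀[ℂ]^2 L →ₗ[ℂ] L →ₗ[ℂ] L :=
  altLift (LinearMap.mk₂ ℂ
    (fun x y => (killingForm ℂ L x).smulRight y - (killingForm ℂ L y).smulRight x)
    (by intro x x' y; ext a; simp [add_smul]; abel)
    (by intro c x y; ext a; simp [smul_smul, smul_sub, mul_comm])
    (by intro x y y'; ext a; simp [add_smul]; abel)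
    (by intro c x y; ext a; simp [smul_smul, smul_sub, mul_comm])) (by
    intro x
    simp)

theorem toEndo_wedge (x y a : L) :
    toEndo (wedge x y) a = killingForm ℂ L x a • y - killingForm ℂ L y a • x := by
  simp [toEndo, altLift_wedge]

theorem killingForm_comm (x y : L) : killingForm ℂ L x y = killingForm ℂ L y x :=
  LieModule.traceForm_comm ℂ L L x y

theorem killingForm_lie (x y z : L) : killingForm ℂ L ⁅x, y⁆ z = killingForm ℂ L x ⁅y, z⁆ :=
  LieModule.traceForm_apply_lie_apply ℂ L L x y z

theorem coe_wedge (x y : L) :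
    ((wedge x y : ⋀[ℂ]^2 L) : ExteriorAlgebra ℂ L) =
      ExteriorAlgebra.ι ℂ x * ExteriorAlgebra.ι ℂ y := by
  simp [wedge, ExteriorAlgebra.ιMulti_apply]

theorem toEndo_skew (f : ⋀[ℂ]^2 L) (a b : L) :
    killingForm ℂ L (toEndo f a) b = -killingForm ℂ L a (toEndo f b) := by
  suffices (killingForm ℂ L).flip b ∘ₗ toEndo.flip a =
      -(killingForm ℂ L a ∘ₗ toEndo.flip b) from LinearMap.congr_fun this f
  refine bivector_hom_ext fun x y => ?_
  change killingForm ℂ L (toEndo (wedge x y) a) b = -killingForm ℂ L a (toEndo (wedge x y) b)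
  simp only [toEndo_wedge, map_sub, map_smul, LinearMap.sub_apply, LinearMap.smul_apply,
    smul_eq_mul]
  rw [killingForm_comm a y, killingForm_comm a x]
  ring

/-- For a nondegenerate Killing form this turns invariance of `f` under `x` into commutation of
`toEndo f` with `ad x`. -/
theorem evalBivector_adBivector (x a b : L) (f : ⋀[ℂ]^2 L) :
    evalBivector (killingForm ℂ L a) (killingForm ℂ L b) (adBivector x f) =
      killingForm ℂ L (⁅x, toEndo f a⁆ - toEndo f ⁅x, a⁆) b := by
  let φ : ⋀[ℂ]^2 L →ₗ[ℂ] ℂ :=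
    (evalBivector (killingForm ℂ L a) (killingForm ℂ L b)) ∘ₗ adBivector x
  let ψ : ⋀[ℂ]^2 L →ₗ[ℂ] ℂ := ((killingForm ℂ L).flip b) ∘ₗ
    ((LieAlgebra.ad ℂ L x : L →ₗ[ℂ] L) ∘ₗ toEndo.flip a - toEndo.flip ⁅x, a⁆)
  suffices φ = ψ from LinearMap.congr_fun this f
  refine bivector_hom_ext fun y z => ?_
  have h1 : ∀ u, killingForm ℂ L u ⁅x, a⁆ = - killingForm ℂ L a ⁅x, u⁆ := by
    intro u
    rw [← killingForm_lie, ← lie_skew, map_neg, LinearMap.neg_apply, killingForm_comm]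
  change evalBivector (killingForm ℂ L a) (killingForm ℂ L b) (adBivector x (wedge y z)) =
    killingForm ℂ L (⁅x, toEndo (wedge y z) a⁆ - toEndo (wedge y z) ⁅x, a⁆) b
  simp only [LinearMap.sub_apply, adBivector_wedge, map_add, evalBivector_ι_mul_ι, toEndo_wedge,
    map_sub, map_smul, lie_sub, lie_smul, h1, smul_eq_mul, LinearMap.smul_apply]
  rw [killingForm_comm b, killingForm_comm b, killingForm_comm b, killingForm_comm b,
    killingForm_comm a y, killingForm_comm a z]
  ring

/-- The value of the Schouten bracket in terms of the corresponding endomorphisms. -/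
theorem evalTrivector_schouten (a b c : L) (f g : ⋀[ℂ]^2 L) :
    evalTrivector (killingForm ℂ L a) (killingForm ℂ L b) (killingForm ℂ L c) (schouten f g) =
      killingForm ℂ L (⁅toEndo f a, toEndo g b⁆ + ⁅toEndo g a, toEndo f b⁆) c +
      killingForm ℂ L (⁅toEndo f b, toEndo g c⁆ + ⁅toEndo g b, toEndo f c⁆) a +
      killingForm ℂ L (⁅toEndo f c, toEndo g a⁆ + ⁅toEndo g c, toEndo f a⁆) b := by
  let B (a b c : L) : ⋀[ℂ]^2 L →ₗ[ℂ] ⋀[ℂ]^2 L →ₗ[ℂ] ℂ := LinearMap.mk₂ ℂ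
    (fun f g => killingForm ℂ L (⁅toEndo f a, toEndo g b⁆ + ⁅toEndo g a, toEndo f b⁆) c)
    (by intros; simp; ring) (by intros; simp; ring) (by intros; simp; ring) (by intros; simp; ring)
  suffices schouten.compr₂ (evalTrivector (killingForm ℂ L a) (killingForm ℂ L b)
      (killingForm ℂ L c)) = B a b c + B b c a + B c a b from
    LinearMap.congr_fun (LinearMap.congr_fun this f) g
  refine bivector_hom_ext fun x₁ x₂ => bivector_hom_ext fun y₁ y₂ => ?_
  simp only [LinearMap.compr₂_apply, schouten_wedge, map_add, map_sub, LinearMap.add_apply,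
    evalTrivector_ι_mul_ι_mul_ι, B, LinearMap.mk₂_apply, toEndo_wedge, sub_lie, lie_sub, smul_lie,
    lie_smul, LinearMap.sub_apply, map_smul, LinearMap.smul_apply, smul_eq_mul,
    ← lie_skew y₁ x₁, ← lie_skew y₂ x₁, ← lie_skew y₁ x₂, ← lie_skew y₂ x₂, map_neg,
    LinearMap.neg_apply, killingForm_comm a, killingForm_comm b, killingForm_comm c]
  ring

theorem adBivector_mem (x : L) (f : ⋀[ℂ]^2 L) : adBivector x f ∈ ⋀[ℂ]^2 L := by
  suffices (Submodule.mkQ (⋀[ℂ]^2 L)) ∘ₗ adBivector x = 0 by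
    rw [← Submodule.Quotient.mk_eq_zero]
    exact LinearMap.congr_fun this f
  refine bivector_hom_ext fun y z => ?_
  rw [LinearMap.comp_apply, adBivector_wedge, ← coe_wedge, ← coe_wedge, LinearMap.zero_apply,
    Submodule.mkQ_apply, Submodule.Quotient.mk_eq_zero]
  exact Submodule.add_mem _ (Subtype.mem _) (Subtype.mem _)

theorem schouten_mem (f g : ⋀[ℂ]^2 L) : schouten f g ∈ ⋀[ℂ]^3 L := by
  suffices schouten.compr₂ (Submodule.mkQ (⋀[ℂ]^3 L)) = 0 by
    rw [← Submodule.Quotient.mk_eq_zero]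
    exact LinearMap.congr_fun (LinearMap.congr_fun this f) g
  have h : ∀ x y z : L, ExteriorAlgebra.ι ℂ x * ExteriorAlgebra.ι ℂ y * ExteriorAlgebra.ι ℂ z ∈
      ⋀[ℂ]^3 L := by
    intro x y z
    rw [ExteriorAlgebra.exteriorPower, pow_succ, pow_two]
    exact Submodule.mul_mem_mul (Submodule.mul_mem_mul ⟨x, rfl⟩ ⟨y, rfl⟩) ⟨z, rfl⟩
  refine bivector_hom_ext fun x₁ x₂ => bivector_hom_ext fun y₁ y₂ => ?_
  rw [LinearMap.compr₂_apply, schouten_wedge, LinearMap.zero_apply, LinearMap.zero_apply,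
    Submodule.mkQ_apply, Submodule.Quotient.mk_eq_zero]
  exact Submodule.add_mem _ (Submodule.sub_mem _ (Submodule.sub_mem _ (h _ _ _) (h _ _ _))
    (h _ _ _)) (h _ _ _)

end

end GoodOrbit

end

/-! ### Root vectors and their brackets. -/

section

open Module LieModule LieAlgebra LieAlgebra.IsKilling

namespace GoodOrbit

section

variable {L : Type*} [LieRing L] [LieAlgebra ℂ L] [FiniteDimensional ℂ L] [LieAlgebra.IsKilling ℂ L]
  {H : LieSubalgebra ℂ L} [H.IsCartanSubalgebra]

/-- The negative of a root. -/
noncomputable def negRoot (α : H.root) : H.root := ⟨-α.1, by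
  have := H.isNonZero_coe_root α
  simpa using this⟩

theorem negRoot_negRoot (α : H.root) : negRoot (negRoot α) = α :=
  Subtype.ext (neg_neg α.1)

theorem root_negRoot (α : H.root) :
    (rootSystem H).root (negRoot α) = -(rootSystem H).root α := rfl

theorem reflectionPerm_self_eq_negRoot (α : H.root) :
    (rootSystem H).reflectionPerm α α = negRoot α := by
  apply (rootSystem H).root.injective
  rw [root_negRoot, (rootSystem H).root_reflectionPerm, (rootSystem H).reflection_apply_self]

theorem isPos_negRoot_iff (b : (rootSystem H).Base) (α : H.root) :
    b.IsPos (negRoot α) ↔ ¬ b.IsPos α := by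
  let := (rootSystem H).indexNeg
  have : negRoot α = -α := (reflectionPerm_self_eq_negRoot α).symm
  rw [this, RootPairing.Base.IsPos.neg_iff_not]

theorem coe_eq_add_of_root_eq {α β γ : H.root}
    (h : (rootSystem H).root γ = (rootSystem H).root α + (rootSystem H).root β) :
    (γ.1 : H → ℂ) = α.1 + β.1 := by
  ext x
  exact LinearMap.congr_fun h x

namespace RootVectors

variable (E : RootVectors H)

theorem mem (α : H.root) : E.vec α.1 ∈ rootSpace H α.1 := E.mem_rootSpace α.1 α.2

theorem killing_neg (α : H.root) : killingForm ℂ L (E.vec α.1) (E.vec (-α.1)) = 1 :=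
  E.killing_eq_one α.1 α.2

theorem ne_zero (α : H.root) : E.vec α.1 ≠ 0 := by
  intro h
  have := E.killing_neg α
  simp [h] at this

open Classical in
theorem killing_vec (α β : H.root) :
    killingForm ℂ L (E.vec α.1) (E.vec β.1) = if β = negRoot α then 1 else 0 := by
  split_ifs with h
  · subst h
    exact E.killing_neg α
  · apply killingForm_apply_eq_zero_of_mem_rootSpace_of_add_ne_zero ℂ L H (E.mem α) (E.mem β)
    intro h0
    apply h
    apply Subtype.ext
    apply DFunLike.coe_injective
    rw [eq_neg_of_add_eq_zero_right h0]
    rfl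

theorem killing_cartan (α : H.root) {x : L} (hx : x ∈ H) :
    killingForm ℂ L (E.vec α.1) x = 0 := by
  have hx0 : x ∈ rootSpace H (0 : H → ℂ) := by
    rw [← LieSubmodule.mem_toSubmodule]
    exact LieAlgebra.toLieSubmodule_le_rootSpace_zero ℂ L H hx
  apply killingForm_apply_eq_zero_of_mem_rootSpace_of_add_ne_zero ℂ L H (E.mem α) hx0
  rw [add_zero]
  exact H.isNonZero_coe_root α

theorem lie_cartan (α : H.root) (h : H) : ⁅(h : L), E.vec α.1⁆ = α.1 h • E.vec α.1 :=
  lie_eq_smul_of_mem_rootSpace (E.mem α) h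

theorem exists_eq_smul (α : H.root) {x : L} (hx : x ∈ rootSpace H α.1) :
    ∃ c : ℂ, x = c • E.vec α.1 := by
  have h1 := finrank_rootSpace_eq_one α.1 (H.isNonZero_coe_root α)
  obtain ⟨c, hc⟩ := (finrank_eq_one_iff_of_nonzero' (⟨E.vec α.1, E.mem α⟩ : rootSpace H α.1)
    (fun h => E.ne_zero α (congrArg Subtype.val h))).1 h1 ⟨x, hx⟩
  exact ⟨c, (congrArg Subtype.val hc).symm⟩

theorem lie_vec_neg (α : H.root) :
    ⁅E.vec α.1, E.vec (-α.1)⁆ = ((cartanEquivDual H).symm α.1 : L) := by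
  have h : E.vec (-α.1) ∈ rootSpace H (-α.1 : H → ℂ) := E.mem (negRoot α)
  rw [lie_eq_killingForm_smul_of_mem_rootSpace_of_mem_rootSpace_neg (E.mem α) h,
    E.killing_neg, one_smul]

theorem span_eq_top :
    (H.toSubmodule ⊔ Submodule.span ℂ (Set.range fun α : H.root => E.vec α.1)) = ⊤ := by
  rw [eq_top_iff, ← LieSubmodule.top_toSubmodule (R := ℂ) (L := H),
    ← LieModule.iSup_genWeightSpace_eq_top' ℂ H L, LieSubmodule.iSup_toSubmodule, iSup_le_iff]
  intro χ
  by_cases hχ : χ.IsZero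
  · refine le_trans ?_ le_sup_left
    intro x hx
    rw [LieSubmodule.mem_toSubmodule, hχ.eq] at hx
    have : rootSpace H (0 : H → ℂ) = H.toLieSubmodule := rootSpace_zero_eq ℂ L H
    change x ∈ rootSpace H (0 : H → ℂ) at hx
    rw [this] at hx
    exact hx
  · refine le_trans ?_ le_sup_right
    intro x hx
    obtain ⟨c, rfl⟩ := E.exists_eq_smul ⟨χ, by simpa using hχ⟩ hx
    exact Submodule.smul_mem _ _ (Submodule.subset_span ⟨_, rfl⟩)

/-- In the `sl₂` of the root `-α`, the lowering operator is a multiple of `E_α`. Starting at the top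
of the `-α`-chain, `k` steps reach the root space of `β`. As `α + β` is a weight, the chain goes on,
so the next step is nonzero; but it is a multiple of the bracket of `E_α` and `E_β`. -/
theorem lie_vec_ne_zero {α β γ : H.root}
    (h : (rootSystem H).root γ = (rootSystem H).root α + (rootSystem H).root β) :
    ⁅E.vec α.1, E.vec β.1⁆ ≠ 0 := by
  intro h0
  have hα := (H.isNonZero_coe_root α).neg
  obtain ⟨x, hx, x_ne0⟩ := (chainTop (-α.1) β.1).exists_ne_zero
  obtain ⟨h', e, f, isSl2, he, hf⟩ := exists_isSl2Triple_of_weight_isNonZero hα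
  obtain rfl := isSl2.h_eq_coroot hα he hf
  have prim : isSl2.HasPrimitiveVectorWith x (chainLength (-α.1) β.1 : ℂ) :=
    have := lie_mem_genWeightSpace_of_mem_genWeightSpace he hx
    ⟨x_ne0, (chainLength_smul _ _ hx).symm, by rwa [genWeightSpace_add_chainTop _ _ hα] at this⟩
  set k := chainTopCoeff (-α.1) β.1 with hk
  have hneg : -((-α.1 : Weight ℂ H L) : H → ℂ) = α.1 := by
    rw [Weight.coe_neg, neg_neg]
  have hle : k + 1 ≤ chainLength (-α.1) β.1 := by
    by_contra hlt
    have h1 := rootSpace_neg_nsmul_add_chainTop_of_lt (-α.1) β.1 hα (not_le.1 hlt)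
    apply γ.1.genWeightSpace_ne_bot
    rw [← h1, coe_eq_add_of_root_eq h]
    congr 1
    rw [coe_chainTop', ← hk, Weight.coe_neg]
    ext y
    simp
    ring
  apply prim.pow_toEnd_f_ne_zero_of_eq_nat rfl hle
  have h2 := toEnd_pow_apply_mem hf hx k
  have h3 : (k • -((-α.1 : Weight ℂ H L) : H → ℂ) + chainTop (-α.1) β.1 : H → ℂ) = β.1 := by
    rw [coe_chainTop', ← hk, Weight.coe_neg]
    ext y
    simp
  rw [h3] at h2
  rw [hneg] at hf
  obtain ⟨c, hc⟩ := E.exists_eq_smul β h2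
  obtain ⟨d, rfl⟩ := E.exists_eq_smul α hf
  rw [pow_succ', Module.End.mul_apply, hc, toEnd_apply_apply, lie_smul, smul_lie, h0, smul_zero,
    smul_zero]

theorem exists_lie_vec_eq_smul {α β γ : H.root}
    (h : (rootSystem H).root γ = (rootSystem H).root α + (rootSystem H).root β) :
    ∃ c : ℂ, c ≠ 0 ∧ ⁅E.vec α.1, E.vec β.1⁆ = c • E.vec γ.1 := by
  have h1 := lie_mem_genWeightSpace_of_mem_genWeightSpace (E.mem α) (E.mem β)
  rw [← coe_eq_add_of_root_eq h] at h1
  obtain ⟨c, hc⟩ := E.exists_eq_smul γ h1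
  refine ⟨c, ?_, hc⟩
  rintro rfl
  exact E.lie_vec_ne_zero h (by rw [hc, zero_smul])

/-- The bracket of root vectors has no component in a root space unless the weights add up. -/
theorem killing_lie_ne_zero_iff {α β γ : H.root} :
    killingForm ℂ L ⁅E.vec α.1, E.vec β.1⁆ (E.vec γ.1) ≠ 0 ↔
      (rootSystem H).root α + (rootSystem H).root β + (rootSystem H).root γ = 0 := by
  constructor
  · intro h
    by_contra h0
    apply h
    have h1 := lie_mem_genWeightSpace_of_mem_genWeightSpace (E.mem α) (E.mem β)
    apply killingForm_apply_eq_zero_of_mem_rootSpace_of_add_ne_zero ℂ L H h1 (E.mem γ)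
    intro h2
    apply h0
    ext x
    exact congrFun h2 x
  · intro h
    have h1 : (rootSystem H).root (negRoot γ) =
        (rootSystem H).root α + (rootSystem H).root β := by
      rw [root_negRoot, eq_neg_of_add_eq_zero_left h]
    obtain ⟨c, hc, hcc⟩ := E.exists_lie_vec_eq_smul h1
    rw [hcc, map_smul, LinearMap.smul_apply, E.killing_vec, if_pos (negRoot_negRoot γ).symm]
    simpa using hc

end RootVectors

end

end GoodOrbit

end

/-! ### The Levi subalgebra as a stabilizer, and trivectors on the tangent space. -/

section

open Module LieModule LieAlgebra LieAlgebra.IsKilling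
open scoped ExteriorAlgebra

namespace GoodOrbit

section

theorem map_mem_exteriorPower {K V W : Type*} [Field K] [AddCommGroup V] [Module K V]
    [AddCommGroup W] [Module K W] (f : V →ₗ[K] W) {n : ℕ} {w : ExteriorAlgebra K V}
    (hw : w ∈ ⋀[K]^n V) : ExteriorAlgebra.map f w ∈ ⋀[K]^n W := by
  have h : (⋀[K]^n V).map (ExteriorAlgebra.map f).toLinearMap ≤ ⋀[K]^n W := by
    rw [ExteriorAlgebra.exteriorPower, ExteriorAlgebra.exteriorPower, Submodule.map_pow]
    gcongr
    rintro _ ⟨_, ⟨x, rfl⟩, rfl⟩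
    exact ⟨f x, (ExteriorAlgebra.map_apply_ι f x).symm⟩
  exact h ⟨w, hw, rfl⟩

variable {L : Type*} [LieRing L] [LieAlgebra ℂ L] [FiniteDimensional ℂ L] [LieAlgebra.IsKilling ℂ L]
  {H : LieSubalgebra ℂ L} [H.IsCartanSubalgebra] {E : RootVectors H} {Γ : Finset H.root}

omit [FiniteDimensional ℂ L] in
theorem eq_zero_of_killingForm {x : L} (h : ∀ y, killingForm ℂ L x y = 0) : x = 0 :=
  (killingForm_nondegenerate ℂ L).1 x h

/-- The functional on `h*` induced by a functional on `L`, by the Killing form. -/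
noncomputable def dualFunctional (H : LieSubalgebra ℂ L) [H.IsCartanSubalgebra] (lam : Dual ℂ L) :
    Dual ℂ (Dual ℂ H) :=
  lam ∘ₗ H.toSubmodule.subtype ∘ₗ (cartanEquivDual H).symm.toLinearMap

theorem dualFunctional_root (E : RootVectors H) (lam : Dual ℂ L) (α : H.root) :
    dualFunctional H lam ((rootSystem H).root α) = lam ⁅E.vec α.1, E.vec (-α.1)⁆ := by
  rw [E.lie_vec_neg]
  rfl

theorem mem_levi_of_mem_cartan {x : L} (hx : x ∈ H) : x ∈ levi E Γ :=
  LieSubalgebra.subset_lieSpan (Or.inl hx)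

theorem negRoot_mem_leviRoots_iff {α : H.root} : negRoot α ∈ leviRoots Γ ↔ α ∈ leviRoots Γ :=
  (rootSpan Γ).neg_mem_iff (x := (rootSystem H).root α)

theorem exists_cartan_separating {γ : H.root} (hγ : γ ∉ leviRoots Γ) :
    ∃ h : H, (∀ α ∈ Γ, α.1 h = 0) ∧ γ.1 h ≠ 0 := by
  obtain ⟨φ, hφ, hker⟩ := Submodule.exists_le_ker_of_notMem
    (show (rootSystem H).root γ ∉ rootSpan Γ from hγ)
  have key : ∀ α : H.root, α.1 ((evalEquiv ℂ H).symm φ) = φ ((rootSystem H).root α) := fun α =>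
    apply_evalEquiv_symm_apply ℂ H ((rootSystem H).root α) φ
  refine ⟨(evalEquiv ℂ H).symm φ, fun α hα => ?_, ?_⟩
  · rw [key]
    exact hker (Submodule.subset_span ⟨α, hα, rfl⟩)
  · rwa [key]

/-- Some `h` in the Cartan subalgebra is killed by `Γ` but not by `γ`. The generators of `levi E Γ`
commute with `h`, so the whole subalgebra stabilizes the functional `killingForm ℂ L h`, and `γ h`
times the pairing of `x` with `E_γ` is zero. -/
theorem killing_levi_vec {x : L} (hx : x ∈ levi E Γ) {γ : H.root} (hγ : γ ∉ leviRoots Γ) :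
    killingForm ℂ L x (E.vec γ.1) = 0 := by
  obtain ⟨h, h0, hne⟩ := exists_cartan_separating hγ
  have hle : levi E Γ ≤ coadjointStabilizer (killingForm ℂ L h) := by
    refine LieSubalgebra.lieSpan_le.2 ?_
    have hvec : ∀ α : H.root, α.1 h = 0 → E.vec α.1 ∈ coadjointStabilizer (killingForm ℂ L h) := by
      intro α hα y
      rw [← killingForm_lie, E.lie_cartan, hα, zero_smul, map_zero, LinearMap.zero_apply]
    rintro x (hx | ⟨α, hα, rfl | rfl⟩)
    · intro y
      have h1 : ⁅(h : L), x⁆ = 0 := congrArg Subtype.val (trivial_lie_zero H H h ⟨x, hx⟩)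
      rw [← killingForm_lie, h1, map_zero, LinearMap.zero_apply]
    · exact hvec α (h0 α hα)
    · refine hvec (negRoot α) ?_
      change -(α.1 h) = 0
      rw [h0 α hα, neg_zero]
  have h1 : killingForm ℂ L (h : L) ⁅x, E.vec γ.1⁆ = 0 := hle hx _
  rw [← killingForm_lie, ← lie_skew, map_neg, LinearMap.neg_apply, killingForm_lie, E.lie_cartan,
    map_smul, smul_eq_mul, neg_eq_zero, mul_eq_zero] at h1
  exact h1.resolve_left hne

section

variable {lam : Dual ℂ L} (hlam : coadjointStabilizer lam = levi E Γ)
include hlam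

theorem apply_eq_zero_of_mem_rootSpace {δ : H → ℂ} (hδ : δ ≠ 0) {x : L} (hx : x ∈ rootSpace H δ) :
    lam x = 0 := by
  obtain ⟨h, hh⟩ := Function.ne_iff.1 hδ
  have h1 : (h : L) ∈ coadjointStabilizer lam := hlam ▸ mem_levi_of_mem_cartan h.2
  have h2 : lam ⁅(h : L), x⁆ = 0 := h1 x
  have h3 : ⁅(h : L), x⁆ = δ h • x := lie_eq_smul_of_mem_rootSpace hx h
  rw [h3, map_smul, smul_eq_mul, mul_eq_zero] at h2
  exact h2.resolve_left hh

theorem vec_mem_levi_of_dualFunctional_eq_zero {α : H.root}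
    (hα : dualFunctional H lam ((rootSystem H).root α) = 0) : E.vec α.1 ∈ levi E Γ := by
  rw [← hlam]
  suffices lam ∘ₗ (LieAlgebra.ad ℂ L (E.vec α.1) : L →ₗ[ℂ] L) = 0 from
    fun y => LinearMap.congr_fun this y
  rw [← LinearMap.ker_eq_top, eq_top_iff, ← E.span_eq_top, sup_le_iff, Submodule.span_le]
  constructor
  · intro h hh
    have h1 : ⁅h, E.vec α.1⁆ = α.1 ⟨h, hh⟩ • E.vec α.1 := E.lie_cartan α ⟨h, hh⟩
    have h2 : lam (E.vec α.1) = 0 :=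
      apply_eq_zero_of_mem_rootSpace hlam (H.isNonZero_coe_root α) (E.mem α)
    rw [LinearMap.mem_ker, LinearMap.comp_apply, LieAlgebra.ad_apply, ← lie_skew, h1, map_neg,
      map_smul, h2, smul_zero, neg_zero]
  · rintro _ ⟨β, rfl⟩
    change lam ⁅E.vec α.1, E.vec β.1⁆ = 0
    by_cases hβ : β = negRoot α
    · rw [hβ, ← hα, dualFunctional_root E]
      rfl
    · refine apply_eq_zero_of_mem_rootSpace hlam (δ := α.1 + β.1) (fun h => hβ ?_)
        (lie_mem_genWeightSpace_of_mem_genWeightSpace (E.mem α) (E.mem β))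
      apply Subtype.ext
      apply DFunLike.coe_injective
      rw [eq_neg_of_add_eq_zero_right h]
      rfl

/-- If the functional vanishes at `α`, then `E_α` stabilizes `lam` and so lies in `levi E Γ`. As
`E_α` pairs to `1` with `E_{-α}`, the orthogonality in `killing_levi_vec` excludes roots outside
`Ω_Γ`. -/
theorem dualFunctional_root_eq_zero_iff (α : H.root) :
    dualFunctional H lam ((rootSystem H).root α) = 0 ↔
      (rootSystem H).root α ∈ rootSpan Γ := by
  constructor
  · intro h
    by_contra hα
    have h1 := killing_levi_vec (vec_mem_levi_of_dualFunctional_eq_zero hlam h)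
      (γ := negRoot α) (fun h => hα (negRoot_mem_leviRoots_iff.1 h))
    have h2 : killingForm ℂ L (E.vec α.1) (E.vec (negRoot α).1) = 1 := E.killing_neg α
    exact one_ne_zero (h2.symm.trans h1)
  · intro h
    have : rootSpan Γ ≤ LinearMap.ker (dualFunctional H lam) := by
      refine Submodule.span_le.2 ?_
      rintro _ ⟨β, hβ, rfl⟩
      change dualFunctional H lam ((rootSystem H).root β) = 0
      rw [dualFunctional_root E]
      have h1 : E.vec β.1 ∈ coadjointStabilizer lam :=
        hlam ▸ LieSubalgebra.subset_lieSpan (Or.inr ⟨β, hβ, Or.inl rfl⟩)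
      exact h1 _
    exact this h

theorem vec_mem_levi {α : H.root} (hα : α ∈ leviRoots Γ) : E.vec α.1 ∈ levi E Γ :=
  vec_mem_levi_of_dualFunctional_eq_zero hlam ((dualFunctional_root_eq_zero_iff hlam α).2 hα)

theorem mem_tangent_of_killing_levi {a : L} (ha : ∀ x ∈ levi E Γ, killingForm ℂ L a x = 0) :
    a ∈ tangent E Γ := by
  classical
  obtain ⟨h, hh, y, hy, rfl⟩ := Submodule.mem_sup.1 (E.span_eq_top.symm ▸ Submodule.mem_top (x := a))
  obtain ⟨c, rfl⟩ := (Submodule.mem_span_range_iff_exists_fun ℂ).1 hy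
  have hh0 : h = 0 := by
    have h1 : ∀ x : H, LieModule.traceForm ℂ H L ⟨h, hh⟩ x = 0 := by
      intro x
      have h2 := ha x (mem_levi_of_mem_cartan x.2)
      rw [map_add, LinearMap.add_apply, map_sum, LinearMap.sum_apply, Finset.sum_eq_zero,
        add_zero] at h2
      · exact h2
      · intro α _
        rw [map_smul, LinearMap.smul_apply, E.killing_cartan α x.2, smul_zero]
    exact congrArg Subtype.val ((traceForm_cartan_nondegenerate ℂ L H).1 ⟨h, hh⟩ h1)
  rw [hh0, zero_add]
  refine Submodule.sum_mem _ fun α _ => ?_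
  by_cases hα : α ∈ leviRoots Γ
  · have h1 := ha _ (vec_mem_levi hlam (negRoot_mem_leviRoots_iff.2 hα))
    rw [hh0, zero_add, map_sum, LinearMap.sum_apply, Finset.sum_eq_single α] at h1
    · rw [map_smul, LinearMap.smul_apply, E.killing_vec, if_pos rfl, smul_eq_mul, mul_one] at h1
      rw [h1, zero_smul]
      exact Submodule.zero_mem _
    · intro β _ hβ
      rw [map_smul, LinearMap.smul_apply, E.killing_vec, if_neg, smul_zero]
      intro e
      apply hβ
      rw [← negRoot_negRoot β, ← e, negRoot_negRoot]
    · intro h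
      exact absurd (Finset.mem_univ α) h
  · exact Submodule.smul_mem _ _ (Submodule.subset_span ⟨α, hα, rfl⟩)

/-- Covectors on `L / g_Γ` are the functionals killing `g_Γ`, hence Killing duals of elements of
`m`. By multilinearity it suffices to test on the root vectors spanning `m`. -/
theorem toM_eq_zero_iff {w : ExteriorAlgebra ℂ L} (hw : w ∈ ⋀[ℂ]^3 L) :
    toM E Γ w = 0 ↔ ∀ α β γ : H.root, α ∉ leviRoots Γ → β ∉ leviRoots Γ → γ ∉ leviRoots Γ →
      evalTrivector (killingForm ℂ L (E.vec α.1)) (killingForm ℂ L (E.vec β.1))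
        (killingForm ℂ L (E.vec γ.1)) w = 0 := by
  constructor
  · intro h α β γ hα hβ hγ
    have key : ∀ δ : H.root, δ ∉ leviRoots Γ → ∃ d : Dual ℂ (L ⧸ (levi E Γ).toSubmodule),
        d ∘ₗ (levi E Γ).toSubmodule.mkQ = killingForm ℂ L (E.vec δ.1) := by
      intro δ hδ
      refine ⟨(levi E Γ).toSubmodule.liftQ (killingForm ℂ L (E.vec δ.1)) ?_, ?_⟩
      · intro x hx
        rw [LinearMap.mem_ker, killingForm_comm]
        exact killing_levi_vec hx hδ
      · exact Submodule.liftQ_mkQ _ _ _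
    obtain ⟨d₁, h₁⟩ := key α hα
    obtain ⟨d₂, h₂⟩ := key β hβ
    obtain ⟨d₃, h₃⟩ := key γ hγ
    rw [← h₁, ← h₂, ← h₃, ← evalTrivector_map]
    exact (congrArg _ h).trans (map_zero _)
  · intro h
    refine eq_zero_of_evalTrivector (map_mem_exteriorPower _ hw) fun d₁ d₂ d₃ => ?_
    rw [toM, evalTrivector_map]
    have key : ∀ d : Dual ℂ (L ⧸ (levi E Γ).toSubmodule), ∃ a ∈ tangent E Γ,
        d ∘ₗ (levi E Γ).toSubmodule.mkQ = killingForm ℂ L a := by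
      intro d
      obtain ⟨a, ha⟩ := ((killingForm ℂ L).toDual (killingForm_nondegenerate ℂ L)).surjective
        (d ∘ₗ (levi E Γ).toSubmodule.mkQ)
      refine ⟨a, mem_tangent_of_killing_levi hlam fun x hx => ?_, ha.symm⟩
      have h1 := LinearMap.congr_fun ha x
      rw [LinearMap.comp_apply, (Submodule.mkQ_apply _ x), (Submodule.Quotient.mk_eq_zero _).2 hx,
        map_zero] at h1
      exact h1
    obtain ⟨a, ha, h₁⟩ := key d₁
    obtain ⟨b, hb, h₂⟩ := key d₂
    obtain ⟨c, hc, h₃⟩ := key d₃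
    rw [h₁, h₂, h₃]
    clear h₁ h₂ h₃ key
    induction ha using Submodule.span_induction with
    | zero => simp [evalTrivector, evalBivector]
    | add x y _ _ hx hy =>
      simp only [evalTrivector, evalBivector, LinearMap.comp_apply, map_add,
        LinearMap.add_apply] at hx hy ⊢
      rw [hx, hy, add_zero]
    | smul r x _ hx =>
      simp only [evalTrivector, evalBivector, LinearMap.comp_apply, map_smul,
        LinearMap.smul_apply] at hx ⊢
      rw [hx, smul_zero]
    | mem a ha =>
    obtain ⟨α, hα, rfl⟩ := ha
    induction hb using Submodule.span_induction with
    | zero => simp [evalTrivector, evalBivector]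
    | add x y _ _ hx hy =>
      simp only [evalTrivector, evalBivector, LinearMap.comp_apply, map_add,
        LinearMap.add_apply] at hx hy ⊢
      rw [hx, hy, add_zero]
    | smul r x _ hx =>
      simp only [evalTrivector, evalBivector, LinearMap.comp_apply, map_smul,
        LinearMap.smul_apply] at hx ⊢
      rw [hx, smul_zero]
    | mem b hb =>
    obtain ⟨β, hβ, rfl⟩ := hb
    induction hc using Submodule.span_induction with
    | zero => simp [evalTrivector, evalBivector]
    | add x y _ _ hx hy =>
      simp only [evalTrivector, evalBivector, LinearMap.comp_apply, map_add,
        LinearMap.add_apply] at hx hy ⊢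
      rw [hx, hy, add_zero]
    | smul r x _ hx =>
      simp only [evalTrivector, evalBivector, LinearMap.comp_apply, map_smul,
        LinearMap.smul_apply] at hx ⊢
      rw [hx, smul_zero]
    | mem c hc =>
    obtain ⟨γ, hγ, rfl⟩ := hc
    exact h α β γ hα hβ hγ

end

end

end GoodOrbit

end

/-! ### Schouten brackets of bivectors that act diagonally on the root vectors. -/

section

open Module LieModule LieAlgebra LieAlgebra.IsKilling
open scoped ExteriorAlgebra

namespace GoodOrbit

section

variable {L : Type*} [LieRing L] [LieAlgebra ℂ L] [FiniteDimensional ℂ L] [LieAlgebra.IsKilling ℂ L]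
  {H : LieSubalgebra ℂ L} [H.IsCartanSubalgebra] {E : RootVectors H} {Γ : Finset H.root}

theorem RootVectors.hom_ext (E : RootVectors H) {N : Type*} [AddCommGroup N] [Module ℂ N]
    {φ ψ : L →ₗ[ℂ] N} (h₁ : ∀ h ∈ H, φ h = ψ h) (h₂ : ∀ α : H.root, φ (E.vec α.1) = ψ (E.vec α.1)) :
    φ = ψ := by
  rw [← LinearMap.eqLocus_eq_top, eq_top_iff, ← E.span_eq_top, sup_le_iff, Submodule.span_le]
  refine ⟨h₁, ?_⟩
  rintro _ ⟨α, rfl⟩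
  exact h₂ α

theorem evalTrivector_schouten_vec {f g : ⋀[ℂ]^2 L} {s t : H.root → ℂ}
    (hf : ∀ α : H.root, toEndo f (E.vec α.1) = s α • E.vec α.1)
    (hg : ∀ α : H.root, toEndo g (E.vec α.1) = t α • E.vec α.1) (α β γ : H.root) :
    evalTrivector (killingForm ℂ L (E.vec α.1)) (killingForm ℂ L (E.vec β.1))
      (killingForm ℂ L (E.vec γ.1)) (schouten f g) =
      (s α * t β + t α * s β + s β * t γ + t β * s γ + s γ * t α + t γ * s α) *
        killingForm ℂ L ⁅E.vec α.1, E.vec β.1⁆ (E.vec γ.1) := by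
  have h1 : killingForm ℂ L ⁅E.vec β.1, E.vec γ.1⁆ (E.vec α.1) =
      killingForm ℂ L ⁅E.vec α.1, E.vec β.1⁆ (E.vec γ.1) := by
    rw [killingForm_lie, killingForm_comm, killingForm_comm ⁅_, _⁆, ← killingForm_lie,
      killingForm_comm, ← killingForm_lie, killingForm_comm]
  have h2 : killingForm ℂ L ⁅E.vec γ.1, E.vec α.1⁆ (E.vec β.1) =
      killingForm ℂ L ⁅E.vec α.1, E.vec β.1⁆ (E.vec γ.1) := by
    rw [killingForm_lie, killingForm_comm]
  rw [evalTrivector_schouten]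
  simp only [hf, hg, smul_lie, lie_smul, map_add, map_smul, LinearMap.add_apply,
    LinearMap.smul_apply, smul_eq_mul, h1, h2]
  ring

open Classical in
/-- The bivector `∑ g α • E_α ∧ E_{-α}`, summed over the positive roots. -/
noncomputable def rootBivector (b : (rootSystem H).Base) (E : RootVectors H) (g : H.root → ℂ) :
    ⋀[ℂ]^2 L :=
  ∑ α : H.root with b.IsPos α, g α • wedge (E.vec α.1) (E.vec (-α.1))

variable (b : (rootSystem H).Base)

theorem toEndo_rootBivector_cartan (g : H.root → ℂ) {h : L} (hh : h ∈ H) :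
    toEndo (rootBivector b E g) h = 0 := by
  classical
  rw [rootBivector, map_sum, LinearMap.sum_apply]
  refine Finset.sum_eq_zero fun α _ => ?_
  have h1 : killingForm ℂ L (E.vec (-α.1)) h = 0 := E.killing_cartan (negRoot α) hh
  rw [map_smul, LinearMap.smul_apply, toEndo_wedge, E.killing_cartan α hh, h1, zero_smul, zero_smul,
    sub_zero, smul_zero]

/-- Oddness of `g` lets one formula cover negative roots too, although the sum runs over positive
ones. The minus sign comes from the sign convention of `toEndo`. -/
theorem toEndo_rootBivector_vec {g : H.root → ℂ} (hg : ∀ α, g (negRoot α) = -g α) (β : H.root) :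
    toEndo (rootBivector b E g) (E.vec β.1) = -g β • E.vec β.1 := by
  classical
  have h1 : ∀ α : H.root, killingForm ℂ L (E.vec (-α.1)) (E.vec β.1) = if α = β then 1 else 0 := by
    intro α
    have h2 := E.killing_vec (negRoot α) β
    rw [negRoot_negRoot] at h2
    simp only [eq_comm (a := α)]
    exact h2
  rw [rootBivector, map_sum, LinearMap.sum_apply]
  simp only [map_smul, LinearMap.smul_apply, toEndo_wedge, h1, E.killing_vec]
  by_cases hβ : b.IsPos β
  · rw [Finset.sum_eq_single β]
    · have : β ≠ negRoot β := by
        intro e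
        have h2 := isPos_negRoot_iff b β
        rw [← e] at h2
        exact (h2.1 hβ) hβ
      simp [this]
    · intro α hα hαβ
      have : β ≠ negRoot α := by
        rintro rfl
        rw [isPos_negRoot_iff] at hβ
        exact hβ (Finset.mem_filter.1 hα).2
      simp [this, hαβ]
    · intro h
      simp [hβ] at h
  · rw [Finset.sum_eq_single (negRoot β)]
    · have h2 : negRoot β ≠ β := by
        intro e
        have h2 := isPos_negRoot_iff b β
        rw [e] at h2
        exact hβ (h2.2 hβ)
      rw [negRoot_negRoot, if_pos rfl, if_neg h2, hg, one_smul, zero_smul, sub_zero]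
      have h3 : E.vec (-(negRoot β).1) = E.vec β.1 := congrArg _ (neg_neg β.1)
      rw [h3]
    · intro α hα hαβ
      have h2 : β ≠ negRoot α := by
        rintro rfl
        exact hαβ (negRoot_negRoot α).symm
      have h3 : α ≠ β := by
        rintro rfl
        exact hβ (Finset.mem_filter.1 hα).2
      simp [h2, h3]
    · intro h
      simp [isPos_negRoot_iff, hβ] at h

open Classical in
theorem rMatrix_eq (E : RootVectors H) :
    rMatrix b E = rootBivector b E fun α => if b.IsPos α then 1 else -1 := by
  refine Finset.sum_congr rfl fun α hα => ?_
  beta_reduce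
  rw [if_pos (Finset.mem_filter.1 hα).2, one_smul]

/-- On `Ω_Γ` the functional vanishes and the inverse of zero is zero, so the sum may run over all
positive roots. -/
theorem kks_eq {lam : Dual ℂ L} (hlam : coadjointStabilizer lam = levi E Γ) :
    kks b E Γ lam =
      rootBivector b E fun α => (dualFunctional H lam ((rootSystem H).root α))⁻¹ := by
  classical
  rw [kks, rootBivector, ← Finset.filter_filter, Finset.sum_filter]
  refine Finset.sum_congr rfl fun α _ => ?_
  by_cases h : α ∈ leviRoots Γ
  · rw [if_neg (not_not.2 h), (dualFunctional_root_eq_zero_iff hlam α).2 h, inv_zero, zero_smul]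
  · rw [if_pos h, dualFunctional_root E]

/-- Three roots with sum zero do not all have the same sign, so among the products of pairs one is
`1` and two are `-1`. -/
theorem mul_sign_sum {α β γ : H.root} (h : (rootSystem H).root α + (rootSystem H).root β +
    (rootSystem H).root γ = 0) {ε : H.root → ℂ} (h₁ : ∀ α, b.IsPos α → ε α = -1)
    (h₂ : ∀ α, ¬ b.IsPos α → ε α = 1) : ε α * ε β + ε β * ε γ + ε γ * ε α = -1 := by
  have key : ∀ α β γ : H.root, (rootSystem H).root α + (rootSystem H).root β +
      (rootSystem H).root γ = 0 → b.IsPos α → b.IsPos β → ¬ b.IsPos γ := by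
    intro α β γ h hα hβ
    rw [← isPos_negRoot_iff]
    exact hα.add hβ (by rw [root_negRoot, eq_neg_of_add_eq_zero_left h])
  have h3 := key α β γ h
  have h4 := key (negRoot α) (negRoot β) (negRoot γ) (by
    simp only [root_negRoot, ← neg_add, h, neg_zero])
  simp only [isPos_negRoot_iff] at h4
  have hv : ∀ δ, b.IsPos δ ∧ ε δ = -1 ∨ ¬ b.IsPos δ ∧ ε δ = 1 := fun δ =>
    (em (b.IsPos δ)).imp (fun h => ⟨h, h₁ δ h⟩) fun h => ⟨h, h₂ δ h⟩
  rcases hv α with ⟨p₁, e₁⟩ | ⟨p₁, e₁⟩ <;> rcases hv β with ⟨p₂, e₂⟩ | ⟨p₂, e₂⟩ <;>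
    rcases hv γ with ⟨p₃, e₃⟩ | ⟨p₃, e₃⟩ <;>
    first
    | exact absurd p₃ (h3 p₁ p₂)
    | exact absurd p₃ (h4 p₁ p₂)
    | (rw [e₁, e₂, e₃]; norm_num)

section

variable {lam : Dual ℂ L} (hlam : coadjointStabilizer lam = levi E Γ)
include hlam

/-- On three root vectors both sides are multiples of one structure constant, nonzero exactly when
the roots sum to zero. The sign function of `r` contributes the `-1` of `mul_sign_sum`. -/
theorem toM_schouten_self_iff {f : ⋀[ℂ]^2 L} {s : H.root → ℂ}
    (hf : ∀ α : H.root, toEndo f (E.vec α.1) = s α • E.vec α.1) (c : ℂ) :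
    toM E Γ (schouten f f) = c ^ 2 • toM E Γ (phi b E) ↔
      ∀ α β γ : H.root, α ∉ leviRoots Γ → β ∉ leviRoots Γ → γ ∉ leviRoots Γ →
        (rootSystem H).root α + (rootSystem H).root β + (rootSystem H).root γ = 0 →
          s α * s β + s β * s γ + s γ * s α = -c ^ 2 := by
  classical
  have hmem : schouten f f - c ^ 2 • phi b E ∈ ⋀[ℂ]^3 L :=
    Submodule.sub_mem _ (schouten_mem _ _) (Submodule.smul_mem _ _ (schouten_mem _ _))
  rw [← sub_eq_zero, ← map_smul, ← map_sub, toM_eq_zero_iff hlam hmem]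
  have hr := toEndo_rootBivector_vec (E := E) b
    (g := fun α => if b.IsPos α then 1 else -1) (by
      intro α
      simp only [isPos_negRoot_iff]
      by_cases h : b.IsPos α <;> simp [h])
  refine forall₃_congr fun α β γ => forall₃_congr fun hα hβ hγ => ?_
  rw [phi, rMatrix_eq, map_sub, map_smul, evalTrivector_schouten_vec hf hf,
    evalTrivector_schouten_vec hr hr, smul_eq_mul]
  by_cases h : (rootSystem H).root α + (rootSystem H).root β + (rootSystem H).root γ = 0
  · have hN := E.killing_lie_ne_zero_iff.2 h
    have hs := mul_sign_sum b h (ε := fun α => -(if b.IsPos α then 1 else -1))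
      (fun α hα => by simp [hα]) (fun α hα => by simp [hα])
    constructor
    · intro h1 _
      apply mul_right_cancel₀ hN
      linear_combination (1 / 2) * h1 + c ^ 2 *
        killingForm ℂ L ⁅E.vec α.1, E.vec β.1⁆ (E.vec γ.1) * hs
    · intro h1
      linear_combination (2 * killingForm ℂ L ⁅E.vec α.1, E.vec β.1⁆ (E.vec γ.1)) * h1 h -
        2 * c ^ 2 * killingForm ℂ L ⁅E.vec α.1, E.vec β.1⁆ (E.vec γ.1) * hs
  · have hN := not_ne_iff.1 fun h' => h (E.killing_lie_ne_zero_iff.1 h')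
    exact ⟨fun _ h' => absurd h' h, fun _ => by rw [hN, mul_zero, mul_zero, mul_zero, sub_zero]⟩

theorem toM_schouten_kks_iff {f : ⋀[ℂ]^2 L} {s : H.root → ℂ}
    (hf : ∀ α : H.root, toEndo f (E.vec α.1) = s α • E.vec α.1) :
    toM E Γ (schouten f (kks b E Γ lam)) = 0 ↔
      ∀ α β γ : H.root, α ∉ leviRoots Γ → β ∉ leviRoots Γ → γ ∉ leviRoots Γ →
        (rootSystem H).root α + (rootSystem H).root β + (rootSystem H).root γ = 0 →
          dualFunctional H lam ((rootSystem H).root α) ^ 2 * s α +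
            dualFunctional H lam ((rootSystem H).root β) ^ 2 * s β +
            dualFunctional H lam ((rootSystem H).root γ) ^ 2 * s γ = 0 := by
  classical
  rw [toM_eq_zero_iff hlam (schouten_mem _ _), kks_eq b hlam]
  have hv := toEndo_rootBivector_vec (E := E) b
    (g := fun α => (dualFunctional H lam ((rootSystem H).root α))⁻¹) (by
      intro α
      rw [root_negRoot, map_neg, inv_neg])
  refine forall₃_congr fun α β γ => forall₃_congr fun hα hβ hγ => ?_
  rw [evalTrivector_schouten_vec hf hv]
  have hne : ∀ δ : H.root, δ ∉ leviRoots Γ → dualFunctional H lam ((rootSystem H).root δ) ≠ 0 :=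
    fun δ hδ h => hδ ((dualFunctional_root_eq_zero_iff hlam δ).1 h)
  by_cases h : (rootSystem H).root α + (rootSystem H).root β + (rootSystem H).root γ = 0
  · have hN := E.killing_lie_ne_zero_iff.2 h
    have hsum := congrArg (dualFunctional H lam) h
    rw [map_add, map_add, map_zero] at hsum
    have h1 := hne α hα
    have h2 := hne β hβ
    have h3 := hne γ hγ
    set x := dualFunctional H lam ((rootSystem H).root α)
    set y := dualFunctional H lam ((rootSystem H).root β)
    set z := dualFunctional H lam ((rootSystem H).root γ)
    -- The coefficient of `s α` is `-(y + z) / (y * z)`, which is `x / (y * z)` because `x + y + z =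
    -- 0`; similarly for the others.
    have h4 : s α * -y⁻¹ + -x⁻¹ * s β + s β * -z⁻¹ + -y⁻¹ * s γ + s γ * -x⁻¹ + -z⁻¹ * s α =
        (x ^ 2 * s α + y ^ 2 * s β + z ^ 2 * s γ) / (x * y * z) := by
      field_simp
      linear_combination -(s α * x + s β * y + s γ * z) * hsum
    rw [h4, mul_eq_zero, or_iff_left hN, div_eq_zero_iff, or_iff_left (by simp [h1, h2, h3])]
    exact ⟨fun h' _ => h', fun h' => h' h⟩
  · have hN := not_ne_iff.1 fun h' => h (E.killing_lie_ne_zero_iff.1 h')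
    exact ⟨fun _ h' => absurd h' h, fun _ => by rw [hN, mul_zero]⟩

end

end

end GoodOrbit

end

/-! ### Good orbits and quadratic pairs. -/

section

open Module LieModule LieAlgebra LieAlgebra.IsKilling
open scoped ExteriorAlgebra

namespace GoodOrbit

section

variable {L : Type*} [LieRing L] [LieAlgebra ℂ L] [FiniteDimensional ℂ L] [LieAlgebra.IsKilling ℂ L]
  {H : LieSubalgebra ℂ L} [H.IsCartanSubalgebra] {E : RootVectors H} {Γ : Finset H.root}

omit [FiniteDimensional ℂ L] in
theorem lie_toEndo_of_adBivector_eq_zero {x : L} {f : ⋀[ℂ]^2 L} (h : adBivector x f = 0) (a : L) :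
    ⁅x, toEndo f a⁆ = toEndo f ⁅x, a⁆ := by
  rw [← sub_eq_zero]
  refine eq_zero_of_killingForm fun b => ?_
  rw [← evalBivector_adBivector, h, map_zero]

theorem adBivector_eq_zero_of_lie_toEndo {x : L} {f : ⋀[ℂ]^2 L}
    (h : ∀ a, ⁅x, toEndo f a⁆ = toEndo f ⁅x, a⁆) : adBivector x f = 0 := by
  refine eq_zero_of_evalBivector (adBivector_mem x f) fun d₁ d₂ => ?_
  obtain ⟨a, rfl⟩ := ((killingForm ℂ L).toDual (killingForm_nondegenerate ℂ L)).surjective d₁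
  obtain ⟨b, rfl⟩ := ((killingForm ℂ L).toDual (killingForm_nondegenerate ℂ L)).surjective d₂
  refine (evalBivector_adBivector x a b f).trans ?_
  rw [h, sub_self, map_zero, LinearMap.zero_apply]

theorem exists_toEndo_vec_eq_smul {f : ⋀[ℂ]^2 L} (h : ∀ x ∈ H, adBivector x f = 0) :
    ∃ s : H.root → ℂ, ∀ α : H.root, toEndo f (E.vec α.1) = s α • E.vec α.1 := by
  have key : ∀ α : H.root, ∃ c : ℂ, toEndo f (E.vec α.1) = c • E.vec α.1 := by
    intro α
    refine E.exists_eq_smul α ((mem_genWeightSpace L α.1 _).2 fun x => ⟨1, ?_⟩)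
    have h1 : ⁅(x : L), toEndo f (E.vec α.1)⁆ = α.1 x • toEndo f (E.vec α.1) := by
      rw [lie_toEndo_of_adBivector_eq_zero (h x x.2), E.lie_cartan, map_smul]
    rw [pow_one, LinearMap.sub_apply, toEnd_apply_apply, LinearMap.smul_apply, Module.End.one_apply,
      sub_eq_zero]
    exact h1
  choose s hs using key
  exact ⟨s, hs⟩

theorem eq_neg_of_toEndo_vec {f : ⋀[ℂ]^2 L} {s : H.root → ℂ}
    (hs : ∀ α : H.root, toEndo f (E.vec α.1) = s α • E.vec α.1) (α : H.root) :
    s (negRoot α) = -s α := by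
  have h1 := toEndo_skew f (E.vec α.1) (E.vec (negRoot α).1)
  rw [hs, hs, map_smul, map_smul, LinearMap.smul_apply, E.killing_vec, if_pos rfl, smul_eq_mul,
    smul_eq_mul, mul_one, mul_one] at h1
  rw [h1, neg_neg]

/-- The endomorphism commutes with `ad E_α`, which maps `E_β` to a nonzero multiple of `E_γ`. So `s`
is unchanged by adding roots of `Ω_Γ`. -/
theorem eq_of_toEndo_vec {f : ⋀[ℂ]^2 L} {s : H.root → ℂ}
    (hs : ∀ α : H.root, toEndo f (E.vec α.1) = s α • E.vec α.1) {α β γ : H.root}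
    (h : (rootSystem H).root γ = (rootSystem H).root α + (rootSystem H).root β)
    (hα : adBivector (E.vec α.1) f = 0) : s γ = s β := by
  obtain ⟨c, hc, hcc⟩ := E.exists_lie_vec_eq_smul h
  have h1 := lie_toEndo_of_adBivector_eq_zero hα (E.vec β.1)
  rw [hs, lie_smul, hcc, map_smul, hs, smul_comm, smul_right_inj hc] at h1
  exact (smul_left_injective ℂ (E.ne_zero γ) h1).symm

theorem lie_vec_eq_zero {α β : H.root} (h0 : β ≠ negRoot α)
    (h : ∀ γ : H.root, (rootSystem H).root γ ≠ (rootSystem H).root α + (rootSystem H).root β) :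
    ⁅E.vec α.1, E.vec β.1⁆ = 0 := by
  by_contra hne
  have h1 := lie_mem_genWeightSpace_of_mem_genWeightSpace (E.mem α) (E.mem β)
  have h2 : genWeightSpace L (α.1 + β.1 : H → ℂ) ≠ ⊥ := by
    intro h3
    rw [h3] at h1
    exact hne h1
  let γ : Weight ℂ H L := ⟨α.1 + β.1, h2⟩
  have hγ : γ.IsNonZero := by
    intro h3
    apply h0
    apply Subtype.ext
    apply DFunLike.coe_injective
    rw [eq_neg_of_add_eq_zero_right h3]
    rfl
  apply h ⟨γ, by simpa using hγ⟩
  ext x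
  rfl

variable (b : (rootSystem H).Base) {lam : Dual ℂ L} (hlam : coadjointStabilizer lam = levi E Γ)
include hlam

theorem exists_isQuadraticPair_of_isGood (h : IsGood b E Γ lam) :
    ∃ m c, c ≠ 0 ∧ (rootSystem H).IsQuadraticPair (dualFunctional H lam) m c := by
  obtain ⟨f, ⟨-, hinv⟩, ⟨c, hc, h1⟩, h2⟩ := h
  obtain ⟨s, hs⟩ := exists_toEndo_vec_eq_smul (E := E) fun x hx =>
    hinv x (mem_levi_of_mem_cartan hx)
  rw [toM_schouten_self_iff b hlam hs] at h1
  rw [toM_schouten_kks_iff b hlam hs] at h2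
  have hodd := eq_neg_of_toEndo_vec hs
  set l := dualFunctional H lam with hl
  have hl0 : ∀ α : H.root, l ((rootSystem H).root α) = 0 ↔ α ∈ leviRoots Γ :=
    dualFunctional_root_eq_zero_iff hlam
  -- The hypothesis `h2` speaks only of roots outside `Ω_Γ`. When one root is in `Ω_Γ`, invariance
  -- of `f` gives the same identity, so additivity holds throughout.
  have hA : ∀ α β γ : H.root, α ∈ leviRoots Γ →
      (rootSystem H).root α + (rootSystem H).root β + (rootSystem H).root γ = 0 →
      l ((rootSystem H).root α) ^ 2 * s α + l ((rootSystem H).root β) ^ 2 * s β +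
        l ((rootSystem H).root γ) ^ 2 * s γ = 0 := by
    intro α β γ hα h
    have h3 := eq_of_toEndo_vec hs (α := α) (β := β) (γ := negRoot γ) (by
      rw [root_negRoot, eq_neg_of_add_eq_zero_left h]) (hinv _ (vec_mem_levi hlam hα))
    rw [hodd] at h3
    have h4 := congrArg l h
    rw [map_add, map_add, map_zero, (hl0 α).2 hα, zero_add] at h4
    rw [(hl0 α).2 hα, eq_neg_of_add_eq_zero_left h4, ← h3]
    ring
  have hsum : ∀ α β γ : H.root,
      (rootSystem H).root α + (rootSystem H).root β + (rootSystem H).root γ = 0 →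
      l ((rootSystem H).root α) ^ 2 * s α + l ((rootSystem H).root β) ^ 2 * s β +
        l ((rootSystem H).root γ) ^ 2 * s γ = 0 := by
    intro α β γ h
    by_cases hα : α ∈ leviRoots Γ
    · exact hA α β γ hα h
    by_cases hβ : β ∈ leviRoots Γ
    · have := hA β γ α hβ (by rw [← h]; abel)
      linear_combination this
    by_cases hγ : γ ∈ leviRoots Γ
    · have := hA γ α β hγ (by rw [← h]; abel)
      linear_combination this
    exact h2 α β γ hα hβ hγ h
  obtain ⟨m, hm⟩ := RootPairing.exists_dual_of_additive b
    (fun α => l ((rootSystem H).root α) ^ 2 * s α) (fun α => by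
      rw [reflectionPerm_self_eq_negRoot, hodd, root_negRoot, map_neg]
      ring) (fun α β γ h => by
      have h3 := hsum α β (negRoot γ) (by rw [root_negRoot, h, add_neg_cancel])
      rw [hodd, root_negRoot, map_neg] at h3
      linear_combination -h3)
  refine ⟨m, c, hc, fun α hα => by rw [hm, hα]; ring, fun α β γ h => ?_⟩
  have h4 := congrArg l h
  have h5 := congrArg m h
  rw [map_add] at h4 h5
  rw [hm α, hm β, hm γ] at h5
  rw [hm, hm]
  by_cases hα : α ∈ leviRoots Γ
  · rw [(hl0 α).2 hα]
    ring
  by_cases hβ : β ∈ leviRoots Γ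
  · rw [(hl0 β).2 hβ]
    ring
  by_cases hγ : γ ∈ leviRoots Γ
  -- Here the right side vanishes, and the additivity of `m` makes the left side vanish too.
  · rw [(hl0 γ).2 hγ] at h4 h5 ⊢
    have h6 : l ((rootSystem H).root β) = -l ((rootSystem H).root α) :=
      eq_neg_of_add_eq_zero_right h4.symm
    rw [h6] at h5 ⊢
    have h7 : l ((rootSystem H).root α) ^ 2 * (s α + s β) = 0 := by linear_combination -h5
    linear_combination (l ((rootSystem H).root α) ^ 4 * (s α + s β)) * h7
  · have h3 := h1 α β (negRoot γ) hα hβ (mt negRoot_mem_leviRoots_iff.1 hγ)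
      (by rw [root_negRoot, h, add_neg_cancel])
    rw [hodd] at h3
    set x := l ((rootSystem H).root α)
    set y := l ((rootSystem H).root β)
    rw [h4] at h5 ⊢
    linear_combination (-x ^ 2 * y ^ 2 * (x + y) ^ 2) * h3 - (x ^ 2 * y ^ 2 * (s α + s β)) * h5

theorem isGood_of_isQuadraticPair {m : Dual ℂ (Dual ℂ H)} {c : ℂ} (hc : c ≠ 0)
    (h : (rootSystem H).IsQuadraticPair (dualFunctional H lam) m c) : IsGood b E Γ lam := by
  classical
  set l := dualFunctional H lam with hl
  have hl0 : ∀ α : H.root, l ((rootSystem H).root α) = 0 ↔ α ∈ leviRoots Γ :=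
    dualFunctional_root_eq_zero_iff hlam
  -- This inverts `m = l ^ 2 * s`. On `Ω_Γ` the quotient is zero, so that `f` below has no
  -- components along `g_Γ`.
  let s : H.root → ℂ := fun α => m ((rootSystem H).root α) / l ((rootSystem H).root α) ^ 2
  have hs0 : ∀ α ∈ leviRoots Γ, s α = 0 := by
    intro α hα
    simp only [s, (hl0 α).2 hα]
    simp
  have hodd : ∀ α, s (negRoot α) = -s α := by
    intro α
    simp only [s, root_negRoot, map_neg, neg_sq, neg_div]
  let f := rootBivector b E fun α => -s α
  have hs : ∀ α : H.root, toEndo f (E.vec α.1) = s α • E.vec α.1 := by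
    intro α
    rw [toEndo_rootBivector_vec b (fun α => by rw [hodd]), neg_neg]
  have hsH : ∀ x ∈ H, toEndo f x = 0 := fun x hx => toEndo_rootBivector_cartan b _ hx
  have hinv : ∀ α β γ : H.root, α ∈ leviRoots Γ →
      (rootSystem H).root γ = (rootSystem H).root α + (rootSystem H).root β → s γ = s β := by
    intro α β γ hα hαβ
    have h1 := (hl0 α).2 hα
    simp only [s, hαβ, map_add, h1, h.1 α h1, zero_add]
  have hvec : ∀ α ∈ leviRoots Γ, ∀ a, ⁅E.vec α.1, toEndo f a⁆ = toEndo f ⁅E.vec α.1, a⁆ := by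
    intro α hα
    suffices (LieAlgebra.ad ℂ L (E.vec α.1) : L →ₗ[ℂ] L) ∘ₗ toEndo f =
        toEndo f ∘ₗ (LieAlgebra.ad ℂ L (E.vec α.1) : L →ₗ[ℂ] L) from
      fun a => LinearMap.congr_fun this a
    refine E.hom_ext (fun x hx => ?_) fun β => ?_
    · have h1 : ⁅x, E.vec α.1⁆ = α.1 ⟨x, hx⟩ • E.vec α.1 := E.lie_cartan α ⟨x, hx⟩
      simp only [LinearMap.comp_apply, LieAlgebra.ad_apply]
      rw [hsH x hx, lie_zero, ← lie_skew, h1, map_neg, map_smul, hs, hs0 α hα, zero_smul, smul_zero,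
        neg_zero]
    · simp only [LinearMap.comp_apply, LieAlgebra.ad_apply]
      rw [hs, lie_smul]
      by_cases hβ : β = negRoot α
      · have h1 : ⁅E.vec α.1, E.vec β.1⁆ ∈ H := by
          rw [hβ]
          exact (E.lie_vec_neg α).symm ▸ Subtype.mem _
        rw [hsH _ h1, hβ, hodd, hs0 α hα, neg_zero, zero_smul]
      by_cases hγ : ∃ γ : H.root,
          (rootSystem H).root γ = (rootSystem H).root α + (rootSystem H).root β
      · obtain ⟨γ, hγ⟩ := hγ
        obtain ⟨d, -, hd⟩ := E.exists_lie_vec_eq_smul hγ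
        rw [hd, map_smul, hs, hinv α β γ hα hγ, smul_comm]
      · push Not at hγ
        rw [lie_vec_eq_zero hβ hγ, smul_zero, map_zero]
  -- Elements whose adjoint action commutes with `toEndo f` form a subalgebra, so invariance needs
  -- checking only on the generators of `levi E Γ`.
  let S : LieSubalgebra ℂ L :=
    { carrier := {x | ∀ a, ⁅x, toEndo f a⁆ = toEndo f ⁅x, a⁆}
      add_mem' := fun {x y} hx hy a => by rw [add_lie, add_lie, hx, hy, map_add]
      zero_mem' := fun a => by rw [zero_lie, zero_lie, map_zero]
      smul_mem' := fun r x hx a => by rw [smul_lie, smul_lie, hx, map_smul]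
      lie_mem' := fun {x y} hx hy a => by
        rw [lie_lie, lie_lie, hx, hy, hx, hy, map_sub] }
  have hS : levi E Γ ≤ S := by
    refine LieSubalgebra.lieSpan_le.2 ?_
    have hΓ : ∀ α ∈ Γ, α ∈ leviRoots Γ := fun α hα => Submodule.subset_span ⟨α, hα, rfl⟩
    rintro x (hx | ⟨α, hα, rfl | rfl⟩)
    · suffices (LieAlgebra.ad ℂ L x : L →ₗ[ℂ] L) ∘ₗ toEndo f =
          toEndo f ∘ₗ (LieAlgebra.ad ℂ L x : L →ₗ[ℂ] L) from
        fun a => LinearMap.congr_fun this a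
      refine E.hom_ext (fun y hy => ?_) fun β => ?_
      · simp only [LinearMap.comp_apply, LieAlgebra.ad_apply]
        rw [hsH y hy, hsH _ (H.lie_mem hx hy), lie_zero]
      · have h1 : ⁅x, E.vec β.1⁆ = β.1 ⟨x, hx⟩ • E.vec β.1 := E.lie_cartan β ⟨x, hx⟩
        simp only [LinearMap.comp_apply, LieAlgebra.ad_apply]
        rw [hs, lie_smul, h1, map_smul, hs, smul_comm]
    · exact hvec α (hΓ α hα)
    · exact hvec (negRoot α) (negRoot_mem_leviRoots_iff.2 (hΓ α hα))
  refine ⟨f, ⟨?_, fun x hx => adBivector_eq_zero_of_lie_toEndo (hS hx)⟩, ⟨c, hc, ?_⟩, ?_⟩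
  · refine Submodule.sum_mem _ fun α _ => ?_
    by_cases hα : α ∈ leviRoots Γ
    · beta_reduce
      rw [hs0 α hα, neg_zero, zero_smul]
      exact Submodule.zero_mem _
    · exact Submodule.smul_mem _ _ (Submodule.subset_span ⟨_, Submodule.subset_span ⟨α, hα, rfl⟩, _,
        Submodule.subset_span ⟨negRoot α, mt negRoot_mem_leviRoots_iff.1 hα, rfl⟩, rfl⟩)
  · rw [toM_schouten_self_iff b hlam hs]
    intro α β γ hα hβ hγ hsum
    have h1 : (rootSystem H).root (negRoot γ) =
        (rootSystem H).root α + (rootSystem H).root β := by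
      rw [root_negRoot, eq_neg_of_add_eq_zero_left hsum]
    have h2 := h.2 α β _ h1
    have h3 : m ((rootSystem H).root γ) =
        -(m ((rootSystem H).root α) + m ((rootSystem H).root β)) := by
      rw [← map_add, ← h1, root_negRoot, map_neg, neg_neg]
    have h4 : l ((rootSystem H).root γ) =
        -(l ((rootSystem H).root α) + l ((rootSystem H).root β)) := by
      rw [← map_add, ← h1, root_negRoot, map_neg, neg_neg]
    have h5 : l ((rootSystem H).root α) ≠ 0 := mt (hl0 α).1 hα
    have h6 : l ((rootSystem H).root β) ≠ 0 := mt (hl0 β).1 hβ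
    have h7 : l ((rootSystem H).root γ) ≠ 0 := mt (hl0 γ).1 hγ
    rw [root_negRoot, map_neg] at h2
    simp only [s]
    rw [h4] at h2 h7 ⊢
    rw [h3]
    set x := l ((rootSystem H).root α)
    set y := l ((rootSystem H).root β)
    have h8 : x + y ≠ 0 := fun e => h7 (by rw [e, neg_zero])
    field_simp
    linear_combination -h2
  · rw [toM_schouten_kks_iff b hlam hs]
    intro α β γ hα hβ hγ hsum
    have h5 : l ((rootSystem H).root α) ≠ 0 := mt (hl0 α).1 hα
    have h6 : l ((rootSystem H).root β) ≠ 0 := mt (hl0 β).1 hβ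
    have h7 : l ((rootSystem H).root γ) ≠ 0 := mt (hl0 γ).1 hγ
    have h8 := congrArg m hsum
    rw [map_add, map_add, map_zero] at h8
    rw [← hl, ← h8]
    simp only [s]
    field_simp

end

end GoodOrbit

end

/-! ### The classification of good orbits. -/

open GoodOrbit LieAlgebra.IsKilling in
theorem proposition3p5 {L : Type*} [LieRing L] [LieAlgebra ℂ L] [FiniteDimensional ℂ L]
    [LieAlgebra.IsSimple ℂ L] (H : LieSubalgebra ℂ L) [H.IsCartanSubalgebra]
    (b : (rootSystem H).Base) (E : RootVectors H)
    (Γ : Finset H.root) (hΓ : Γ ⊆ b.support)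
    (lam : Module.Dual ℂ L) (hlam : coadjointStabilizer lam = levi E Γ) :
    (IsTypeA b → IsGood b E Γ lam) ∧
    (¬ IsTypeA b → Γ ≠ b.support →
      (IsGood b E Γ lam ↔
        (((b.support : Set H.root) \ Γ).ncard = 1 ∨ ((b.support : Set H.root) \ Γ).ncard = 2) ∧
        ∃ θ : H.root, IsMaximalRoot b θ ∧
          ∀ (i : H.root) (hi : i ∈ b.support), i ∉ Γ →
            b.toWeightBasis.repr ((rootSystem H).root θ) ⟨i, hi⟩ = 1)) ∧
    (IsGood b E Γ lam ↔ ∃ k : ℕ, IsIsoToRootsA (quasiroots Γ) k) := by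
  have hl := dualFunctional_root_eq_zero_iff hlam
  have hlΓ : rootSpan Γ ≤ LinearMap.ker (dualFunctional H lam) := by
    refine Submodule.span_le.2 ?_
    rintro _ ⟨α, hα, rfl⟩
    exact (hl α).2 (Submodule.subset_span ⟨α, hα, rfl⟩)
  refine ⟨fun ⟨n, e, he⟩ => ?_, fun hA hne => ⟨fun h => ?_, fun ⟨hcard, θ, hθ, h⟩ => ?_⟩,
    fun h => ?_, fun ⟨k, e, he⟩ => ?_⟩
  · obtain ⟨m, hm⟩ := b.exists_isQuadraticPair_of_cartanMatrix_A e he (dualFunctional H lam)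
    exact isGood_of_isQuadraticPair b hlam one_ne_zero hm
  · obtain ⟨m, c, hc, hm⟩ := exists_isQuadraticPair_of_isGood b hlam h
    obtain ⟨h1, θ, hθ, h2⟩ := hm.ncard_eq_one_or_two hc hΓ hl hne hA
    exact ⟨h1, θ, hθ, fun i hi hiΓ => h2 ⟨i, hi⟩ hiΓ⟩
  · obtain ⟨m, hm⟩ := b.exists_isQuadraticPair_of_ncard
      (fun i hi => hlΓ (Submodule.subset_span ⟨i, hi, rfl⟩)) hcard hθ fun d hd => h d.1 d.2 hd
    exact isGood_of_isQuadraticPair b hlam one_ne_zero hm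
  · obtain ⟨m, c, hc, hm⟩ := exists_isQuadraticPair_of_isGood b hlam h
    obtain ⟨k, e, he⟩ := hm.exists_equiv b hc hl
    exact ⟨k, e, he⟩
  · obtain ⟨m, hm⟩ := RootPairing.exists_isQuadraticPair_of_equiv e he hlΓ
    exact isGood_of_isQuadraticPair b hlam one_ne_zero hm
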